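/- **Setting.** Let $d\ge 2$ and let $\Omega\subset\mathbb R^d$ be bounded and open. Let $g(s)=\sum_{i=0}^N a_i s^{\alpha_i}$ with $N\ge1$, $0=\alpha_0<\alpha_1<\dots<\alpha_N$ real, $a_i\ge 0$, $a_0>0$, $a_N>0$. For $\xi\ge0$ let $s(\xi)\ge0$ be the unique solution of $s\,g(s)=\xi$ and put $K(\xi)=1/g(s(\xi))$. Put $a=\frac{\alpha_N}{\alpha_N+1}$, $\beta=2-a$, $\lambda=\frac{2-a}{1-a}$, and assume the degree condition $a\le \frac{4}{d+2}$. Write $\|\cdot\|$ and $(\cdot,\cdot)$ for the norm and inner product of $L^2(\Omega)$ (and of $(L^2(\Omega))^d$) and $\|\cdot\|_1$ for the norm of $H^1(\Omega)$. *Meshes.* A triangulation $\mathcal T_h$ of $\Omega$ is a finite family of pairwise disjoint nonempty open sets $T\subset\Omega$ (elements, e.g. open simplices, possibly curved along the boundary) that covers $\Omega$ up to a null set; $h$ is the largest diameter of an element. It is quasiuniform with constant $\sigma>0$ if every element contains a ball of radius $\sigma h$ and is star-shaped with respect to each point of that ball. For an integer $r\ge0$, $W_h\subset L^2(\Omega)$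 is the space of discontinuous piecewise polynomials of degree at most $r$ over $\mathcal T_h$, $\nabla$ is taken element by element on $W_h$, and $\pi:L^2(\Omega)\to W_h$ is the $L^2$-projection. *Data.* Let $\rho^0\in H^1(\Omega)$, let $\phi\in C^1([0,\infty);H^1(\Omega))$ (an extension of the boundary data), and let $f:[0,\infty)\to L^2(\Omega)$ be such that $\tilde f=f-\phi_t\in C^1([0,\infty);L^2(\Omega))$. Put $\phi^0=\phi(0)$, $\tilde\rho^0=\rho^0-\phi^0$, and $$\mathfrak g(t)=\|\tilde f(t)\|^{\lambda}+\|\phi(t)\|_1^2 .$$ $Env\,\mathfrak g$ denotes any continuous nondecreasing function on $[0,\infty)$ with $Env\,\mathfrak g(t)\ge \mathfrak g(t)$ for all $t\ge0$. *Semidiscrete problem.* $\tilde\rho_h:[0,\infty)\to W_h$ solves the semidiscrete problem if it is continuous on $[0,\infty)$, differentiable on $(0,\infty)$, $\tilde\rho_h(0)=\pi\tilde\rho^0$ and, with $\rho_h=\tilde\rho_h+\pi\phi$, $$(\tilde\rho_{h,t},w_h)+\big(K(|\nabla\rho_h|)\nabla\rho_h,\nabla w_h\big)=(\tilde f,w_h)\qquad\text{for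 all } w_h\in W_h,\ t>0 .$$ **Theorem.** There is a constant $C>0$, depending only on $g,d,\Omega,r,\sigma$ (thus independent of the mesh and of $h$, of the data, of $t_0$ and of $t$), such that for every triangulation of $\Omega$ that is quasiuniform with constant $\sigma$, all data as above and every solution $\tilde\rho_h$ of the semidiscrete problem: 1. for all $0<t_0<1$, all $t\ge t_0$ and every envelope $Env\,\mathfrak g$, $$\|\tilde\rho_{h,t}(t)\|^2\le C\,\mathcal B(t),$$ where $$\begin{aligned}\mathcal B(t)={}&t_0^{-1}e^{-\frac14(t-t_0)}\Big\{1+\|\rho^0\|_1^2+\|\phi^0\|^2+\int_0^{t_0}\big(\|\phi_t(s)\|_1^2+(Env\,\mathfrak g(s))^{\frac2\beta}\big)ds\Big\}\\&+\int_0^t e^{-\frac14(t-s)}\Big(1+\|\tilde\rho^0\|^2+\|\phi_t(s)\|_1^2+\|\tilde f_t(s)\|^2+(Env\,\mathfrak g(s))^{\frac2\beta}\Big)ds;\end{aligned}$$ 2. in $[0,\infty]$, $$\limsup_{t\to\infty}\|\tilde\rho_{h,t}(t)\|^2\le C\Big(1+\big(\limsup_{t\to\infty}\mathfrak g(t)\big)^{\frac2\beta}+\limsup_{t\to\infty}\|\phi_t(t)\|_1^2+\limsup_{t\to\infty}\|\tilde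 f_t(t)\|^2\Big).$$ -/

import Mathlib

open MeasureTheory Set Filter Topology
open scoped ENNReal NNReal ContDiff RealInnerProductSpace

noncomputable section

namespace ForchheimerFlow

/-! ### The Forchheimer law -/

/-- A generalized polynomial `g(s) = a₀ s^{α₀} + ⋯ + a_N s^{α_N}` with `N ≥ 1`,
`0 = α₀ < α₁ < ⋯ < α_N`, `a_i ≥ 0`, `a₀ > 0` and `a_N > 0`. -/
structure Law where
  N : ℕ
  one_le_N : 1 ≤ N
  /-- the exponents `α_i` -/
  α : Fin (N + 1) → ℝ
  /-- the coefficients `a_i` -/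
  coeff : Fin (N + 1) → ℝ
  α_zero : α 0 = 0
  α_strictMono : StrictMono α
  coeff_nonneg : ∀ i, 0 ≤ coeff i
  coeff_zero_pos : 0 < coeff 0
  coeff_last_pos : 0 < coeff (Fin.last N)

namespace Law

variable (g : Law)

/-- `g(s)`, for `s ≥ 0`. -/
def eval (s : ℝ) : ℝ := ∑ i, g.coeff i * s ^ g.α i

/-- `deg g = α_N`. -/
def deg : ℝ := g.α (Fin.last g.N)

/-- For `ξ ≥ 0`, the unique solution `s ≥ 0` of `s g(s) = ξ`. -/
def root (ξ : ℝ) : ℝ := Function.invFunOn (fun s : ℝ => s * g.eval s) (Ici 0) ξ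

/-- `K(ξ) = 1 / g(s(ξ))`, for `ξ ≥ 0`. -/
def K (ξ : ℝ) : ℝ := 1 / g.eval (g.root ξ)

/-- `a = α_N / (α_N + 1)`. -/
def a : ℝ := g.deg / (g.deg + 1)

/-- `β = 2 - a`. -/
def β : ℝ := 2 - g.a

/-- `λ = (2 - a) / (1 - a)`. -/
def lam : ℝ := (2 - g.a) / (1 - g.a)

end Law

/-! ### `L²(Ω)` and `H¹(Ω)` -/

/-- `ℝ^d` with its Euclidean norm. -/
abbrev Space (d : ℕ) := EuclideanSpace ℝ (Fin d)

variable {d : ℕ}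

/-- `L²(Ω)`. -/
abbrev L2 (Ω : Set (Space d)) := Lp ℝ 2 (volume.restrict Ω)

/-- `(L²(Ω))^d`. -/
abbrev L2Vec (Ω : Set (Space d)) := Lp (Space d) 2 (volume.restrict Ω)

/-- `ψ` is a test function on `Ω`: smooth, with compact support inside `Ω`. -/
def IsTestFunction (Ω : Set (Space d)) (ψ : Space d → ℝ) : Prop :=
  ContDiff ℝ ∞ ψ ∧ HasCompactSupport ψ ∧ tsupport ψ ⊆ Ω

/-- `G` is the weak (distributional) gradient of `u` in `Ω`. -/
def HasWeakGradient (Ω : Set (Space d)) (u : L2 Ω) (G : L2Vec Ω) : Prop :=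
  ∀ ψ : Space d → ℝ, IsTestFunction Ω ψ →
    ∫ x in Ω, u x • gradient ψ x = - ∫ x in Ω, ψ x • G x

theorem IsTestFunction.memLp {Ω : Set (Space d)} {ψ : Space d → ℝ}
    (h : IsTestFunction Ω ψ) : MemLp ψ 2 (volume.restrict Ω) :=
  (h.1.continuous.memLp_of_hasCompactSupport h.2.1).restrict _

theorem IsTestFunction.memLp_gradient {Ω : Set (Space d)} {ψ : Space d → ℝ}
    (h : IsTestFunction Ω ψ) : MemLp (gradient ψ) 2 (volume.restrict Ω) := by
  have hc : Continuous (gradient ψ) :=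
    (InnerProductSpace.toDual ℝ (Space d)).symm.continuous.comp
      (h.1.continuous_fderiv (by simp))
  have hs : HasCompactSupport (gradient ψ) :=
    (h.2.1.fderiv ℝ).comp_left (g := (InnerProductSpace.toDual ℝ (Space d)).symm) (map_zero _)
  exact (hc.memLp_of_hasCompactSupport hs).restrict _

/-- `H¹(Ω)`, as the space of pairs `(u, ∇u)` inside `L²(Ω) × (L²(Ω))^d`. The norm it inherits from
the `ℓ²`-product is `‖u‖₁ = (‖u‖² + ‖∇u‖²)^{1/2}`. -/
def H1 (Ω : Set (Space d)) : Submodule ℝ (WithLp 2 (L2 Ω × L2Vec Ω)) where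
  carrier := {p | HasWeakGradient Ω p.fst p.snd}
  zero_mem' := by
    intro ψ _
    have h1 : ∫ x in Ω, (0 : L2 Ω) x • gradient ψ x = 0 := by
      rw [integral_congr_ae (g := fun _ => 0), integral_zero]
      filter_upwards [Lp.coeFn_zero ℝ 2 (volume.restrict Ω)] with x hx
      rw [hx, Pi.zero_apply, zero_smul]
    have h2 : ∫ x in Ω, ψ x • (0 : L2Vec Ω) x = 0 := by
      rw [integral_congr_ae (g := fun _ => 0), integral_zero]
      filter_upwards [Lp.coeFn_zero (Space d) 2 (volume.restrict Ω)] with x hx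
      rw [hx, Pi.zero_apply, smul_zero]
    simp only [WithLp.zero_fst, WithLp.zero_snd]
    rw [h1, h2, neg_zero]
  add_mem' := by
    intro p q hp hq ψ hψ
    have i1 : ∀ u : L2 Ω, Integrable (fun x => u x • gradient ψ x) (volume.restrict Ω) :=
      fun u => memLp_one_iff_integrable.1 (hψ.memLp_gradient.smul (Lp.memLp u))
    have i2 : ∀ G : L2Vec Ω, Integrable (fun x => ψ x • G x) (volume.restrict Ω) :=
      fun G => memLp_one_iff_integrable.1 ((Lp.memLp G).smul hψ.memLp)
    have h1 : ∫ x in Ω, (p + q).fst x • gradient ψ x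
        = ∫ x in Ω, p.fst x • gradient ψ x + q.fst x • gradient ψ x := by
      apply integral_congr_ae
      filter_upwards [Lp.coeFn_add p.fst q.fst] with x hx
      rw [WithLp.add_fst, hx, Pi.add_apply, add_smul]
    have h2 : ∫ x in Ω, ψ x • (p + q).snd x
        = ∫ x in Ω, ψ x • p.snd x + ψ x • q.snd x := by
      apply integral_congr_ae
      filter_upwards [Lp.coeFn_add p.snd q.snd] with x hx
      rw [WithLp.add_snd, hx, Pi.add_apply, smul_add]
    rw [h1, h2, integral_add (i1 _) (i1 _), integral_add (i2 _) (i2 _), hp ψ hψ, hq ψ hψ, neg_add]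
  smul_mem' := by
    intro c p hp ψ hψ
    have h1 : ∫ x in Ω, (c • p).fst x • gradient ψ x
        = ∫ x in Ω, c • (p.fst x • gradient ψ x) := by
      apply integral_congr_ae
      filter_upwards [Lp.coeFn_smul c p.fst] with x hx
      rw [WithLp.smul_fst, hx, Pi.smul_apply, smul_assoc]
    have h2 : ∫ x in Ω, ψ x • (c • p).snd x
        = ∫ x in Ω, c • (ψ x • p.snd x) := by
      apply integral_congr_ae
      filter_upwards [Lp.coeFn_smul c p.snd] with x hx
      rw [WithLp.smul_snd, hx, Pi.smul_apply, smul_comm]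
    rw [h1, h2, integral_smul, integral_smul, hp ψ hψ, smul_neg]

/-- The inclusion `H¹(Ω) → L²(Ω)`. -/
def incl {Ω : Set (Space d)} (u : H1 Ω) : L2 Ω := (u : WithLp 2 (L2 Ω × L2Vec Ω)).fst

/-! ### Triangulations and piecewise polynomials -/

/-- A finite subdivision of `Ω` into pairwise disjoint nonempty bounded open elements, covering `Ω`
up to a null set. The elements need not be simplices, so that curved elements along a smooth
boundary are allowed. -/
structure Triangulation (Ω : Set (Space d)) where
  elements : Finset (Set (Space d))
  isOpen : ∀ T ∈ elements, IsOpen T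
  nonempty : ∀ T ∈ elements, T.Nonempty
  isBounded : ∀ T ∈ elements, Bornology.IsBounded T
  subset : ∀ T ∈ elements, T ⊆ Ω
  disjoint : (elements : Set (Set (Space d))).PairwiseDisjoint id
  covers : volume (Ω \ ⋃ T ∈ elements, T) = 0

namespace Triangulation

variable {Ω : Set (Space d)} (𝒯 : Triangulation Ω)

/-- The mesh size `h`: the largest diameter of an element. -/
def meshSize : ℝ := sSup (Metric.diam '' (𝒯.elements : Set (Set (Space d))))

/-- Quasiuniformity with constant `σ`: each element is star-shaped with respect to every point of
some ball of radius `σ h` that it contains. -/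
def IsQuasiUniform (σ : ℝ) : Prop :=
  ∀ T ∈ 𝒯.elements, ∃ c : Space d, Metric.ball c (σ * 𝒯.meshSize) ⊆ T ∧
    ∀ y ∈ Metric.ball c (σ * 𝒯.meshSize), StarConvex ℝ y T

/-- Families of polynomials of total degree at most `r`, one for each element. -/
abbrev PolyFamily (r : ℕ) : Type :=
  𝒯.elements → MvPolynomial.restrictTotalDegree (Fin d) ℝ r

variable {𝒯} {r : ℕ}

/-- The function that agrees with `p T` on the element `T`, for each `T`. -/
def polyFun (p : 𝒯.PolyFamily r) (x : Space d) : ℝ :=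
  ∑ T : 𝒯.elements, (T : Set (Space d)).indicator
    (fun x => MvPolynomial.eval x.ofLp (p T : MvPolynomial (Fin d) ℝ)) x

/-- The elementwise gradient: the function that agrees with `∇ (p T)` on the element `T`. -/
def polyGrad (p : 𝒯.PolyFamily r) (x : Space d) : Space d :=
  ∑ T : 𝒯.elements, (T : Set (Space d)).indicator
    (fun x => WithLp.toLp 2 fun i =>
      MvPolynomial.eval x.ofLp (MvPolynomial.pderiv i (p T : MvPolynomial (Fin d) ℝ))) x

theorem continuous_eval (p : MvPolynomial (Fin d) ℝ) :
    Continuous fun x : Space d => MvPolynomial.eval x.ofLp p :=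
  (MvPolynomial.continuous_eval p).comp (PiLp.continuous_ofLp 2 _)

theorem memLp_polyFun (p : 𝒯.PolyFamily r) : MemLp (polyFun p) 2 (volume.restrict Ω) := by
  refine MemLp.restrict _ ?_
  refine memLp_finsetSum _ fun T _ => ?_
  rw [memLp_indicator_iff_restrict (𝒯.isOpen _ T.2).measurableSet]
  have hc : IsCompact (closure (T : Set (Space d))) := (𝒯.isBounded _ T.2).isCompact_closure
  obtain ⟨M, hM⟩ := hc.exists_bound_of_continuousOn
    (continuous_eval (p T : MvPolynomial (Fin d) ℝ)).continuousOn
  have : IsFiniteMeasure (volume.restrict (T : Set (Space d))) :=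
    ⟨by simpa using (𝒯.isBounded _ T.2).measure_lt_top⟩
  refine MemLp.of_bound (continuous_eval _).aestronglyMeasurable M ?_
  filter_upwards [ae_restrict_mem (𝒯.isOpen _ T.2).measurableSet] with x hx
  exact hM x (subset_closure hx)

theorem polyFun_of_mem (p : 𝒯.PolyFamily r) (T : 𝒯.elements) {x : Space d}
    (hx : x ∈ (T : Set (Space d))) :
    polyFun p x = MvPolynomial.eval x.ofLp (p T : MvPolynomial (Fin d) ℝ) := by
  unfold polyFun
  rw [Finset.sum_eq_single T, indicator_of_mem hx]
  · intro T' _ hne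
    refine indicator_of_notMem (fun hx' => ?_) _
    exact Set.disjoint_left.1 (𝒯.disjoint T'.2 T.2 (fun h => hne (Subtype.ext h))) hx' hx
  · simp

variable (𝒯 r)

/-- The map sending a family of polynomials to the piecewise polynomial function in `L²(Ω)`. -/
def toL2 : 𝒯.PolyFamily r →ₗ[ℝ] L2 Ω where
  toFun p := (memLp_polyFun p).toLp (polyFun p)
  map_add' p q := by
    rw [← MemLp.toLp_add]
    congr 1
    ext x
    simp only [polyFun, Pi.add_apply, ← Finset.sum_add_distrib]
    refine Finset.sum_congr rfl fun T _ => ?_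
    by_cases hx : x ∈ (T : Set (Space d)) <;> simp [hx]
  map_smul' c p := by
    rw [RingHom.id_apply, ← MemLp.toLp_const_smul]
    congr 1
    ext x
    simp only [polyFun, Pi.smul_apply, smul_eq_mul, Finset.mul_sum]
    refine Finset.sum_congr rfl fun T _ => ?_
    by_cases hx : x ∈ (T : Set (Space d)) <;> simp [hx]

theorem toL2_injective : Function.Injective (𝒯.toL2 r) := by
  rw [← LinearMap.ker_eq_bot, LinearMap.ker_eq_bot']
  intro p hp
  have h0 : polyFun p =ᵐ[volume.restrict Ω] 0 :=
    ((memLp_polyFun p).coeFn_toLp.symm.trans (by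
      change ⇑(𝒯.toL2 r p) =ᵐ[_] _
      rw [hp]
      exact Lp.coeFn_zero _ _ _))
  funext T
  apply Subtype.ext
  have hT : EqOn (fun x : Space d => MvPolynomial.eval x.ofLp (p T : MvPolynomial (Fin d) ℝ))
      (fun _ => 0) (T : Set (Space d)) := by
    refine Measure.eqOn_open_of_ae_eq (μ := volume) ?_ (𝒯.isOpen _ T.2)
      (continuous_eval _).continuousOn continuousOn_const
    have h1 := ae_restrict_of_ae_restrict_of_subset (𝒯.subset _ T.2) h0
    filter_upwards [h1, ae_restrict_mem (𝒯.isOpen _ T.2).measurableSet] with x hx hxT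
    rw [← polyFun_of_mem p T hxT, hx]
    rfl
  obtain ⟨x₀, hx₀⟩ := 𝒯.nonempty _ T.2
  have hopen : IsOpen ((WithLp.toLp 2 : (Fin d → ℝ) → Space d) ⁻¹' (T : Set (Space d))) :=
    (𝒯.isOpen _ T.2).preimage (PiLp.continuous_toLp 2 _)
  obtain ⟨ε, hε, hball⟩ := Metric.isOpen_iff.1 hopen x₀.ofLp (by simpa using hx₀)
  refine MvPolynomial.funext_set (fun i => Metric.ball (x₀.ofLp i) ε) (fun i => ?_) fun x hx => ?_
  · rw [Real.ball_eq_Ioo]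
    exact Ioo_infinite (by linarith)
  · have hxT : WithLp.toLp 2 x ∈ (T : Set (Space d)) := by
      apply hball
      rw [← ball_pi _ hε] at hx
      exact hx
    simpa using hT hxT

/-- `W_h`: the subspace of `L²(Ω)` of (discontinuous) piecewise polynomials of degree at most `r`
over the triangulation. -/
def femSpace : Submodule ℝ (L2 Ω) := LinearMap.range (𝒯.toL2 r)

instance : FiniteDimensional ℝ (𝒯.femSpace r) :=
  inferInstanceAs (FiniteDimensional ℝ (LinearMap.range (𝒯.toL2 r)))

/-- The `L²`-projection `π` onto `W_h`. -/
def proj (u : L2 Ω) : 𝒯.femSpace r := (𝒯.femSpace r).orthogonalProjectionOnto u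

variable {𝒯 r}

/-- The elementwise gradient of an element of `W_h`. -/
def grad (v : 𝒯.femSpace r) : Space d → Space d :=
  polyGrad ((LinearEquiv.ofInjective (𝒯.toL2 r) (𝒯.toL2_injective r)).symm v)

end Triangulation

/-! ### The semidiscrete problem -/

/-- The data of the problem: the initial density `ρ⁰`, the extension `φ` of the boundary data, the
source `f`, and the time derivatives of `φ` and of `f̃ = f - φ_t`, all as functions of time with
values in function spaces on `Ω`; `φ` is `C¹` into `H¹(Ω)` and `f̃` is `C¹` into `L²(Ω)`. -/
structure Data (Ω : Set (Space d)) where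
  /-- the initial density `ρ⁰` -/
  ρ₀ : H1 Ω
  /-- the extension `φ` of the boundary data -/
  φ : ℝ → H1 Ω
  /-- its time derivative `φ_t` -/
  φt : ℝ → H1 Ω
  /-- the source `f` -/
  f : ℝ → L2 Ω
  /-- the time derivative of `f̃ = f - φ_t` -/
  ftilt : ℝ → L2 Ω
  hasDeriv_φ : ∀ t, 0 ≤ t → HasDerivWithinAt φ (φt t) (Ici 0) t
  continuousOn_φt : ContinuousOn φt (Ici 0)
  hasDeriv_ftil : ∀ t, 0 ≤ t → HasDerivWithinAt (fun s => f s - incl (φt s)) (ftilt t) (Ici 0) t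
  continuousOn_ftilt : ContinuousOn ftilt (Ici 0)

namespace Data

variable {Ω : Set (Space d)} (D : Data Ω)

/-- `f̃ = f - φ_t`. -/
def ftil (t : ℝ) : L2 Ω := D.f t - incl (D.φt t)

/-- `ρ̃⁰ = ρ⁰ - φ(0)`. -/
def ρtil₀ : L2 Ω := incl D.ρ₀ - incl (D.φ 0)

/-- The function `t ↦ ‖f̃(t)‖^λ + ‖φ(t)‖₁²`. -/
def size (g : Law) (t : ℝ) : ℝ := ‖D.ftil t‖ ^ g.lam + ‖D.φ t‖ ^ 2

/-- `G` is a continuous increasing envelope on `[0, ∞)` of `t ↦ ‖f̃(t)‖^λ + ‖φ(t)‖₁²`. -/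
def IsEnvelope (g : Law) (G : ℝ → ℝ) : Prop :=
  ContinuousOn G (Ici 0) ∧ MonotoneOn G (Ici 0) ∧ ∀ t, 0 ≤ t → D.size g t ≤ G t

/-- The bound `𝓑(t)`, for a given `t₀` and a given envelope `G`. -/
def bound (g : Law) (G : ℝ → ℝ) (t₀ t : ℝ) : ℝ :=
  t₀⁻¹ * Real.exp (-(1 / 4) * (t - t₀)) *
      (1 + ‖D.ρ₀‖ ^ 2 + ‖incl (D.φ 0)‖ ^ 2
        + ∫ s in (0 : ℝ)..t₀, (‖D.φt s‖ ^ 2 + G s ^ (2 / g.β)))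
    + ∫ s in (0 : ℝ)..t, Real.exp (-(1 / 4) * (t - s)) *
        (1 + ‖D.ρtil₀‖ ^ 2 + ‖D.φt s‖ ^ 2 + ‖D.ftilt s‖ ^ 2 + G s ^ (2 / g.β))

end Data

/-- `ρtil : [0, ∞) → W_h` solves the semidiscrete problem: with `ρ_h = ρ̃_h + π φ`,
`(ρ̃_{h,t}, w) + (K(|∇ρ_h|) ∇ρ_h, ∇w) = (f̃, w)` for all `w ∈ W_h` and `t > 0`, and
`ρ̃_h(0) = π ρ̃⁰`. -/
structure IsSemidiscreteSolution (g : Law) {Ω : Set (Space d)} (𝒯 : Triangulation Ω) (r : ℕ)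
    (D : Data Ω) (ρtil : ℝ → 𝒯.femSpace r) : Prop where
  continuousOn : ContinuousOn ρtil (Ici 0)
  differentiableAt : ∀ t, 0 < t → DifferentiableAt ℝ ρtil t
  initial : ρtil 0 = 𝒯.proj r D.ρtil₀
  equation : ∀ t, 0 < t → ∀ w : 𝒯.femSpace r,
    ⟪deriv ρtil t, w⟫
      + ∫ x in Ω, ⟪g.K ‖Triangulation.grad (ρtil t + 𝒯.proj r (incl (D.φ t))) x‖ •
          Triangulation.grad (ρtil t + 𝒯.proj r (incl (D.φ t))) x, Triangulation.grad w x⟫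
      = ⟪D.ftil t, (w : L2 Ω)⟫

end ForchheimerFlow

end

/-!
Modulo the kernel of the elementwise gradient, the semidiscrete problem is a monotone gradient flow
on `W_h`. Let `y` be the squared norm of the solution modulo this kernel, `H` its energy and
`p = ‖ρ̃_{h,t}‖²`. Testing with the solution gives `y' ≤ -κ / 2 - c y^{β/2} + …`, where `κ ≥ H` is
the dissipation; the term in `y` comes from an elementwise Poincaré inequality, uniform in the mesh
by the degree condition. Testing with `ρ̃_{h,t}` gives `H' ≤ -3p / 4 + C κ + …`, and
differentiating the equation in time gives `p' ≤ p / 2 + …` by monotonicity of the flux. A suitable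
combination `p + H + A y` therefore satisfies a Gronwall inequality with rate `1 / 4`, in which `y`
itself is controlled by the envelope through the superlinear term. All constants are independent of
the mesh because on star-shaped elements the Poincaré and inverse inequalities for polynomials
follow from finite-dimensionality and scaling; the `h⁻¹` lost in bounding `∇ π φ` is recovered from
the approximation of `φ` by elementwise constants.
-/

noncomputable section

namespace ForchheimerFlow

theorem rpow_le_one_add_sq {x p : ℝ} (hx : 0 ≤ x) (hp : 0 ≤ p) (hp2 : p ≤ 2) :
    x ^ p ≤ 1 + x ^ 2 := by
  rcases le_total x 1 with h | h
  · have := Real.rpow_le_one hx h hp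
    nlinarith [sq_nonneg x]
  · have := Real.rpow_le_rpow_of_exponent_le h hp2
    rw [Real.rpow_two] at this
    linarith

theorem le_one_add_rpow {x p : ℝ} (hx : 0 ≤ x) (hp : 1 ≤ p) : x ≤ 1 + x ^ p := by
  rcases le_total x 1 with h | h
  · linarith [Real.rpow_nonneg hx p]
  · have := Real.rpow_le_rpow_of_exponent_le h hp
    rw [Real.rpow_one] at this
    linarith

theorem add_rpow_le_two_mul {x y p : ℝ} (hx : 0 ≤ x) (hy : 0 ≤ y) (hp : 1 ≤ p) (hp2 : p ≤ 2) :
    (x + y) ^ p ≤ 2 * (x ^ p + y ^ p) := by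
  lift x to ℝ≥0 using hx
  lift y to ℝ≥0 using hy
  have h2 : (2 : ℝ) ^ (p - 1) ≤ 2 ^ (1 : ℝ) :=
    Real.rpow_le_rpow_of_exponent_le one_le_two (by linarith)
  rw [Real.rpow_one] at h2
  refine le_trans ?_ (mul_le_mul_of_nonneg_right h2 (by positivity))
  exact_mod_cast NNReal.rpow_add_le_mul_rpow_add_rpow x y hp

theorem mul_one_add_rpow_le {k x p : ℝ} (hk : 0 ≤ k) (hx : 0 ≤ x) (hp : 1 ≤ p) (hp2 : p ≤ 2) :
    (k * (1 + x)) ^ p ≤ 2 * k ^ p * (1 + x ^ p) := by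
  have h := add_rpow_le_two_mul zero_le_one hx hp hp2
  rw [Real.one_rpow] at h
  rw [Real.mul_rpow hk (by positivity), mul_comm 2, mul_assoc]
  gcongr

theorem rpow_sub_rpow_mul_le {s t p : ℝ} (hs : 0 ≤ s) (hst : s ≤ t) (hp : 0 ≤ p) :
    (t ^ p - s ^ p) * s ≤ p * t ^ p * (t - s) := by
  rcases hs.eq_or_lt with rfl | hs0
  · have : 0 ≤ p * t ^ p * (t - 0) :=
      mul_nonneg (mul_nonneg hp (Real.rpow_nonneg hst _)) (by linarith)
    simpa using this
  rcases hst.eq_or_lt with rfl | hlt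
  · simp
  obtain ⟨c, hc, hc'⟩ := exists_deriv_eq_slope (fun x : ℝ => x ^ p) hlt
    (continuousOn_id.rpow_const fun x hx => Or.inl (hs0.trans_le hx.1).ne')
    (fun x hx => (Real.differentiableAt_rpow_const_of_ne p
      (hs0.trans hx.1).ne').differentiableWithinAt)
  have hc0 : 0 < c := hs0.trans hc.1
  rw [Real.deriv_rpow_const, eq_div_iff (by linarith)] at hc'
  rw [← hc']
  have h1 : c ^ (p - 1) * s ≤ t ^ p := by
    calc c ^ (p - 1) * s ≤ c ^ (p - 1) * c :=
          mul_le_mul_of_nonneg_left hc.1.le (Real.rpow_nonneg hc0.le _)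
      _ = c ^ p := by rw [← Real.rpow_add_one hc0.ne']; congr 1; ring
      _ ≤ t ^ p := Real.rpow_le_rpow hc0.le hc.2.le hp
  calc p * c ^ (p - 1) * (t - s) * s = p * (c ^ (p - 1) * s) * (t - s) := by ring
    _ ≤ _ := by
      have := sub_pos.2 hlt
      gcongr

namespace Law

variable (g : Law)

theorem α_nonneg (i : Fin (g.N + 1)) : 0 ≤ g.α i := by
  rw [← g.α_zero]
  exact g.α_strictMono.monotone (Fin.zero_le i)

theorem α_le_deg (i : Fin (g.N + 1)) : g.α i ≤ g.deg :=
  g.α_strictMono.monotone (Fin.le_last i)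

theorem deg_pos : 0 < g.deg := by
  have h : (0 : Fin (g.N + 1)) < Fin.last g.N := by
    rw [Fin.lt_def]
    simpa using Nat.lt_of_succ_le g.one_le_N
  have := g.α_strictMono h
  rwa [g.α_zero] at this

theorem a_pos : 0 < g.a := div_pos g.deg_pos (by linarith [g.deg_pos])

theorem one_sub_a : 1 - g.a = 1 / (g.deg + 1) := by
  have := g.deg_pos
  unfold a
  field_simp
  ring

theorem a_lt_one : g.a < 1 := by
  have h : 0 < 1 / (g.deg + 1) := by have := g.deg_pos; positivity
  rw [← one_sub_a] at h
  linarith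

theorem one_lt_β : 1 < g.β := by unfold β; linarith [g.a_lt_one]

theorem β_lt_two : g.β < 2 := by unfold β; linarith [g.a_pos]

theorem β_pos : 0 < g.β := by linarith [g.one_lt_β]

theorem holderConjugate_β_lam : g.β.HolderConjugate g.lam := by
  rw [Real.holderConjugate_iff]
  refine ⟨g.one_lt_β, ?_⟩
  have : 1 - g.a ≠ 0 := by linarith [g.a_lt_one]
  have : 2 - g.a ≠ 0 := by linarith [g.a_lt_one]
  unfold lam β
  field_simp
  ring

theorem one_le_two_div_β : 1 ≤ 2 / g.β := (one_le_div g.β_pos).2 g.β_lt_two.le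

theorem two_div_β_le_two : 2 / g.β ≤ 2 := (div_le_iff₀ g.β_pos).2 (by linarith [g.one_lt_β])

theorem sq_le_one_add_rpow {x y : ℝ} (hx : 0 ≤ x) (h : x ^ g.lam ≤ y) :
    x ^ 2 ≤ 1 + y ^ (2 / g.β) := by
  have hy : 0 ≤ y := (Real.rpow_nonneg hx _).trans h
  rcases le_total x 1 with hx1 | hx1
  · nlinarith [Real.rpow_nonneg hy (2 / g.β)]
  have hβ := g.β_pos
  have he : g.lam * (2 / g.β) = 2 / (1 - g.a) := by
    have h1 : 1 - g.a ≠ 0 := by linarith [g.a_lt_one]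
    have h2 : 2 - g.a ≠ 0 := by linarith [g.a_lt_one]
    unfold lam β
    field_simp
  calc x ^ 2 = x ^ (2 : ℝ) := (Real.rpow_two x).symm
    _ ≤ x ^ (g.lam * (2 / g.β)) := Real.rpow_le_rpow_of_exponent_le hx1 <| by
      rw [he, le_div_iff₀ (by linarith [g.a_lt_one])]
      linarith [g.a_pos]
    _ = (x ^ g.lam) ^ (2 / g.β) := Real.rpow_mul hx _ _
    _ ≤ y ^ (2 / g.β) := Real.rpow_le_rpow (Real.rpow_nonneg hx _) h (by positivity)
    _ ≤ 1 + y ^ (2 / g.β) := by linarith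

theorem two_mul_mul_le {x y k : ℝ} (hx : 0 ≤ x) (hy : 0 ≤ y) (hk : 0 < k) :
    2 * (x * y) ≤ k * y ^ g.β + 2 * ((k / 2) ^ (1 / g.β))⁻¹ ^ g.lam * x ^ g.lam := by
  set δ := (k / 2) ^ (1 / g.β) with hδ
  have hδ0 : 0 < δ := by positivity
  have hyoung := Real.young_inequality_of_nonneg (mul_nonneg hδ0.le hy)
    (mul_nonneg (inv_pos.2 hδ0).le hx) g.holderConjugate_β_lam
  have hδβ : δ ^ g.β = k / 2 := by
    rw [hδ, ← Real.rpow_mul (by positivity), one_div_mul_cancel g.β_pos.ne', Real.rpow_one]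
  have hcancel : δ * y * (δ⁻¹ * x) = x * y := by field_simp
  rw [hcancel, Real.mul_rpow hδ0.le hy, Real.mul_rpow (inv_pos.2 hδ0).le hx, hδβ] at hyoung
  have h1 : k / 2 * y ^ g.β / g.β ≤ k / 2 * y ^ g.β :=
    div_le_self (by positivity) g.one_lt_β.le
  have h2 : δ⁻¹ ^ g.lam * x ^ g.lam / g.lam ≤ δ⁻¹ ^ g.lam * x ^ g.lam :=
    div_le_self (by positivity) g.holderConjugate_β_lam.symm.lt.le
  linarith

theorem eval_mono {s t : ℝ} (hs : 0 ≤ s) (hst : s ≤ t) : g.eval s ≤ g.eval t :=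
  Finset.sum_le_sum fun i _ =>
    mul_le_mul_of_nonneg_left (Real.rpow_le_rpow hs hst (g.α_nonneg i)) (g.coeff_nonneg i)

theorem coeff_zero_le_eval {s : ℝ} (hs : 0 ≤ s) : g.coeff 0 ≤ g.eval s := by
  have h := Finset.single_le_sum (f := fun i => g.coeff i * s ^ g.α i)
    (fun i _ => mul_nonneg (g.coeff_nonneg i) (Real.rpow_nonneg hs _)) (Finset.mem_univ 0)
  simpa [eval, g.α_zero] using h

theorem eval_pos {s : ℝ} (hs : 0 ≤ s) : 0 < g.eval s :=
  g.coeff_zero_pos.trans_le (g.coeff_zero_le_eval hs)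

theorem continuous_eval : Continuous g.eval :=
  continuous_finsetSum _ fun i _ =>
    continuous_const.mul (Real.continuous_rpow_const (g.α_nonneg i))

theorem root_spec {ξ : ℝ} (hξ : 0 ≤ ξ) : 0 ≤ g.root ξ ∧ g.root ξ * g.eval (g.root ξ) = ξ := by
  have hmem : ξ ∈ (fun s : ℝ => s * g.eval s) '' Ici 0 := by
    have hT : 0 ≤ ξ / g.coeff 0 := div_nonneg hξ g.coeff_zero_pos.le
    have hiv := intermediate_value_Icc hT
      (f := fun s : ℝ => s * g.eval s) (continuous_id.mul g.continuous_eval).continuousOn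
    obtain ⟨s, hs, hs'⟩ := hiv (show ξ ∈ Icc _ _ by
      refine ⟨by simpa using hξ, ?_⟩
      calc ξ = ξ / g.coeff 0 * g.coeff 0 := (div_mul_cancel₀ _ g.coeff_zero_pos.ne').symm
        _ ≤ _ := mul_le_mul_of_nonneg_left (g.coeff_zero_le_eval hT) hT)
    exact ⟨s, hs.1, hs'⟩
  exact ⟨Function.invFunOn_mem hmem, Function.invFunOn_eq hmem⟩

theorem eval_sub_eval_mul_le {s t : ℝ} (hs : 0 ≤ s) (hst : s ≤ t) :
    (g.eval t - g.eval s) * s ≤ g.deg * g.eval t * (t - s) := by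
  have ht : 0 ≤ t := hs.trans hst
  unfold eval
  rw [← Finset.sum_sub_distrib, Finset.sum_mul, Finset.mul_sum, Finset.sum_mul]
  refine Finset.sum_le_sum fun i _ => ?_
  have h := rpow_sub_rpow_mul_le hs hst (g.α_nonneg i)
  have h2 : g.α i * t ^ g.α i * (t - s) ≤ g.deg * t ^ g.α i * (t - s) := by
    have := Real.rpow_nonneg ht (g.α i)
    have := sub_nonneg.2 hst
    have := g.α_le_deg i
    gcongr
  calc (g.coeff i * t ^ g.α i - g.coeff i * s ^ g.α i) * s
      = g.coeff i * ((t ^ g.α i - s ^ g.α i) * s) := by ring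
    _ ≤ g.coeff i * (g.deg * t ^ g.α i * (t - s)) :=
      mul_le_mul_of_nonneg_left (h.trans h2) (g.coeff_nonneg i)
    _ = _ := by ring

theorem eval_le_mul_one_add_rpow {s : ℝ} (hs : 0 ≤ s) :
    g.eval s ≤ g.eval 1 * (1 + s) ^ g.deg := by
  unfold eval
  rw [Finset.sum_mul]
  refine Finset.sum_le_sum fun i _ => ?_
  rw [Real.one_rpow, mul_one]
  refine mul_le_mul_of_nonneg_left ?_ (g.coeff_nonneg i)
  exact (Real.rpow_le_rpow hs (by linarith) (g.α_nonneg i)).trans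
    (Real.rpow_le_rpow_of_exponent_le (by linarith) (g.α_le_deg i))

theorem rpow_one_sub_a_le {ξ : ℝ} (hξ : 0 ≤ ξ) :
    ξ ^ (1 - g.a) ≤ g.eval 1 ^ (1 - g.a) * (1 + g.root ξ) := by
  obtain ⟨hs, hsξ⟩ := g.root_spec hξ
  have hd := g.deg_pos
  have hle : ξ ≤ g.eval 1 * (1 + g.root ξ) ^ (g.deg + 1) := calc
    ξ = g.root ξ * g.eval (g.root ξ) := hsξ.symm
    _ ≤ (1 + g.root ξ) * (g.eval 1 * (1 + g.root ξ) ^ g.deg) :=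
      mul_le_mul (by linarith) (g.eval_le_mul_one_add_rpow hs) (g.eval_pos hs).le (by linarith)
    _ = _ := by rw [Real.rpow_add_one (by linarith)]; ring
  refine (Real.rpow_le_rpow hξ hle (by linarith [g.a_lt_one])).trans_eq ?_
  rw [Real.mul_rpow (g.eval_pos zero_le_one).le (by positivity), ← Real.rpow_mul (by linarith),
    one_sub_a, mul_one_div_cancel (by linarith), Real.rpow_one]

theorem le_eval_one_add_root_mul {ξ : ℝ} (hξ : 0 ≤ ξ) : ξ ≤ g.eval 1 + g.root ξ * ξ := by
  obtain ⟨hs, hsξ⟩ := g.root_spec hξ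
  have hg1 := g.eval_pos zero_le_one
  rcases le_total (g.root ξ) 1 with h | h
  · have : ξ ≤ 1 * g.eval 1 := hsξ.symm.trans_le
      (mul_le_mul h (g.eval_mono hs h) (g.eval_pos hs).le zero_le_one)
    linarith [mul_nonneg hs hξ]
  · nlinarith

/-- The primitive `∑ a_i s^{α_i + 2} / (α_i + 2)` of `s g(s)`. -/
def primitive (s : ℝ) : ℝ := ∑ i, g.coeff i * (s ^ (g.α i + 2) / (g.α i + 2))

theorem primitive_nonneg {s : ℝ} (hs : 0 ≤ s) : 0 ≤ g.primitive s :=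
  Finset.sum_nonneg fun i _ => mul_nonneg (g.coeff_nonneg i)
    (div_nonneg (Real.rpow_nonneg hs _) (by linarith [g.α_nonneg i]))

theorem primitive_zero : g.primitive 0 = 0 :=
  Finset.sum_eq_zero fun i _ => by
    rw [Real.zero_rpow (by linarith [g.α_nonneg i]), zero_div, mul_zero]

theorem mul_eval_mul_sub_le {s t : ℝ} (hs : 0 ≤ s) (ht : 0 ≤ t) :
    t * g.eval t * (s - t) ≤ g.primitive s - g.primitive t := by
  unfold primitive eval
  rw [← Finset.sum_sub_distrib, Finset.mul_sum, Finset.sum_mul]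
  refine Finset.sum_le_sum fun i _ => ?_
  have hα := g.α_nonneg i
  have hpq : (g.α i + 2).HolderConjugate ((g.α i + 2) / (g.α i + 1)) := by
    rw [Real.holderConjugate_iff]
    refine ⟨by linarith, ?_⟩
    field_simp
    ring
  have hy := Real.young_inequality_of_nonneg hs (Real.rpow_nonneg ht (g.α i + 1)) hpq
  rw [← Real.rpow_mul ht, mul_div_cancel₀ _ (by linarith : g.α i + 1 ≠ 0)] at hy
  have h1 : t ^ (g.α i + 1) = t * t ^ g.α i := by
    rw [Real.rpow_add_one' ht (by linarith)]; ring
  have h2 : t ^ (g.α i + 2) = t * (t * t ^ g.α i) := by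
    rw [← h1, show g.α i + 2 = (g.α i + 1) + 1 by ring, Real.rpow_add_one' ht (by linarith)]; ring
  have h3 : t ^ (g.α i + 2) / ((g.α i + 2) / (g.α i + 1))
      = t ^ (g.α i + 2) - t ^ (g.α i + 2) / (g.α i + 2) := by
    field_simp
    ring
  rw [h3, h1] at hy
  calc t * (g.coeff i * t ^ g.α i) * (s - t)
      = g.coeff i * (s * (t * t ^ g.α i) - t ^ (g.α i + 2)) := by rw [h2]; ring
    _ ≤ g.coeff i * (s ^ (g.α i + 2) / (g.α i + 2) - t ^ (g.α i + 2) / (g.α i + 2)) :=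
      mul_le_mul_of_nonneg_left (by linarith) (g.coeff_nonneg i)
    _ = _ := by ring

section Flux

variable {E : Type*} [NormedAddCommGroup E] [InnerProductSpace ℝ E]

/-- The nonlinear flux `z ↦ K(|z|) z`. -/
def flux (z : E) : E := g.K ‖z‖ • z

theorem K_pos {ξ : ℝ} (hξ : 0 ≤ ξ) : 0 < g.K ξ := one_div_pos.2 (g.eval_pos (g.root_spec hξ).1)

theorem norm_flux (z : E) : ‖g.flux z‖ = g.root ‖z‖ := by
  obtain ⟨h0, h1⟩ := g.root_spec (norm_nonneg z)
  have hp := g.eval_pos h0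
  rw [flux, norm_smul, Real.norm_of_nonneg (g.K_pos (norm_nonneg z)).le, K, one_div,
    inv_mul_eq_iff_eq_mul₀ hp.ne']
  linarith

theorem eval_norm_flux_smul (z : E) : g.eval ‖g.flux z‖ • g.flux z = z := by
  have h0 := (g.root_spec (norm_nonneg z)).1
  rw [norm_flux, flux, smul_smul, K, mul_one_div_cancel (g.eval_pos h0).ne', one_smul]

theorem flux_zero : g.flux (0 : E) = 0 := by simp [flux]

theorem inner_flux_self (z : E) : ⟪g.flux z, z⟫ = g.root ‖z‖ * ‖z‖ := by
  obtain ⟨h0, h1⟩ := g.root_spec (norm_nonneg z)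
  have hp := g.eval_pos h0
  rw [flux, real_inner_smul_left, real_inner_self_eq_norm_sq, K]
  field_simp
  linear_combination (-‖z‖) * h1

theorem inner_flux_self_nonneg (z : E) : 0 ≤ ⟪g.flux z, z⟫ := by
  rw [inner_flux_self]
  exact mul_nonneg (g.root_spec (norm_nonneg z)).1 (norm_nonneg z)

theorem inner_sub_eval_smul_ge {v w : E} (h : ‖v‖ ≤ ‖w‖) :
    1 / 2 * g.eval ‖w‖ * ‖w - v‖ ^ 2 ≤ ⟪w - v, g.eval ‖w‖ • w - g.eval ‖v‖ • v⟫ := by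
  have hv := g.eval_pos (norm_nonneg v)
  have hm := g.eval_mono (norm_nonneg v) h
  have e1 : ⟪w - v, g.eval ‖w‖ • w - g.eval ‖v‖ • v⟫
      = 1 / 2 * (g.eval ‖w‖ + g.eval ‖v‖) * ‖w - v‖ ^ 2
        + 1 / 2 * (g.eval ‖w‖ - g.eval ‖v‖) * (‖w‖ ^ 2 - ‖v‖ ^ 2) := by
    rw [norm_sub_sq_real]
    simp only [inner_sub_left, inner_sub_right, real_inner_smul_right, real_inner_self_eq_norm_sq,
      real_inner_comm w v]
    ring
  have h2 : 0 ≤ (g.eval ‖w‖ - g.eval ‖v‖) * (‖w‖ ^ 2 - ‖v‖ ^ 2) :=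
    mul_nonneg (by linarith) (by nlinarith [norm_nonneg v])
  have h3 : 0 ≤ g.eval ‖v‖ * ‖w - v‖ ^ 2 := by positivity
  rw [e1]
  linarith

theorem norm_sub_eval_smul_le {v w : E} (h : ‖v‖ ≤ ‖w‖) :
    ‖g.eval ‖w‖ • w - g.eval ‖v‖ • v‖ ≤ (1 + g.deg) * g.eval ‖w‖ * ‖w - v‖ := by
  have hw := g.eval_pos (norm_nonneg w)
  have hm := g.eval_mono (norm_nonneg v) h
  have e1 : g.eval ‖w‖ • w - g.eval ‖v‖ • v
      = g.eval ‖w‖ • (w - v) + (g.eval ‖w‖ - g.eval ‖v‖) • v := by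
    rw [smul_sub, sub_smul]; abel
  have h1 := g.eval_sub_eval_mul_le (norm_nonneg v) h
  have h2 : ‖w‖ - ‖v‖ ≤ ‖w - v‖ := norm_sub_norm_le w v
  calc _ ≤ g.eval ‖w‖ * ‖w - v‖ + (g.eval ‖w‖ - g.eval ‖v‖) * ‖v‖ := by
        rw [e1]
        refine (norm_add_le _ _).trans ?_
        rw [norm_smul, norm_smul, Real.norm_of_nonneg hw.le, Real.norm_of_nonneg (by linarith)]
    _ ≤ g.eval ‖w‖ * ‖w - v‖ + g.deg * g.eval ‖w‖ * ‖w - v‖ := by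
        have := mul_le_mul_of_nonneg_left h2 (mul_nonneg g.deg_pos.le hw.le)
        linarith
    _ = _ := by ring

theorem exists_flux_weight (z z' : E) : ∃ k : ℝ, 0 < k ∧ k ≤ 1 / g.coeff 0 ∧
    1 / (2 * (1 + g.deg) ^ 2) * k * ‖z' - z‖ ^ 2 ≤ ⟪g.flux z' - g.flux z, z' - z⟫ ∧
    ‖g.flux z' - g.flux z‖ ≤ 2 * k * ‖z' - z‖ := by
  wlog h : ‖g.flux z‖ ≤ ‖g.flux z'‖ generalizing z z'
  · obtain ⟨k, h0, h1, h2, h3⟩ := this z' z (le_of_not_ge h)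
    refine ⟨k, h0, h1, ?_, ?_⟩
    · rw [norm_sub_rev, ← neg_sub (g.flux z), ← neg_sub z, inner_neg_neg]
      exact h2
    · rw [norm_sub_rev, norm_sub_rev z']
      exact h3
  have hM := g.eval_pos (norm_nonneg (g.flux z'))
  have hd := g.deg_pos
  have hin := g.inner_sub_eval_smul_ge h
  have hno := g.norm_sub_eval_smul_le h
  rw [eval_norm_flux_smul, eval_norm_flux_smul] at hin hno
  set M := g.eval ‖g.flux z'‖
  set V := ‖g.flux z' - g.flux z‖
  set Z := ‖z' - z‖
  have hV : 0 ≤ V := norm_nonneg _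
  -- The weight comes from the larger of the two fluxes, which carries the larger value of `g`.
  refine ⟨1 / M, by positivity,
    one_div_le_one_div_of_le g.coeff_zero_pos (g.coeff_zero_le_eval (norm_nonneg _)), ?_, ?_⟩
  · refine le_trans ?_ hin
    calc 1 / (2 * (1 + g.deg) ^ 2) * (1 / M) * Z ^ 2
        ≤ 1 / (2 * (1 + g.deg) ^ 2) * (1 / M) * ((1 + g.deg) * M * V) ^ 2 := by gcongr
      _ = _ := by field_simp
  · have hcs : 1 / 2 * M * V ^ 2 ≤ V * Z := hin.trans (real_inner_le_norm _ _)
    rcases hV.eq_or_lt with h0 | h0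
    · rw [← h0]; positivity
    · have : M * V ≤ 2 * Z := by
        have : V * (M * V) ≤ V * (2 * Z) := by nlinarith
        exact le_of_mul_le_mul_left this h0
      rw [show 2 * (1 / M) * Z = 2 * Z / M by ring, le_div_iff₀ hM]
      linarith

theorem lipschitzWith_flux :
    LipschitzWith (2 / g.coeff 0).toNNReal (g.flux : E → E) := by
  refine LipschitzWith.of_dist_le_mul fun z' z => ?_
  obtain ⟨k, -, h1, -, h3⟩ := g.exists_flux_weight z z'
  rw [dist_eq_norm, dist_eq_norm,
    Real.coe_toNNReal _ (div_nonneg zero_le_two g.coeff_zero_pos.le)]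
  refine h3.trans ?_
  rw [show 2 / g.coeff 0 = 2 * (1 / g.coeff 0) by ring]
  gcongr

theorem inner_flux_sub_sub_ge (z z' η : E) :
    -(2 * (1 + g.deg) ^ 2 / g.coeff 0) * ‖η‖ ^ 2 ≤ ⟪g.flux z' - g.flux z, z' - z - η⟫ := by
  obtain ⟨k, h0, h1, h2, h3⟩ := g.exists_flux_weight z z'
  have hd := g.deg_pos
  have h4 : ⟪g.flux z' - g.flux z, η⟫ ≤ 2 * k * ‖z' - z‖ * ‖η‖ :=
    (real_inner_le_norm _ _).trans (by gcongr)
  rw [inner_sub_right]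
  set A := 2 * (1 + g.deg) ^ 2
  have hA0 : 0 < A := by positivity
  have h5 : 2 * ‖z' - z‖ * ‖η‖ ≤ 1 / A * ‖z' - z‖ ^ 2 + A * ‖η‖ ^ 2 := by
    have : 0 ≤ 1 / A * (‖z' - z‖ - A * ‖η‖) ^ 2 := by positivity
    have e : 1 / A * (‖z' - z‖ - A * ‖η‖) ^ 2
      = 1 / A * ‖z' - z‖ ^ 2 + A * ‖η‖ ^ 2 - 2 * ‖z' - z‖ * ‖η‖ := by field_simp; ring
    linarith
  have h6 := mul_le_mul_of_nonneg_left h5 h0.le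
  have h7 : k * (A * ‖η‖ ^ 2) ≤ 1 / g.coeff 0 * (A * ‖η‖ ^ 2) := by gcongr
  have e : -(A / g.coeff 0) * ‖η‖ ^ 2 = -(1 / g.coeff 0 * (A * ‖η‖ ^ 2)) := by ring
  rw [e]
  nlinarith

theorem K_le {ξ : ℝ} (hξ : 0 ≤ ξ) : g.K ξ ≤ 1 / g.coeff 0 :=
  one_div_le_one_div_of_le g.coeff_zero_pos (g.coeff_zero_le_eval (g.root_spec hξ).1)

theorem inner_flux_self_eq (z : E) : ⟪g.flux z, z⟫ = g.K ‖z‖ * ‖z‖ ^ 2 := by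
  rw [flux, real_inner_smul_left, real_inner_self_eq_norm_sq]

theorem abs_inner_flux_le (z η : E) :
    |⟪g.flux z, η⟫| ≤ 1 / 2 * ⟪g.flux z, z⟫ + 1 / g.coeff 0 * ‖η‖ ^ 2 := by
  have hK := g.K_pos (norm_nonneg z)
  have hK' := g.K_le (norm_nonneg z)
  have h1 : |⟪g.flux z, η⟫| ≤ g.K ‖z‖ * ‖z‖ * ‖η‖ := by
    refine (abs_real_inner_le_norm _ _).trans ?_
    rw [flux, norm_smul, Real.norm_of_nonneg hK.le]
  have h2 : g.K ‖z‖ * (‖z‖ * ‖η‖) ≤ g.K ‖z‖ * (1 / 2 * ‖z‖ ^ 2 + ‖η‖ ^ 2) := by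
    gcongr
    nlinarith [sq_nonneg (‖z‖ - ‖η‖), sq_nonneg ‖η‖]
  have h3 : g.K ‖z‖ * ‖η‖ ^ 2 ≤ 1 / g.coeff 0 * ‖η‖ ^ 2 := by gcongr
  rw [inner_flux_self_eq]
  nlinarith

/-- The convex function whose gradient is the flux: the Legendre transform of `V ↦ G(|V|)`, where
`G` is `primitive`, with its supremum attained at `V = flux z`. -/
def potential (z : E) : ℝ := ⟪g.flux z, z⟫ - g.primitive ‖g.flux z‖

theorem inner_flux_le_potential_sub (z z' : E) :
    ⟪g.flux z, z' - z⟫ ≤ g.potential z' - g.potential z := by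
  have h := g.mul_eval_mul_sub_le (norm_nonneg (g.flux z)) (norm_nonneg (g.flux z'))
  have h1 : ⟪g.flux z' - g.flux z, z'⟫
      = g.eval ‖g.flux z'‖ * (‖g.flux z'‖ ^ 2 - ⟪g.flux z, g.flux z'⟫) := by
    conv_lhs => rw [← g.eval_norm_flux_smul z']
    rw [real_inner_smul_right, g.eval_norm_flux_smul z', inner_sub_left,
      real_inner_self_eq_norm_sq]
  have h2 := real_inner_le_norm (g.flux z) (g.flux z')
  have h3 := mul_le_mul_of_nonneg_left h2 (g.eval_pos (norm_nonneg (g.flux z'))).le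
  unfold potential
  rw [inner_sub_left] at h1
  rw [inner_sub_right]
  nlinarith

theorem potential_nonneg (z : E) : 0 ≤ g.potential z := by
  have h := g.inner_flux_le_potential_sub 0 z
  have h0 : g.potential (0 : E) = 0 := by simp [potential, flux_zero, primitive_zero]
  rw [h0, flux_zero, inner_zero_left] at h
  linarith

theorem potential_le (z : E) : g.potential z ≤ ⟪g.flux z, z⟫ := by
  have := g.primitive_nonneg (norm_nonneg (g.flux z))
  unfold potential
  linarith

theorem inner_flux_self_le (z : E) : ⟪g.flux z, z⟫ ≤ 1 / g.coeff 0 * ‖z‖ ^ 2 := by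
  rw [inner_flux_self_eq]
  have := g.K_le (norm_nonneg z)
  gcongr

theorem continuous_flux : Continuous (g.flux : E → E) := g.lipschitzWith_flux.continuous

theorem continuous_potential : Continuous (g.potential : E → ℝ) := by
  refine (g.continuous_flux.inner continuous_id).sub ?_
  refine Continuous.comp (g := g.primitive) ?_ g.continuous_flux.norm
  exact continuous_finsetSum _ fun i _ => continuous_const.mul
    ((Real.continuous_rpow_const (by linarith [g.α_nonneg i])).div_const _)

theorem exists_rpow_β_le : ∃ C : ℝ, 0 < C ∧ ∀ z : E, ‖z‖ ^ g.β ≤ C * (1 + ⟪g.flux z, z⟫) := by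
  have hg1 := g.eval_pos zero_le_one
  set c := g.eval 1 ^ (1 - g.a)
  have : 0 < c := Real.rpow_pos_of_pos hg1 _
  refine ⟨c * (g.eval 1 + 2), by positivity, fun z => ?_⟩
  have hξ := norm_nonneg z
  have hs := (g.root_spec hξ).1
  rw [inner_flux_self]
  calc ‖z‖ ^ g.β = ‖z‖ * ‖z‖ ^ (1 - g.a) := by
        rw [show g.β = 1 - g.a + 1 by unfold β; ring,
          Real.rpow_add_one' hξ (by linarith [g.a_lt_one]), mul_comm]
    _ ≤ ‖z‖ * (c * (1 + g.root ‖z‖)) := by gcongr; exact g.rpow_one_sub_a_le hξ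
    _ = c * (‖z‖ + g.root ‖z‖ * ‖z‖) := by ring
    _ ≤ c * ((g.eval 1 + 2) * (1 + g.root ‖z‖ * ‖z‖)) := by
      have := g.le_eval_one_add_root_mul hξ
      have := mul_nonneg hs hξ
      gcongr
      nlinarith
    _ = _ := by ring

end Flux

end Law

section SquareIntegrable

variable {X E : Type*} [MeasurableSpace X] {μ : Measure X} [NormedAddCommGroup E]
  [InnerProductSpace ℝ E]

theorem L2_norm_sq_eq_integral (H : Lp E 2 μ) : ‖H‖ ^ 2 = ∫ x, ‖H x‖ ^ 2 ∂μ := by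
  rw [← real_inner_self_eq_norm_sq, L2.inner_def]
  simp only [real_inner_self_eq_norm_sq]

theorem integrable_norm_sq (H : Lp E 2 μ) : Integrable (fun x => ‖H x‖ ^ 2) μ := by
  have := L2.integrable_inner (𝕜 := ℝ) H H
  simpa only [real_inner_self_eq_norm_sq] using this

end SquareIntegrable

namespace Law

variable (g : Law) {X E : Type*} [MeasurableSpace X] {μ : Measure X} [NormedAddCommGroup E]
  [InnerProductSpace ℝ E]

/-- The superposition operator `Z ↦ K(|Z|) Z` on `L²`. -/
def fluxLp (Z : Lp E 2 μ) : Lp E 2 μ := g.lipschitzWith_flux.compLp g.flux_zero Z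

theorem coeFn_fluxLp (Z : Lp E 2 μ) : g.fluxLp Z =ᵐ[μ] fun x => g.flux (Z x) :=
  LipschitzWith.coeFn_compLp _ _ Z

theorem norm_fluxLp_sub_le (Z Z' : Lp E 2 μ) :
    ‖g.fluxLp Z - g.fluxLp Z'‖ ≤ 2 / g.coeff 0 * ‖Z - Z'‖ := by
  have h := g.lipschitzWith_flux.norm_compLp_sub_le g.flux_zero Z Z'
  rwa [Real.coe_toNNReal _ (div_nonneg zero_le_two g.coeff_zero_pos.le)] at h

theorem inner_fluxLp (Z H : Lp E 2 μ) : ⟪g.fluxLp Z, H⟫ = ∫ x, ⟪g.flux (Z x), H x⟫ ∂μ := by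
  rw [L2.inner_def]
  refine integral_congr_ae ?_
  filter_upwards [g.coeFn_fluxLp Z] with x hx
  rw [hx]

theorem integrable_inner_flux (Z H : Lp E 2 μ) :
    Integrable (fun x => ⟪g.flux (Z x), H x⟫) μ := by
  refine (L2.integrable_inner (𝕜 := ℝ) (g.fluxLp Z) H).congr ?_
  filter_upwards [g.coeFn_fluxLp Z] with x hx
  rw [hx]

theorem inner_fluxLp_sub_sub_ge (Z Z' H : Lp E 2 μ) :
    -(2 * (1 + g.deg) ^ 2 / g.coeff 0) * ‖H‖ ^ 2 ≤ ⟪g.fluxLp Z' - g.fluxLp Z, Z' - Z - H⟫ := by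
  rw [L2_norm_sq_eq_integral, L2.inner_def, ← integral_const_mul]
  refine integral_mono_ae ((integrable_norm_sq H).const_mul _) (L2.integrable_inner _ _) ?_
  filter_upwards [g.coeFn_fluxLp Z, g.coeFn_fluxLp Z', Lp.coeFn_sub (g.fluxLp Z') (g.fluxLp Z),
    Lp.coeFn_sub (Z' - Z) H, Lp.coeFn_sub Z' Z] with x h1 h2 h3 h4 h5
  rw [h3, h4, Pi.sub_apply, Pi.sub_apply, h5, Pi.sub_apply, h1, h2]
  exact g.inner_flux_sub_sub_ge _ _ _

theorem inner_fluxLp_self_nonneg (Z : Lp E 2 μ) : 0 ≤ ⟪g.fluxLp Z, Z⟫ := by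
  rw [inner_fluxLp]
  exact integral_nonneg fun x => g.inner_flux_self_nonneg _

theorem abs_inner_fluxLp_le (Z H : Lp E 2 μ) :
    |⟪g.fluxLp Z, H⟫| ≤ 1 / 2 * ⟪g.fluxLp Z, Z⟫ + 1 / g.coeff 0 * ‖H‖ ^ 2 := by
  rw [inner_fluxLp, inner_fluxLp, L2_norm_sq_eq_integral, ← integral_const_mul,
    ← integral_const_mul,
    ← integral_add ((g.integrable_inner_flux Z Z).const_mul _) ((integrable_norm_sq H).const_mul _)]
  refine abs_integral_le_integral_abs.trans (integral_mono (g.integrable_inner_flux Z H).abs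
    (((g.integrable_inner_flux Z Z).const_mul _).add ((integrable_norm_sq H).const_mul _))
    fun x => g.abs_inner_flux_le _ _)

theorem inner_fluxLp_self_le (Z : Lp E 2 μ) :
    ⟪g.fluxLp Z, Z⟫ ≤ 1 / g.coeff 0 * ‖Z‖ ^ 2 := by
  rw [inner_fluxLp, L2_norm_sq_eq_integral, ← integral_const_mul]
  exact integral_mono (g.integrable_inner_flux Z Z) ((integrable_norm_sq Z).const_mul _)
    fun x => g.inner_flux_self_le _

theorem integrable_potential (Z : Lp E 2 μ) : Integrable (fun x => g.potential (Z x)) μ := by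
  refine (g.integrable_inner_flux Z Z).mono'
    (g.continuous_potential.comp_aestronglyMeasurable (Lp.aestronglyMeasurable Z)) ?_
  filter_upwards with x
  rw [Real.norm_of_nonneg (g.potential_nonneg _)]
  exact g.potential_le _

/-- The convex functional on `L²` whose gradient is `fluxLp`. -/
def energy (Z : Lp E 2 μ) : ℝ := ∫ x, g.potential (Z x) ∂μ

theorem energy_nonneg (Z : Lp E 2 μ) : 0 ≤ g.energy Z :=
  integral_nonneg fun _ => g.potential_nonneg _

theorem energy_le (Z : Lp E 2 μ) : g.energy Z ≤ ⟪g.fluxLp Z, Z⟫ := by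
  rw [inner_fluxLp]
  exact integral_mono (g.integrable_potential Z) (g.integrable_inner_flux Z Z)
    fun x => g.potential_le _

theorem inner_fluxLp_le_energy_sub (Z Z' : Lp E 2 μ) :
    ⟪g.fluxLp Z, Z' - Z⟫ ≤ g.energy Z' - g.energy Z := by
  rw [inner_fluxLp, energy, energy,
    ← integral_sub (g.integrable_potential Z') (g.integrable_potential Z)]
  refine integral_mono_ae (g.integrable_inner_flux Z _)
    ((g.integrable_potential Z').sub (g.integrable_potential Z)) ?_
  filter_upwards [Lp.coeFn_sub Z' Z] with x hx
  simp only [hx, Pi.sub_apply]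
  exact g.inner_flux_le_potential_sub _ _

theorem integrable_norm_rpow_β [IsFiniteMeasure μ] (Z : Lp E 2 μ) :
    Integrable (fun x => ‖Z x‖ ^ g.β) μ := by
  refine ((integrable_const (1 : ℝ)).add (integrable_norm_sq Z)).mono'
    ((Real.continuous_rpow_const g.β_pos.le).comp_aestronglyMeasurable
      (Lp.aestronglyMeasurable Z).norm) ?_
  filter_upwards with x
  rw [Real.norm_of_nonneg (Real.rpow_nonneg (norm_nonneg _) _)]
  exact rpow_le_one_add_sq (norm_nonneg _) g.β_pos.le g.β_lt_two.le

variable (E μ) in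
theorem exists_integral_rpow_β_le [IsFiniteMeasure μ] : ∃ C : ℝ, 0 < C ∧ ∀ Z H : Lp E 2 μ,
    ∫ x, ‖(Z - H) x‖ ^ g.β ∂μ ≤ C * (1 + ⟪g.fluxLp Z, Z⟫ + ‖H‖ ^ 2) := by
  obtain ⟨C, hC, h⟩ := g.exists_rpow_β_le (E := E)
  have hm : 0 ≤ μ.real univ := measureReal_nonneg
  refine ⟨4 * (C + 1) * (1 + μ.real univ), by positivity, fun Z H => ?_⟩
  have hpointwise : ∀ᵐ x ∂μ, ‖(Z - H) x‖ ^ g.β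
      ≤ 4 * (C + 1) * (1 + ⟪g.flux (Z x), Z x⟫ + ‖H x‖ ^ 2) := by
    filter_upwards [Lp.coeFn_sub Z H] with x hx
    rw [hx, Pi.sub_apply]
    have h1 := Real.rpow_le_rpow (norm_nonneg _) (norm_sub_le (Z x) (H x)) g.β_pos.le
    have h2 := add_rpow_le_two_mul (norm_nonneg (Z x)) (norm_nonneg (H x)) g.one_lt_β.le
      g.β_lt_two.le
    have h3 := h (Z x)
    have h4 := rpow_le_one_add_sq (norm_nonneg (H x)) g.β_pos.le g.β_lt_two.le
    have h5 := g.inner_flux_self_nonneg (Z x)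
    nlinarith [sq_nonneg ‖H x‖, mul_nonneg hC.le (sq_nonneg ‖H x‖)]
  have hint₀ : Integrable (fun x => 1 + ⟪g.flux (Z x), Z x⟫) μ :=
    (integrable_const 1).add (g.integrable_inner_flux Z Z)
  have hint : Integrable (fun x => 1 + ⟪g.flux (Z x), Z x⟫ + ‖H x‖ ^ 2) μ :=
    hint₀.add (integrable_norm_sq H)
  refine (integral_mono_ae (g.integrable_norm_rpow_β _) (hint.const_mul _) hpointwise).trans ?_
  rw [integral_const_mul, integral_add hint₀ (integrable_norm_sq H),
    integral_add (integrable_const 1) (g.integrable_inner_flux Z Z),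
    ← inner_fluxLp, ← L2_norm_sq_eq_integral, integral_const, smul_eq_mul, mul_one]
  have h1 := g.inner_fluxLp_self_nonneg Z
  rw [mul_assoc (4 * (C + 1)) (1 + _)]
  refine mul_le_mul_of_nonneg_left ?_ (by positivity : 0 ≤ 4 * (C + 1))
  have h2 : 0 ≤ μ.real univ * ⟪g.fluxLp Z, Z⟫ := mul_nonneg hm h1
  have h3 : 0 ≤ μ.real univ * ‖H‖ ^ 2 := mul_nonneg hm (sq_nonneg _)
  linarith

end Law

theorem intervalIntegrable_of_continuousOn_Ici {f : ℝ → ℝ} {a b : ℝ} (hf : ContinuousOn f (Ici 0))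
    (ha : 0 ≤ a) (hb : 0 ≤ b) : IntervalIntegrable f volume a b :=
  (hf.mono fun _ hx => (le_min ha hb).trans hx.1).intervalIntegrable

section Gronwall

/-- The solution at time `t` of `u' = -k u + R`, `u s = a`, by variation of constants. -/
def duhamel (k a s : ℝ) (R : ℝ → ℝ) (t : ℝ) : ℝ :=
  Real.exp (-k * (t - s)) * a + ∫ x in s..t, Real.exp (-k * (t - x)) * R x

variable {k a s t : ℝ} {R : ℝ → ℝ}

theorem duhamel_self : duhamel k a s R s = a := by simp [duhamel]

theorem duhamel_eq_exp_mul : duhamel k a s R t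
    = Real.exp (-k * t) * (Real.exp (k * s) * a + ∫ x in s..t, Real.exp (k * x) * R x) := by
  rw [duhamel, mul_add, ← mul_assoc, ← Real.exp_add, ← intervalIntegral.integral_const_mul]
  congr 1
  · congr 2; ring
  · refine intervalIntegral.integral_congr fun x _ => ?_
    rw [← mul_assoc, ← Real.exp_add]
    congr 2; ring

theorem hasDerivAt_duhamel (hR : ContinuousOn R (Ici 0)) (hs : 0 < s) (ht : 0 < t) :
    HasDerivAt (duhamel k a s R) (-k * duhamel k a s R t + R t) t := by
  have hcont : ContinuousOn (fun x => Real.exp (k * x) * R x) (Ici 0) :=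
    (by fun_prop : Continuous fun x : ℝ => Real.exp (k * x)).continuousOn.mul hR
  have hint : HasDerivAt (fun t => ∫ x in s..t, Real.exp (k * x) * R x)
      (Real.exp (k * t) * R t) t :=
    intervalIntegral.integral_hasDerivAt_right
      (intervalIntegrable_of_continuousOn_Ici hcont hs.le ht.le)
      ((hcont.mono Ioi_subset_Ici_self).stronglyMeasurableAtFilter isOpen_Ioi t ht)
      (hcont.continuousAt (Ici_mem_nhds ht))
  have hexp : HasDerivAt (fun t : ℝ => Real.exp (-k * t)) (Real.exp (-k * t) * -k) t := by
    simpa using ((hasDerivAt_id t).const_mul (-k)).exp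
  have h1 : Real.exp (-k * t) * Real.exp (k * t) = 1 := by rw [← Real.exp_add]; simp
  rw [funext fun t => duhamel_eq_exp_mul (k := k) (a := a) (s := s) (t := t) (R := R)]
  refine (hexp.mul (hint.const_add (Real.exp (k * s) * a))).congr_deriv ?_
  linear_combination R t * h1

theorem le_duhamel_of_slope_lt {J J' : ℝ → ℝ} (hs : 0 < s) (hst : s ≤ t)
    (hJ : ContinuousOn J (Icc s t)) (hR : ContinuousOn R (Ici 0))
    (hslope : ∀ x ∈ Ico s t, ∀ r, J' x < r → ∀ᶠ z in 𝓝[>] x, slope J x z < r)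
    (hlt : ∀ x ∈ Ico s t, J' x < -k * J x + R x) : J t ≤ duhamel k (J s) s R t := by
  have hderiv : ∀ x, s ≤ x → HasDerivAt (duhamel k (J s) s R) _ x := fun x hx =>
    hasDerivAt_duhamel hR hs (hs.trans_le hx)
  exact image_le_of_liminf_slope_right_lt_deriv_boundary' hJ
    (fun x hx r hr => (hslope x hx r hr).frequently) duhamel_self.ge
    (fun x hx => (hderiv x hx.1).continuousAt.continuousWithinAt)
    (fun x hx => (hderiv x hx.1).hasDerivWithinAt)
    (fun x hx hx' => by rw [← hx']; exact hlt x hx) (right_mem_Icc.2 hst)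

theorem duhamel_le {a' t₀ : ℝ} (hk : 0 ≤ k) (hR : ContinuousOn R (Ici 0))
    (hR0 : ∀ x, 0 ≤ x → 0 ≤ R x) (ha : a ≤ a') (ha' : 0 ≤ a') (hs : 0 ≤ s) (hst₀ : s ≤ t₀)
    (ht₀t : t₀ ≤ t) :
    duhamel k a s R t
      ≤ Real.exp (-k * (t - t₀)) * a' + ∫ x in (0 : ℝ)..t, Real.exp (-k * (t - x)) * R x := by
  have hexp : Real.exp (-k * (t - s)) ≤ Real.exp (-k * (t - t₀)) :=
    Real.exp_le_exp.2 (by nlinarith)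
  have hcont : ContinuousOn (fun x => Real.exp (-k * (t - x)) * R x) (Ici 0) :=
    (by fun_prop : Continuous fun x : ℝ => Real.exp (-k * (t - x))).continuousOn.mul hR
  refine add_le_add ((mul_le_mul_of_nonneg_left ha (Real.exp_pos _).le).trans
    (mul_le_mul_of_nonneg_right hexp ha')) ?_
  exact intervalIntegral.integral_mono_interval hs (hst₀.trans ht₀t) le_rfl
    ((ae_restrict_iff' measurableSet_Ioc).2 (ae_of_all _ fun x hx =>
      mul_nonneg (Real.exp_pos _).le (hR0 x hx.1.le)))
    (intervalIntegrable_of_continuousOn_Ici hcont le_rfl (hs.trans (hst₀.trans ht₀t)))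

theorem duhamel_const (hk : k ≠ 0) (N : ℝ) :
    duhamel k a s (fun _ => N) t = Real.exp (-k * (t - s)) * (a - N / k) + N / k := by
  have hexp : ∫ x in s..t, Real.exp (k * x) = (Real.exp (k * t) - Real.exp (k * s)) / k := by
    rw [intervalIntegral.integral_comp_mul_left (fun x => Real.exp x) hk, integral_exp,
      smul_eq_mul, inv_mul_eq_div]
  have h1 : Real.exp (-(k * t)) * Real.exp (k * t) = 1 := by rw [← Real.exp_add]; simp
  have h2 : Real.exp (-k * (t - s)) = Real.exp (-(k * t)) * Real.exp (k * s) := by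
    rw [← Real.exp_add]; congr 1; ring
  rw [duhamel_eq_exp_mul, intervalIntegral.integral_mul_const, hexp, h2, neg_mul]
  field_simp
  linear_combination N * h1

theorem tendsto_duhamel_const (hk : 0 < k) (N : ℝ) :
    Tendsto (duhamel k a s fun _ => N) atTop (𝓝 (N / k)) := by
  have hexp : Tendsto (fun t : ℝ => Real.exp (-k * (t - s))) atTop (𝓝 0) :=
    Real.tendsto_exp_atBot.comp ((tendsto_atTop_add_const_right _ (-s)
      tendsto_id).const_mul_atTop_of_neg (neg_neg_of_pos hk))
  rw [funext fun t => duhamel_const (a := a) (s := s) (t := t) hk.ne' N]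
  simpa using (hexp.mul_const (a - N / k)).add_const (N / k)

end Gronwall

section Decay

variable {c q D : ℝ} {y : ℝ → ℝ}

theorem le_of_deriv_neg_above {s t m : ℝ} (hst : s ≤ t) (hc : ContinuousOn y (Icc s t))
    (hd : ∀ x ∈ Ioo s t, DifferentiableAt ℝ y x) (hs : y s ≤ m)
    (h : ∀ x ∈ Ioo s t, m < y x → deriv y x < 0) : y t ≤ m := by
  by_contra! hlt
  rcases hst.eq_or_lt with rfl | hst
  · exact hlt.not_ge hs
  -- A barrier strictly between `m` and `y t` cannot be crossed from below.
  obtain ⟨M, hmM, hMt⟩ := exists_between hlt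
  have hcs : Tendsto y (𝓝[>] s) (𝓝 (y s)) :=
    ((hc s (left_mem_Icc.2 hst.le)).mono_of_mem_nhdsWithin (Icc_mem_nhdsGE hst)).mono_left
      (nhdsWithin_mono _ Ioi_subset_Ici_self)
  obtain ⟨s', hs', hI⟩ :=
    ((hcs.eventually_lt_const (hs.trans_lt hmM)).and (Ioo_mem_nhdsGT hst)).exists
  refine hMt.not_ge (image_le_of_deriv_right_lt_deriv_boundary' (f := y) (a := s') (b := t)
    (hc.mono (Icc_subset_Icc_left hI.1.le))
    (fun x hx => (hd x ⟨hI.1.trans_le hx.1, hx.2⟩).hasDerivAt.hasDerivWithinAt)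
    (B := fun _ => M) (B' := fun _ => 0) hs'.le continuousOn_const
    (fun x _ => hasDerivWithinAt_const _ _ _)
    (fun x hx hx' => h x ⟨hI.1.trans_le hx.1, hx.2⟩ (by rwa [hx']))
    (right_mem_Icc.2 hI.2.le))

theorem neg_mul_rpow_add_lt {x E : ℝ} (hq : 0 < q) (hc : 0 < c) (hE : 0 ≤ E)
    (hx : (E / c) ^ q⁻¹ < x) : -c * x ^ q + D < D - E := by
  have h0 : 0 ≤ E / c := div_nonneg hE hc.le
  have h1 : E / c < x ^ q := by
    have h2 := Real.rpow_lt_rpow (Real.rpow_nonneg h0 _) hx hq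
    rwa [← Real.rpow_mul h0, inv_mul_cancel₀ hq.ne', Real.rpow_one] at h2
  rw [div_lt_iff₀ hc] at h1
  linarith

theorem le_add_of_deriv_le_neg_mul_rpow {t : ℝ} (hq : 0 < q) (hc : 0 < c) (hD : 0 ≤ D)
    (ht : 0 ≤ t) (hy0 : 0 ≤ y 0) (hy : ContinuousOn y (Icc 0 t))
    (hd : ∀ x ∈ Ioo 0 t, DifferentiableAt ℝ y x)
    (hle : ∀ x ∈ Ioo 0 t, deriv y x ≤ -c * y x ^ q + D) : y t ≤ y 0 + (D / c) ^ q⁻¹ := by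
  refine le_of_deriv_neg_above ht hy hd (by linarith [Real.rpow_nonneg (div_nonneg hD hc.le) q⁻¹])
    fun x hx hlt => (hle x hx).trans_lt ?_
  simpa using neg_mul_rpow_add_lt (D := D) hq hc hD (by linarith : (D / c) ^ q⁻¹ < y x)

theorem eventually_le_of_deriv_le_neg_mul_rpow {T : ℝ} (hq : 0 < q) (hc : 0 < c) (hD : 0 < D)
    (hy0 : ∀ t, T ≤ t → 0 ≤ y t) (hy : ContinuousOn y (Ici T))
    (hd : ∀ t, T < t → DifferentiableAt ℝ y t)
    (hle : ∀ t, T < t → deriv y t ≤ -c * y t ^ q + D) :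
    ∀ᶠ t in atTop, y t ≤ (2 * D / c) ^ q⁻¹ := by
  set m := (2 * D / c) ^ q⁻¹
  have hdecay : ∀ t, T < t → m < y t → deriv y t < -D := fun t ht hm => by
    have := neg_mul_rpow_add_lt (D := D) hq hc (by positivity : 0 ≤ 2 * D) hm
    linarith [hle t ht]
  obtain ⟨T', hT', hyT'⟩ : ∃ T', T ≤ T' ∧ y T' ≤ m := by
    -- Otherwise `y` would decrease at rate at least `D` forever.
    by_contra! hgt
    set t := T + y T / D + 1 with ht
    have hTt : T ≤ t := by linarith [div_nonneg (hy0 T le_rfl) hD.le]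
    have hsub := intervalIntegral.sub_le_integral_of_hasDeriv_right_of_le (φ := fun _ => -D) hTt
      (hy.mono Icc_subset_Ici_self)
      (fun x hx => (hd x hx.1).hasDerivAt.hasDerivWithinAt)
      (by simp) fun x hx => (hdecay x hx.1 (hgt x hx.1.le)).le
    rw [intervalIntegral.integral_const, smul_eq_mul] at hsub
    have : (t - T) * D = y T + D := by rw [ht]; field_simp; ring
    linarith [hy0 t hTt]
  filter_upwards [eventually_ge_atTop T'] with t ht
  exact le_of_deriv_neg_above ht (hy.mono fun x hx => hT'.trans hx.1)
    (fun x hx => hd x (hT'.trans_lt hx.1)) hyT' fun x hx hlt =>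
      (hdecay x (hT'.trans_lt hx.1) hlt).trans (neg_neg_of_pos hD)

end Decay

/-- The scalar differential inequalities satisfied by a gradient flow: `y` is the squared norm of
the solution modulo the kernel of the gradient, `H` its energy, `κ` its dissipation, `p` the squared
norm of its velocity; `S`, `P` and `Q` measure the data. -/
structure EnergySystem (b c C : ℝ) (y H p κ S P Q : ℝ → ℝ) : Prop where
  y_nonneg : ∀ t, 0 ≤ t → 0 ≤ y t
  H_nonneg : ∀ t, 0 ≤ t → 0 ≤ H t
  p_nonneg : ∀ t, 0 ≤ t → 0 ≤ p t
  S_nonneg : ∀ t, 0 ≤ t → 0 ≤ S t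
  P_nonneg : ∀ t, 0 ≤ t → 0 ≤ P t
  Q_nonneg : ∀ t, 0 ≤ t → 0 ≤ Q t
  H_le : ∀ t, 0 < t → H t ≤ κ t
  continuousOn_y : ContinuousOn y (Ici 0)
  continuousOn_H : ContinuousOn H (Ici 0)
  continuousOn_p : ContinuousOn p (Ioi 0)
  differentiableAt_y : ∀ t, 0 < t → DifferentiableAt ℝ y t
  differentiableAt_H : ∀ t, 0 < t → DifferentiableAt ℝ H t
  deriv_y_le : ∀ t, 0 < t → deriv y t ≤ -(1 / 2) * κ t - c * y t ^ (b / 2) + C * (1 + S t)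
  deriv_H_le : ∀ t, 0 < t →
    deriv H t ≤ -(3 / 4) * p t + C * κ t + C * (1 + S t ^ (2 / b) + P t)
  slope_p_lt : ∀ t, 0 < t → ∀ r, 1 / 2 * p t + C * (Q t + P t) < r →
    ∀ᶠ z in 𝓝[>] t, slope p t z < r

namespace EnergySystem

/-- The weight of `y` in the Lyapunov function: large enough for the dissipation in `y'` to absorb
the term `C κ` in `H'`. -/
def yWeight (C : ℝ) : ℝ := 2 * C + 1 / 2

/-- The energy `H` corrected by a multiple of `y`. -/
def storedEnergy (C : ℝ) (y H : ℝ → ℝ) (t : ℝ) : ℝ := H t + yWeight C * y t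

/-- The Lyapunov function of the system. -/
def lyapunov (C : ℝ) (y H p : ℝ → ℝ) (t : ℝ) : ℝ := p t + storedEnergy C y H t

/-- The size of the forcing in the inequality satisfied by the stored energy. -/
def forcing (b C : ℝ) (S P : ℝ → ℝ) (t : ℝ) : ℝ :=
  (C + 2 * yWeight C * C) * (1 + S t ^ (2 / b) + P t)

variable {b c C : ℝ} {y H p κ S P Q : ℝ → ℝ}

theorem yWeight_pos (hC : 0 < C) : 0 < yWeight C := by unfold yWeight; positivity

theorem storedEnergy_nonneg (h : EnergySystem b c C y H p κ S P Q) (hC : 0 < C) {t : ℝ}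
    (ht : 0 ≤ t) : 0 ≤ storedEnergy C y H t :=
  add_nonneg (h.H_nonneg t ht) (mul_nonneg (yWeight_pos hC).le (h.y_nonneg t ht))

theorem continuousOn_storedEnergy (h : EnergySystem b c C y H p κ S P Q) :
    ContinuousOn (storedEnergy C y H) (Ici 0) :=
  h.continuousOn_H.add (continuousOn_const.mul h.continuousOn_y)

theorem continuousOn_lyapunov (h : EnergySystem b c C y H p κ S P Q) :
    ContinuousOn (lyapunov C y H p) (Ioi 0) :=
  h.continuousOn_p.add (h.continuousOn_storedEnergy.mono Ioi_subset_Ici_self)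

theorem hasDerivAt_storedEnergy (h : EnergySystem b c C y H p κ S P Q) {t : ℝ} (ht : 0 < t) :
    HasDerivAt (storedEnergy C y H) (deriv H t + yWeight C * deriv y t) t :=
  (h.differentiableAt_H t ht).hasDerivAt.add ((h.differentiableAt_y t ht).hasDerivAt.const_mul _)

theorem deriv_add_yWeight_mul_deriv_le (h : EnergySystem b c C y H p κ S P Q) (hb : 0 < b)
    (hb2 : b ≤ 2) (hc : 0 ≤ c) (hC : 0 < C) {t : ℝ} (ht : 0 < t) :
    deriv H t + yWeight C * deriv y t
      ≤ -(3 / 4) * p t - 1 / 4 * H t + forcing b C S P t := by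
  have hA := yWeight_pos hC
  have hS := h.S_nonneg t ht.le
  have hSe : S t ≤ 1 + S t ^ (2 / b) := le_one_add_rpow hS ((one_le_div hb).2 hb2)
  have := Real.rpow_nonneg hS (2 / b)
  have hP := h.P_nonneg t ht.le
  have hy : deriv y t ≤ -(1 / 2) * κ t + C * (2 + S t ^ (2 / b)) := by
    have hdrop : 0 ≤ c * y t ^ (b / 2) := mul_nonneg hc (Real.rpow_nonneg (h.y_nonneg t ht.le) _)
    have hforce : C * (1 + S t) ≤ C * (2 + S t ^ (2 / b)) :=
      mul_le_mul_of_nonneg_left (by linarith) hC.le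
    linarith [h.deriv_y_le t ht]
  have hAy := mul_le_mul_of_nonneg_left hy hA.le
  have hκ : yWeight C * κ t = 2 * C * κ t + 1 / 2 * κ t := by unfold yWeight; ring
  have h1 : 0 ≤ yWeight C * C * S t ^ (2 / b) := by positivity
  have h2 : 0 ≤ yWeight C * C * P t := by positivity
  unfold forcing
  linarith [h.deriv_H_le t ht, h.H_le t ht]

theorem forcing_le (h : EnergySystem b c C y H p κ S P Q) (hb : 0 < b) (hC : 0 < C) {t L : ℝ}
    (ht : 0 ≤ t) (hS : S t ≤ L) :
    forcing b C S P t ≤ (C + 2 * yWeight C * C) * (1 + L ^ (2 / b) + P t) := by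
  have hA := yWeight_pos hC
  have hpow : S t ^ (2 / b) ≤ L ^ (2 / b) :=
    Real.rpow_le_rpow (h.S_nonneg t ht) hS (by positivity)
  unfold forcing
  gcongr

theorem slope_lyapunov_lt (h : EnergySystem b c C y H p κ S P Q) (hb : 0 < b) (hb2 : b ≤ 2)
    (hc : 0 ≤ c) (hC : 0 < C) {t r : ℝ} (ht : 0 < t)
    (hr : -(1 / 4) * lyapunov C y H p t
      + (1 / 4 * yWeight C * y t + forcing b C S P t + C * (Q t + P t)) < r) :
    ∀ᶠ z in 𝓝[>] t, slope (lyapunov C y H p) t z < r := by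
  set P' := 1 / 2 * p t + C * (Q t + P t) with hP'
  set E' := deriv H t + yWeight C * deriv y t
  have hsum : P' + E' < r := by
    have := h.deriv_add_yWeight_mul_deriv_le hb hb2 hc hC ht
    simp only [lyapunov, storedEnergy] at hr
    linarith
  have hE : ∀ᶠ z in 𝓝[>] t, slope (storedEnergy C y H) t z < E' + (r - (P' + E')) / 2 :=
    ((hasDerivAt_iff_tendsto_slope.1 (h.hasDerivAt_storedEnergy ht)).mono_left
      (nhdsWithin_mono _ fun x hx => ne_of_gt hx)).eventually_lt_const (by linarith)
  filter_upwards [hE, h.slope_p_lt t ht (P' + (r - (P' + E')) / 2) (by linarith)] with z hzE hzp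
  have hslope : slope (lyapunov C y H p) t z = slope p t z + slope (storedEnergy C y H) t z := by
    simp only [slope_def_field, lyapunov]
    ring
  linarith

theorem lyapunov_le_duhamel (h : EnergySystem b c C y H p κ S P Q) (hb : 0 < b) (hb2 : b ≤ 2)
    (hc : 0 ≤ c) (hC : 0 < C) {R : ℝ → ℝ} (hR : ContinuousOn R (Ici 0)) {s t : ℝ} (hs : 0 < s)
    (hst : s ≤ t)
    (hlt : ∀ x ∈ Ico s t,
      1 / 4 * yWeight C * y x + forcing b C S P x + C * (Q x + P x) < R x) :
    lyapunov C y H p t ≤ duhamel (1 / 4) (lyapunov C y H p s) s R t :=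
  le_duhamel_of_slope_lt hs hst (h.continuousOn_lyapunov.mono fun _ hx => hs.trans_le hx.1) hR
    (fun _ hx _ hr => h.slope_lyapunov_lt hb hb2 hc hC (hs.trans_le hx.1) hr)
    (fun x hx => by simpa using hlt x hx)

theorem deriv_y_le_of_S_le (h : EnergySystem b c C y H p κ S P Q) (hC : 0 < C) {t L : ℝ}
    (ht : 0 < t) (hS : S t ≤ L) : deriv y t ≤ -c * y t ^ (b / 2) + C * (1 + L) := by
  have hκ := (h.H_nonneg t ht.le).trans (h.H_le t ht)
  have hCS : C * (1 + S t) ≤ C * (1 + L) := by gcongr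
  linarith [h.deriv_y_le t ht]

theorem y_le (h : EnergySystem b c C y H p κ S P Q) (hb1 : 1 ≤ b) (hb2 : b ≤ 2)
    (hc : 0 < c) (hC : 0 < C) {G : ℝ → ℝ} (hG : MonotoneOn G (Ici 0))
    (hSG : ∀ t, 0 ≤ t → S t ≤ G t) {t : ℝ} (ht : 0 ≤ t) :
    y t ≤ y 0 + 2 * (C / c) ^ (2 / b) * (1 + G t ^ (2 / b)) := by
  have hb : 0 < b := by linarith
  have hG0 : 0 ≤ G t := (h.S_nonneg t ht).trans (hSG t ht)
  have hyD := le_add_of_deriv_le_neg_mul_rpow (y := y) (half_pos hb) hc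
    (by positivity : 0 ≤ C * (1 + G t)) ht (h.y_nonneg 0 le_rfl)
    (h.continuousOn_y.mono Icc_subset_Ici_self) (fun x hx => h.differentiableAt_y x hx.1)
    fun x hx => h.deriv_y_le_of_S_le hC hx.1
      ((hSG x hx.1.le).trans (hG hx.1.le ht hx.2.le))
  rw [inv_div, mul_div_right_comm] at hyD
  refine hyD.trans ?_
  gcongr
  exact mul_one_add_rpow_le (by positivity) hG0 ((one_le_div hb).2 hb2)
    ((div_le_iff₀ hb).2 (by linarith))

theorem eventually_y_le (h : EnergySystem b c C y H p κ S P Q) (hb1 : 1 ≤ b) (hb2 : b ≤ 2)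
    (hc : 0 < c) (hC : 0 < C) {L : ℝ} (hL : 0 ≤ L) (hS : ∀ᶠ t in atTop, S t ≤ L) :
    ∀ᶠ t in atTop, y t ≤ 2 * (2 * C / c) ^ (2 / b) * (1 + L ^ (2 / b)) := by
  have hb : 0 < b := by linarith
  obtain ⟨T, hT⟩ := eventually_atTop.1 (hS.and (eventually_ge_atTop 0))
  have hT0 : 0 ≤ T := (hT T le_rfl).2
  have hyD := eventually_le_of_deriv_le_neg_mul_rpow (y := y) (half_pos hb) hc
    (by positivity : 0 < C * (1 + L)) (fun t ht => h.y_nonneg t (hT0.trans ht))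
    (h.continuousOn_y.mono fun t ht => hT0.trans ht)
    (fun t ht => h.differentiableAt_y t (hT0.trans_lt ht))
    fun t ht => h.deriv_y_le_of_S_le hC (hT0.trans_lt ht) (hT t ht.le).1
  rw [inv_div, ← mul_assoc, mul_div_right_comm] at hyD
  filter_upwards [hyD] with t ht
  exact ht.trans (mul_one_add_rpow_le (by positivity) hL ((one_le_div hb).2 hb2)
    ((div_le_iff₀ hb).2 (by linarith)))

theorem p_le_lyapunov (h : EnergySystem b c C y H p κ S P Q) (hC : 0 < C) {t : ℝ} (ht : 0 ≤ t) :
    p t ≤ lyapunov C y H p t :=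
  le_add_of_nonneg_right (h.storedEnergy_nonneg hC ht)

theorem eventually_p_le (h : EnergySystem b c C y H p κ S P Q) (hb : 0 < b) (hb2 : b ≤ 2)
    (hc : 0 ≤ c) (hC : 0 < C) {N : ℝ} (hN : 0 < N)
    (hlt : ∀ᶠ t in atTop,
      1 / 4 * yWeight C * y t + forcing b C S P t + C * (Q t + P t) < N) :
    ∀ᶠ t in atTop, p t ≤ 5 * N := by
  obtain ⟨T, hT⟩ := eventually_atTop.1 (hlt.and (eventually_gt_atTop 0))
  have hT0 : 0 < T := (hT T le_rfl).2
  have hlim := tendsto_duhamel_const (a := lyapunov C y H p T) (s := T)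
    (by norm_num : (0 : ℝ) < 1 / 4) N
  filter_upwards [hlim.eventually_le_const (by linarith : N / (1 / 4) < 5 * N),
    eventually_ge_atTop T] with t htN htT
  exact (h.p_le_lyapunov hC (hT0.le.trans htT)).trans
    ((h.lyapunov_le_duhamel hb hb2 hc hC continuousOn_const hT0 htT
      fun x hx => (hT x hx.1).1).trans htN)

theorem eventually_le (hb1 : 1 ≤ b) (hb2 : b ≤ 2) (hc : 0 < c) (hC : 0 < C) :
    ∃ C₁ : ℝ, 0 < C₁ ∧ ∀ {y H p κ S P Q : ℝ → ℝ},
      EnergySystem b c C y H p κ S P Q → ∀ {L LP LQ : ℝ}, 0 ≤ L → 0 ≤ LP → 0 ≤ LQ →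
      (∀ᶠ t in atTop, S t ≤ L) → (∀ᶠ t in atTop, P t ≤ LP) → (∀ᶠ t in atTop, Q t ≤ LQ) →
      ∀ᶠ t in atTop, p t ≤ C₁ * (1 + L ^ (2 / b) + LP + LQ) := by
  have hb : 0 < b := by linarith
  have hA := yWeight_pos hC
  set B := 2 * (2 * C / c) ^ (2 / b)
  set F := C + 2 * yWeight C * C
  have : 0 ≤ B := by positivity
  have : 0 < F := by positivity
  refine ⟨5 * (F + C + 1 / 4 * yWeight C * B), by positivity,
    fun {y H p κ S P Q} h {L LP LQ} hL hLP hLQ hS hP hQ => ?_⟩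
  rw [mul_assoc]
  refine h.eventually_p_le hb hb2 hc.le hC (by positivity) ?_
  filter_upwards [h.eventually_y_le hb1 hb2 hc hC hL hS, hS, hP, hQ, eventually_ge_atTop 0]
    with t hyt hSt hPt hQt ht
  have hy : 1 / 4 * yWeight C * y t ≤ 1 / 4 * yWeight C * (B * (1 + L ^ (2 / b))) := by gcongr
  have hf : forcing b C S P t ≤ F * (1 + L ^ (2 / b) + LP) :=
    (h.forcing_le hb hC ht hSt).trans (by gcongr)
  have hq : C * (Q t + P t) ≤ C * (LQ + LP) := by gcongr
  have h1 : 0 < C * (1 + L ^ (2 / b)) := by positivity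
  have h2 : 0 ≤ F * LQ := by positivity
  have h3 : 0 ≤ 1 / 4 * yWeight C * B * (LP + LQ) := by positivity
  linarith

section StartingTime

variable {R : ℝ → ℝ}

theorem storedEnergy_le (h : EnergySystem b c C y H p κ S P Q) (hb : 0 < b) (hb2 : b ≤ 2)
    (hc : 0 ≤ c) (hC : 0 < C) (hR : ContinuousOn R (Ici 0))
    (hle : ∀ t, 0 < t → forcing b C S P t ≤ R t) {t : ℝ} (ht : 0 ≤ t) :
    storedEnergy C y H t ≤ storedEnergy C y H 0 + ∫ x in (0 : ℝ)..t, R x := by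
  have hsub := intervalIntegral.sub_le_integral_of_hasDeriv_right_of_le ht
    (h.continuousOn_storedEnergy.mono Icc_subset_Ici_self)
    (fun x hx => (h.hasDerivAt_storedEnergy hx.1).hasDerivWithinAt)
    ((hR.mono Icc_subset_Ici_self).integrableOn_compact isCompact_Icc) fun x hx => by
      linarith [h.deriv_add_yWeight_mul_deriv_le hb hb2 hc hC hx.1, hle x hx.1,
        h.p_nonneg x hx.1.le, h.H_nonneg x hx.1.le]
  linarith

theorem exists_p_le (h : EnergySystem b c C y H p κ S P Q) (hb : 0 < b) (hb2 : b ≤ 2)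
    (hc : 0 ≤ c) (hC : 0 < C) (hR : ContinuousOn R (Ici 0))
    (hle : ∀ t, 0 < t → forcing b C S P t ≤ R t) {t₀ : ℝ} (ht₀ : 0 < t₀)
    (hpos : 0 < storedEnergy C y H 0 + ∫ x in (0 : ℝ)..t₀, R x) :
    ∃ s ∈ Ioo 0 t₀, p s
      ≤ 2 * t₀⁻¹ * (storedEnergy C y H 0 + ∫ x in (0 : ℝ)..t₀, R x) := by
  set I := storedEnergy C y H 0 + ∫ x in (0 : ℝ)..t₀, R x
  by_contra! hcon
  have hsub := intervalIntegral.sub_le_integral_of_hasDeriv_right_of_le ht₀.le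
    (φ := fun x => R x - 3 / 2 * t₀⁻¹ * I)
    (h.continuousOn_storedEnergy.mono Icc_subset_Ici_self)
    (fun x hx => (h.hasDerivAt_storedEnergy hx.1).hasDerivWithinAt)
    (((hR.mono Icc_subset_Ici_self).sub continuousOn_const).integrableOn_compact isCompact_Icc)
    fun x hx => by
      linarith [h.deriv_add_yWeight_mul_deriv_le hb hb2 hc hC hx.1, hle x hx.1,
        h.H_nonneg x hx.1.le, hcon x hx]
  rw [intervalIntegral.integral_sub (intervalIntegrable_of_continuousOn_Ici hR le_rfl ht₀.le)
    (by simp), intervalIntegral.integral_const, smul_eq_mul] at hsub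
  have : (t₀ - 0) * (3 / 2 * t₀⁻¹ * I) = 3 / 2 * I := by field_simp; ring
  linarith [h.storedEnergy_nonneg hC ht₀.le]

theorem exists_lyapunov_le (h : EnergySystem b c C y H p κ S P Q) (hb : 0 < b) (hb2 : b ≤ 2)
    (hc : 0 ≤ c) (hC : 0 < C) (hR : ContinuousOn R (Ici 0)) (hR0 : ∀ t, 0 ≤ t → 0 < R t)
    (hle : ∀ t, 0 < t → forcing b C S P t ≤ R t) {t₀ : ℝ} (ht₀ : 0 < t₀) (ht₁ : t₀ ≤ 1) :
    ∃ s ∈ Ioo 0 t₀, lyapunov C y H p s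
      ≤ 3 * t₀⁻¹ * (storedEnergy C y H 0 + ∫ x in (0 : ℝ)..t₀, R x) := by
  have hRi : IntervalIntegrable R volume 0 t₀ :=
    intervalIntegrable_of_continuousOn_Ici hR le_rfl ht₀.le
  have hpos : 0 < storedEnergy C y H 0 + ∫ x in (0 : ℝ)..t₀, R x :=
    add_pos_of_nonneg_of_pos (h.storedEnergy_nonneg hC le_rfl)
      (intervalIntegral.intervalIntegral_pos_of_pos_on hRi (fun x hx => hR0 x hx.1.le) ht₀)
  obtain ⟨s, hs, hps⟩ := h.exists_p_le hb hb2 hc hC hR hle ht₀ hpos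
  refine ⟨s, hs, ?_⟩
  have hmono : ∫ x in (0 : ℝ)..s, R x ≤ ∫ x in (0 : ℝ)..t₀, R x :=
    intervalIntegral.integral_mono_interval le_rfl hs.1.le hs.2.le
      ((ae_restrict_iff' measurableSet_Ioc).2 (ae_of_all _ fun x hx => (hR0 x hx.1.le).le)) hRi
  have hinv := le_mul_of_one_le_left hpos.le ((one_le_inv₀ ht₀).2 ht₁)
  unfold lyapunov
  linarith [h.storedEnergy_le hb hb2 hc hC hR hle hs.1.le]

end StartingTime

section Envelope

variable {G : ℝ → ℝ} {t₀ : ℝ}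

theorem exists_lyapunov_le_initial (h : EnergySystem b c C y H p κ S P Q) (hb : 0 < b)
    (hb2 : b ≤ 2) (hc : 0 ≤ c) (hC : 0 < C) (hP : ContinuousOn P (Ici 0))
    (hG : ContinuousOn G (Ici 0)) (hSG : ∀ t, 0 ≤ t → S t ≤ G t) (ht₀ : 0 < t₀) (ht₁ : t₀ ≤ 1) :
    ∃ s ∈ Ioo 0 t₀, lyapunov C y H p s
      ≤ 3 * (1 + yWeight C + (C + 2 * yWeight C * C)) *
        (t₀⁻¹ * (1 + y 0 + H 0 + ∫ x in (0 : ℝ)..t₀, (P x + G x ^ (2 / b)))) := by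
  have hA := yWeight_pos hC
  have he : 0 ≤ 2 / b := by positivity
  have hGe0 : ∀ t, 0 ≤ t → 0 ≤ P t + G t ^ (2 / b) := fun t ht =>
    add_nonneg (h.P_nonneg t ht) (Real.rpow_nonneg ((h.S_nonneg t ht).trans (hSG t ht)) _)
  have hGe : ContinuousOn (fun x => P x + G x ^ (2 / b)) (Ici 0) :=
    hP.add (hG.rpow_const fun _ _ => Or.inr he)
  set F := C + 2 * yWeight C * C
  have hF : 0 < F := by positivity
  obtain ⟨s, hs, hJs⟩ := h.exists_lyapunov_le hb hb2 hc hC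
    (R := fun x => F * (1 + (P x + G x ^ (2 / b))))
    (continuousOn_const.mul (continuousOn_const.add hGe))
    (fun t ht => mul_pos hF (by linarith [hGe0 t ht]))
    (fun t ht => (h.forcing_le hb hC ht.le (hSG t ht.le)).trans_eq (by ring)) ht₀ ht₁
  refine ⟨s, hs, hJs.trans ?_⟩
  rw [intervalIntegral.integral_const_mul, intervalIntegral.integral_add (by simp)
    (intervalIntegrable_of_continuousOn_Ici hGe le_rfl ht₀.le), intervalIntegral.integral_const,
    sub_zero, smul_eq_mul, mul_one]
  have hI : 0 ≤ ∫ x in (0 : ℝ)..t₀, (P x + G x ^ (2 / b)) :=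
    intervalIntegral.integral_nonneg ht₀.le fun x hx => hGe0 x hx.1
  set I := ∫ x in (0 : ℝ)..t₀, (P x + G x ^ (2 / b))
  have hy0 := h.y_nonneg 0 le_rfl
  have hH0 := h.H_nonneg 0 le_rfl
  have hle : storedEnergy C y H 0 + F * (t₀ + I)
      ≤ (1 + yWeight C + F) * (1 + y 0 + H 0 + I) := by
    have h1 : F * (t₀ + I) ≤ F * (1 + I) := by gcongr
    have h2 : 0 ≤ (1 + yWeight C) * (1 + I) := by positivity
    have h3 : 0 ≤ (1 + F) * y 0 := by positivity
    have h4 : 0 ≤ (yWeight C + F) * H 0 := by positivity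
    unfold storedEnergy
    linarith
  calc _ ≤ 3 * t₀⁻¹ * ((1 + yWeight C + F) * (1 + y 0 + H 0 + I)) := by gcongr
    _ = _ := by ring

theorem forcing_add_lt (h : EnergySystem b c C y H p κ S P Q) (hb : 0 < b) (hC : 0 < C)
    {B E L t : ℝ} (hB : 0 ≤ B)
    (hE : E = C + 2 * yWeight C * C + C + 1 / 4 * yWeight C * B + 1 / 4 * yWeight C + 1)
    (ht : 0 ≤ t) (hS : S t ≤ L) (hy : y t ≤ y 0 + B * (1 + L ^ (2 / b))) :
    1 / 4 * yWeight C * y t + forcing b C S P t + C * (Q t + P t)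
      < E * (1 + y 0 + P t + Q t + L ^ (2 / b)) := by
  have hA := yWeight_pos hC
  have hforcing := h.forcing_le hb hC ht hS
  set F := C + 2 * yWeight C * C
  have : 0 < F := by positivity
  have hy0 := h.y_nonneg 0 le_rfl
  have hP := h.P_nonneg t ht
  have hQ := h.Q_nonneg t ht
  have hL := Real.rpow_nonneg ((h.S_nonneg t ht).trans hS) (2 / b)
  have hAy : 1 / 4 * yWeight C * y t
      ≤ 1 / 4 * yWeight C * (y 0 + B * (1 + L ^ (2 / b))) := by gcongr
  have h1 : 0 ≤ (C + 1 / 4 * yWeight C) * (1 + L ^ (2 / b)) := by positivity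
  have h2 : 0 ≤ (1 / 4 * yWeight C * B + 1 / 4 * yWeight C) * P t := by positivity
  have h3 : 0 ≤ (F + 1 / 4 * yWeight C * B + 1 / 4 * yWeight C) * Q t := by positivity
  have h4 : 0 ≤ (F + C + 1 / 4 * yWeight C * B) * y 0 := by positivity
  rw [hE]
  linarith

theorem le_bound (hb1 : 1 ≤ b) (hb2 : b ≤ 2) (hc : 0 < c) (hC : 0 < C) :
    ∃ C₁ : ℝ, 0 < C₁ ∧ ∀ {y H p κ S P Q G : ℝ → ℝ},
      EnergySystem b c C y H p κ S P Q → ContinuousOn P (Ici 0) → ContinuousOn Q (Ici 0) →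
      ContinuousOn G (Ici 0) → MonotoneOn G (Ici 0) → (∀ t, 0 ≤ t → S t ≤ G t) →
      ∀ t₀ : ℝ, 0 < t₀ → t₀ ≤ 1 → ∀ t, t₀ ≤ t →
      p t ≤ C₁ * (t₀⁻¹ * Real.exp (-(1 / 4) * (t - t₀)) *
          (1 + y 0 + H 0 + ∫ s in (0 : ℝ)..t₀, (P s + G s ^ (2 / b)))
        + ∫ s in (0 : ℝ)..t, Real.exp (-(1 / 4) * (t - s)) *
          (1 + y 0 + P s + Q s + G s ^ (2 / b))) := by
  have hb : 0 < b := by linarith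
  have hA := yWeight_pos hC
  set M := 3 * (1 + yWeight C + (C + 2 * yWeight C * C))
  set B := 2 * (C / c) ^ (2 / b)
  have hB : 0 ≤ B := by positivity
  obtain ⟨E, hE⟩ : ∃ E,
    E = C + 2 * yWeight C * C + C + 1 / 4 * yWeight C * B + 1 / 4 * yWeight C + 1 := ⟨_, rfl⟩
  have hE0 : 0 < E := by rw [hE]; positivity
  refine ⟨M + E, by positivity,
    fun {y H p κ S P Q G} h hP hQ hG hGm hSG t₀ ht₀ ht₁ t ht => ?_⟩
  have hy0 := h.y_nonneg 0 le_rfl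
  have hH0 := h.H_nonneg 0 le_rfl
  have hP0 := h.P_nonneg
  have hQ0 := h.Q_nonneg
  have hG0 : ∀ t, 0 ≤ t → 0 ≤ G t ^ (2 / b) := fun t ht =>
    Real.rpow_nonneg ((h.S_nonneg t ht).trans (hSG t ht)) _
  obtain ⟨s, hs, hJs⟩ := h.exists_lyapunov_le_initial hb hb2 hc.le hC hP hG hSG ht₀ ht₁
  have hI : 0 ≤ ∫ s in (0 : ℝ)..t₀, (P s + G s ^ (2 / b)) :=
    intervalIntegral.integral_nonneg ht₀.le fun x hx => add_nonneg (hP0 x hx.1) (hG0 x hx.1)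
  set I := ∫ s in (0 : ℝ)..t₀, (P s + G s ^ (2 / b))
  set W : ℝ → ℝ := fun x => 1 + y 0 + P x + Q x + G x ^ (2 / b)
  have hW : ContinuousOn W (Ici 0) := ((continuousOn_const.add hP).add hQ).add
    (hG.rpow_const fun _ _ => Or.inr (by positivity))
  have hW0 : ∀ x, 0 ≤ x → 0 ≤ W x := fun x hx =>
    add_nonneg (add_nonneg (add_nonneg (by positivity) (hP0 x hx)) (hQ0 x hx)) (hG0 x hx)
  have hEW : ContinuousOn (fun x => E * W x) (Ici 0) := continuousOn_const.mul hW
  have hp := (h.p_le_lyapunov hC (ht₀.le.trans ht)).trans <|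
    (h.lyapunov_le_duhamel hb hb2 hc.le hC hEW hs.1 (hs.2.le.trans ht) fun x hx =>
      have hx0 := hs.1.le.trans hx.1
      h.forcing_add_lt hb hC hB hE hx0 (hSG x hx0) (h.y_le hb1 hb2 hc hC hGm hSG hx0)).trans <|
    duhamel_le (by norm_num) hEW (fun x hx => mul_nonneg hE0.le (hW0 x hx)) hJs (by positivity)
      hs.1.le hs.2.le ht
  simp only [mul_left_comm _ E, intervalIntegral.integral_const_mul] at hp
  have hV : 0 ≤ ∫ x in (0 : ℝ)..t, Real.exp (-(1 / 4) * (t - x)) * W x :=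
    intervalIntegral.integral_nonneg (ht₀.le.trans ht) fun x hx =>
      mul_nonneg (Real.exp_pos _).le (hW0 x hx.1)
  set V := ∫ x in (0 : ℝ)..t, Real.exp (-(1 / 4) * (t - x)) * W x
  have h1 : 0 ≤ E * (t₀⁻¹ * Real.exp (-(1 / 4) * (t - t₀)) * (1 + y 0 + H 0 + I)) := by
    positivity
  have h2 : 0 ≤ M * V := by positivity
  linarith

end Envelope

end EnergySystem

section GradientFlow

variable {X E W : Type*} [MeasurableSpace X] {μ : Measure X} [NormedAddCommGroup E]
  [InnerProductSpace ℝ E] [NormedAddCommGroup W] [InnerProductSpace ℝ W]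

theorem slope_norm_sq (u : ℝ → W) (t z : ℝ) :
    slope (fun s => ‖u s‖ ^ 2) t z = ⟪slope u t z, u z + u t⟫ := by
  rw [slope_def_field, slope_def_module, real_inner_smul_left, inner_sub_left, inner_add_right,
    inner_add_right, real_inner_self_eq_norm_sq, real_inner_self_eq_norm_sq,
    real_inner_comm (u z) (u t), div_eq_inv_mul]
  ring

section Oscillation

variable [CompleteSpace W] (grad : W →L[ℝ] Lp E 2 μ)

/-- The component of `w` orthogonal to the kernel of the gradient. -/
def oscillation (w : W) : W := w - (LinearMap.ker (grad : W →ₗ[ℝ] Lp E 2 μ)).starProjection w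

theorem continuous_oscillation : Continuous (oscillation grad) :=
  continuous_id.sub (LinearMap.ker (grad : W →ₗ[ℝ] Lp E 2 μ)).starProjection.continuous

theorem grad_oscillation (w : W) : grad (oscillation grad w) = grad w := by
  have h : grad ((LinearMap.ker (grad : W →ₗ[ℝ] Lp E 2 μ)).starProjection w) = 0 :=
    Submodule.starProjection_apply_mem (LinearMap.ker (grad : W →ₗ[ℝ] Lp E 2 μ)) w
  rw [oscillation, map_sub, h, sub_zero]

variable {grad} in
theorem norm_oscillation_le (w : W) {v : W} (hv : grad v = 0) :
    ‖oscillation grad w‖ ≤ ‖w - v‖ := by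
  set U := LinearMap.ker (grad : W →ₗ[ℝ] Lp E 2 μ)
  have hbdd : BddBelow (range fun x : U => ‖w - x‖) :=
    ⟨0, by rintro _ ⟨x, rfl⟩; exact norm_nonneg _⟩
  exact (U.starProjection_minimal w).trans_le (ciInf_le hbdd ⟨v, hv⟩)

end Oscillation

variable [CompleteSpace E] [CompleteSpace W] (g : Law) (grad : W →L[ℝ] Lp E 2 μ)

/-- The nonlinear operator `∇* K(|∇ ⬝|) ∇`. -/
def diffusion (w : W) : W := ContinuousLinearMap.adjoint grad (g.fluxLp (grad w))

theorem inner_diffusion (w v : W) : ⟪diffusion g grad w, v⟫ = ⟪g.fluxLp (grad w), grad v⟫ :=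
  ContinuousLinearMap.adjoint_inner_left _ _ _

theorem exists_lipschitzWith_diffusion : ∃ L : ℝ≥0, LipschitzWith L (diffusion g grad) := by
  have hflux : LipschitzWith (2 / g.coeff 0).toNNReal (g.fluxLp : Lp E 2 μ → Lp E 2 μ) :=
    LipschitzWith.of_dist_le' fun Z Z' => by
      simpa only [dist_eq_norm] using g.norm_fluxLp_sub_le Z Z'
  exact ⟨_, (ContinuousLinearMap.adjoint grad).lipschitz.comp (hflux.comp grad.lipschitz)⟩

theorem continuous_diffusion : Continuous (diffusion g grad) :=
  (exists_lipschitzWith_diffusion g grad).choose_spec.continuous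

theorem inner_diffusion_sub_sub_ge (w w' v : W) :
    -(2 * (1 + g.deg) ^ 2 / g.coeff 0) * ‖grad v‖ ^ 2
      ≤ ⟪diffusion g grad w' - diffusion g grad w, w' - w - v⟫ := by
  have h := g.inner_fluxLp_sub_sub_ge (grad w) (grad w') (grad v)
  rwa [← map_sub, ← map_sub, inner_sub_left, ← inner_diffusion, ← inner_diffusion,
    ← inner_sub_left] at h

theorem hasFDerivAt_energy (w : W) :
    HasFDerivAt (fun w => g.energy (grad w)) (innerSL ℝ (diffusion g grad w)) w := by
  obtain ⟨L, hL⟩ := exists_lipschitzWith_diffusion g grad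
  refine HasFDerivAt.of_isLittleO (Asymptotics.IsBigO.trans_isLittleO ?_
    (Asymptotics.isLittleO_pow_sub_sub w one_lt_two))
  refine Asymptotics.IsBigO.of_bound L (Eventually.of_forall fun v => ?_)
  -- Convexity traps the remainder between `0` and `⟪A v - A w, v - w⟫`, `A` the diffusion.
  have h1 := g.inner_fluxLp_le_energy_sub (grad w) (grad v)
  have h2 := g.inner_fluxLp_le_energy_sub (grad v) (grad w)
  rw [← map_sub, ← inner_diffusion] at h1 h2
  have h3 : ⟪diffusion g grad v - diffusion g grad w, v - w⟫ ≤ L * ‖v - w‖ * ‖v - w‖ :=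
    (real_inner_le_norm _ _).trans
      (mul_le_mul_of_nonneg_right (hL.norm_sub_le v w) (norm_nonneg _))
  rw [inner_sub_left] at h3
  rw [← neg_sub v w, inner_neg_right] at h2
  rw [innerSL_apply_apply, Real.norm_of_nonneg (by linarith), norm_pow, norm_norm, sq, ← mul_assoc]
  linarith

theorem continuous_energy_grad : Continuous fun w : W => g.energy (grad w) :=
  continuous_iff_continuousAt.2 fun w => (hasFDerivAt_energy g grad w).continuousAt

/-- The velocity `f - ∇* K(|∇(ρ + ψ)|) ∇(ρ + ψ)` of the gradient flow with boundary lift `ψ` and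
source `f`. -/
def velocity (ρ ψ f : ℝ → W) (t : ℝ) : W := f t - diffusion g grad (ρ t + ψ t)

/-- `ρ` is a solution of the abstract gradient flow with boundary lift `ψ` and source `f`, whose
derivatives are `ψt` and `ft`; `F`, `Φ`, `P` and `Q` bound the sizes of `f`, `ψ`, `ψt` and `ft`. -/
structure IsFlow (Cg : ℝ) (ρ ψ ψt f ft : ℝ → W) (F Φ P Q : ℝ → ℝ) : Prop where
  continuousOn_ρ : ContinuousOn ρ (Ici 0)
  continuousOn_ψ : ContinuousOn ψ (Ici 0)
  continuousOn_f : ContinuousOn f (Ici 0)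
  hasDerivAt_ρ : ∀ t, 0 < t → HasDerivAt ρ (velocity g grad ρ ψ f t) t
  hasDerivAt_ψ : ∀ t, 0 < t → HasDerivAt ψ (ψt t) t
  hasDerivAt_f : ∀ t, 0 < t → HasDerivAt f (ft t) t
  norm_f_le : ∀ t, ‖f t‖ ≤ F t
  norm_ft_sq_le : ∀ t, ‖ft t‖ ^ 2 ≤ Q t
  norm_grad_ψ_sq_le : ∀ t, ‖grad (ψ t)‖ ^ 2 ≤ Cg * Φ t
  norm_grad_ψt_sq_le : ∀ t, ‖grad (ψt t)‖ ^ 2 ≤ Cg * P t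

section Slope

variable {ρ ψ f : ℝ → W} {t z : ℝ}

theorem slope_velocity : slope (velocity g grad ρ ψ f) t z
    = slope f t z - slope (fun s => diffusion g grad (ρ s + ψ s)) t z := by
  simp only [slope_def_module, velocity, ← smul_sub]
  congr 1
  abel

theorem inner_slope_diffusion_ge :
    -(2 * (1 + g.deg) ^ 2 / g.coeff 0) * ‖grad (slope ψ t z)‖ ^ 2
      ≤ ⟪slope (fun s => diffusion g grad (ρ s + ψ s)) t z, slope ρ t z⟫ := by
  have h := mul_le_mul_of_nonneg_left
    (inner_diffusion_sub_sub_ge g grad (ρ t + ψ t) (ρ z + ψ z) (ψ z - ψ t))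
    (mul_self_nonneg (z - t)⁻¹)
  rw [show ρ z + ψ z - (ρ t + ψ t) - (ψ z - ψ t) = ρ z - ρ t by abel] at h
  rw [slope_def_module, slope_def_module, slope_def_module, map_smul, norm_smul,
    real_inner_smul_left, real_inner_smul_right, mul_pow, Real.norm_eq_abs, sq_abs]
  linarith

variable {g grad} in
theorem norm_slope_diffusion_le {L : ℝ≥0} (hL : LipschitzWith L (diffusion g grad)) :
    ‖slope (fun s => diffusion g grad (ρ s + ψ s)) t z‖
      ≤ L * ‖slope ρ t z + slope ψ t z‖ := by
  rw [slope_def_module, slope_def_module, slope_def_module, ← smul_add, norm_smul, norm_smul,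
    mul_left_comm]
  refine mul_le_mul_of_nonneg_left ((hL.norm_sub_le _ _).trans_eq ?_) (norm_nonneg _)
  congr 2
  abel

variable {g grad} in
-- The last term vanishes in the limit `z → t` along a flow, since then `slope ρ t z → velocity t`.
theorem slope_norm_velocity_sq_le {L : ℝ≥0} (hL : LipschitzWith L (diffusion g grad)) :
    slope (fun s => ‖velocity g grad ρ ψ f s‖ ^ 2) t z
      ≤ ⟪slope f t z, velocity g grad ρ ψ f z + velocity g grad ρ ψ f t⟫
        + 2 * (2 * (1 + g.deg) ^ 2 / g.coeff 0) * ‖grad (slope ψ t z)‖ ^ 2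
        + L * ‖slope ρ t z + slope ψ t z‖
          * ‖velocity g grad ρ ψ f z + velocity g grad ρ ψ f t - (2 : ℝ) • slope ρ t z‖ := by
  rw [slope_norm_sq, slope_velocity]
  set e := slope (fun s => diffusion g grad (ρ s + ψ s)) t z
  set v := velocity g grad ρ ψ f z + velocity g grad ρ ψ f t
  have hmono := inner_slope_diffusion_ge g grad (ρ := ρ) (ψ := ψ) (t := t) (z := z)
  have hcs : -⟪e, v - (2 : ℝ) • slope ρ t z⟫
      ≤ L * ‖slope ρ t z + slope ψ t z‖ * ‖v - (2 : ℝ) • slope ρ t z‖ :=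
    (neg_le_abs _).trans ((abs_real_inner_le_norm _ _).trans
      (mul_le_mul_of_nonneg_right (norm_slope_diffusion_le hL) (norm_nonneg _)))
  rw [inner_sub_right, real_inner_smul_right] at hcs
  rw [inner_sub_left]
  linarith

end Slope

namespace IsFlow

variable {grad} {g} {Cg : ℝ} {ρ ψ ψt f ft : ℝ → W} {F Φ P Q : ℝ → ℝ}

theorem F_nonneg (h : IsFlow g grad Cg ρ ψ ψt f ft F Φ P Q) (t : ℝ) : 0 ≤ F t :=
  (norm_nonneg _).trans (h.norm_f_le t)

theorem Φ_nonneg (h : IsFlow g grad Cg ρ ψ ψt f ft F Φ P Q) (hCg : 0 < Cg) (t : ℝ) : 0 ≤ Φ t :=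
  nonneg_of_mul_nonneg_right ((sq_nonneg _).trans (h.norm_grad_ψ_sq_le t)) hCg

theorem P_nonneg (h : IsFlow g grad Cg ρ ψ ψt f ft F Φ P Q) (hCg : 0 < Cg) (t : ℝ) : 0 ≤ P t :=
  nonneg_of_mul_nonneg_right ((sq_nonneg _).trans (h.norm_grad_ψt_sq_le t)) hCg

theorem Q_nonneg (h : IsFlow g grad Cg ρ ψ ψt f ft F Φ P Q) (t : ℝ) : 0 ≤ Q t :=
  (sq_nonneg _).trans (h.norm_ft_sq_le t)

theorem continuousOn_velocity (h : IsFlow g grad Cg ρ ψ ψt f ft F Φ P Q) :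
    ContinuousOn (velocity g grad ρ ψ f) (Ici 0) :=
  h.continuousOn_f.sub ((continuous_diffusion g grad).comp_continuousOn
    (h.continuousOn_ρ.add h.continuousOn_ψ))

theorem slope_norm_velocity_sq_lt (h : IsFlow g grad Cg ρ ψ ψt f ft F Φ P Q) {t : ℝ} (ht : 0 < t)
    {r : ℝ} (hr : 1 / 2 * ‖velocity g grad ρ ψ f t‖ ^ 2 + 2 * Q t
      + 2 * (2 * (1 + g.deg) ^ 2 / g.coeff 0) * (Cg * P t) < r) :
    ∀ᶠ z in 𝓝[>] t, slope (fun s => ‖velocity g grad ρ ψ f s‖ ^ 2) t z < r := by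
  obtain ⟨L, hL⟩ := exists_lipschitzWith_diffusion g grad
  set u := velocity g grad ρ ψ f
  set M := 2 * (1 + g.deg) ^ 2 / g.coeff 0
  have hM : 0 ≤ M := div_nonneg (by positivity) g.coeff_zero_pos.le
  have tendsto_slope : ∀ {v : ℝ → W} {v' : W}, HasDerivAt v v' t →
      Tendsto (slope v t) (𝓝[>] t) (𝓝 v') := fun hv =>
    (hasDerivAt_iff_tendsto_slope.1 hv).mono_left (nhdsWithin_mono _ fun x hx => ne_of_gt hx)
  have hρ := tendsto_slope (h.hasDerivAt_ρ t ht)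
  have hψ := tendsto_slope (h.hasDerivAt_ψ t ht)
  have hf := tendsto_slope (h.hasDerivAt_f t ht)
  have hu : Tendsto (fun z => u z + u t) (𝓝[>] t) (𝓝 (u t + u t)) :=
    ((h.continuousOn_velocity.continuousAt (Ici_mem_nhds ht)).tendsto.mono_left
      nhdsWithin_le_nhds).add_const _
  have hbound := ((hf.inner hu).add ((((grad.continuous.tendsto _).comp hψ).norm.pow 2).const_mul
    (2 * M))).add (((hρ.add hψ).norm.const_mul (L : ℝ)).mul
      (hu.sub (hρ.const_smul (2 : ℝ))).norm)
  have hlim : ⟪ft t, u t + u t⟫ + 2 * M * ‖grad (ψt t)‖ ^ 2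
      + L * ‖u t + ψt t‖ * ‖u t + u t - (2 : ℝ) • u t‖ < r := by
    rw [two_smul, sub_self, norm_zero, mul_zero, add_zero, inner_add_right]
    have h1 := real_inner_le_norm (ft t) (u t)
    have h2 := h.norm_ft_sq_le t
    have h3 := mul_le_mul_of_nonneg_left (h.norm_grad_ψt_sq_le t) (by positivity : 0 ≤ 2 * M)
    nlinarith [sq_nonneg (‖u t‖ - 2 * ‖ft t‖)]
  filter_upwards [hbound.eventually_lt_const hlim] with z hz
  exact (slope_norm_velocity_sq_le hL).trans_lt hz

theorem hasDerivAt_energy (h : IsFlow g grad Cg ρ ψ ψt f ft F Φ P Q) {t : ℝ} (ht : 0 < t) :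
    HasDerivAt (fun t => g.energy (grad (ρ t + ψ t)))
      ⟪diffusion g grad (ρ t + ψ t), velocity g grad ρ ψ f t + ψt t⟫ t :=
  (hasFDerivAt_energy g grad (ρ t + ψ t)).comp_hasDerivAt (f := fun t => ρ t + ψ t) t
    ((h.hasDerivAt_ρ t ht).add (h.hasDerivAt_ψ t ht))

theorem hasDerivAt_norm_oscillation_sq (h : IsFlow g grad Cg ρ ψ ψt f ft F Φ P Q) {t : ℝ}
    (ht : 0 < t) :
    HasDerivAt (fun t => ‖oscillation grad (ρ t)‖ ^ 2)
      (2 * ⟪velocity g grad ρ ψ f t, oscillation grad (ρ t)⟫) t := by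
  set U := LinearMap.ker (grad : W →ₗ[ℝ] Lp E 2 μ)
  set u := velocity g grad ρ ψ f t
  have hρ := h.hasDerivAt_ρ t ht
  have hosc := hρ.sub ((U.starProjection.hasFDerivAt (x := ρ t)).comp_hasDerivAt t hρ)
  refine hosc.norm_sq.congr_deriv ?_
  change 2 * ⟪ρ t - U.starProjection (ρ t), u - U.starProjection u⟫
    = 2 * ⟪u, ρ t - U.starProjection (ρ t)⟫
  rw [inner_sub_right, U.starProjection_inner_eq_zero _ _ (U.starProjection_apply_mem u), sub_zero,
    real_inner_comm]

-- `k` is chosen so that the Poincaré inequality costs at most half of the dissipation.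
theorem two_mul_inner_velocity_oscillation_le (h : IsFlow g grad Cg ρ ψ ψt f ft F Φ P Q)
    {Cκ k : ℝ} (hk : 0 < k) (hkC : 4 * Cκ * k = 1) {t : ℝ}
    (hcoer : ‖oscillation grad (ρ t)‖ ^ g.β
      ≤ Cκ * (1 + ⟪g.fluxLp (grad (ρ t + ψ t)), grad (ρ t + ψ t)⟫ + ‖grad (ψ t)‖ ^ 2)) :
    2 * ⟪velocity g grad ρ ψ f t, oscillation grad (ρ t)⟫
      ≤ -(1 / 2) * ⟪g.fluxLp (grad (ρ t + ψ t)), grad (ρ t + ψ t)⟫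
        - k * ‖oscillation grad (ρ t)‖ ^ g.β
        + 2 * ((k / 2) ^ (1 / g.β))⁻¹ ^ g.lam * F t ^ g.lam
        + (2 / g.coeff 0 + 1 / 2) * (Cg * Φ t) + 1 / 2 := by
  set Z := grad (ρ t + ψ t) with hZ
  set κ := ⟪g.fluxLp Z, Z⟫
  set V := ‖oscillation grad (ρ t)‖
  have hdiff : ⟪diffusion g grad (ρ t + ψ t), oscillation grad (ρ t)⟫
      = κ - ⟪g.fluxLp Z, grad (ψ t)⟫ := by
    rw [inner_diffusion, grad_oscillation, ← inner_sub_right, hZ, map_add, add_sub_cancel_right]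
  have hflux := (le_abs_self _).trans (g.abs_inner_fluxLp_le Z (grad (ψ t)))
  have hsource : ⟪f t, oscillation grad (ρ t)⟫ ≤ F t * V :=
    (real_inner_le_norm _ _).trans (mul_le_mul_of_nonneg_right (h.norm_f_le t) (norm_nonneg _))
  have hyoung := g.two_mul_mul_le (h.F_nonneg t) (norm_nonneg _ : 0 ≤ V) hk
  have hpoin : 2 * k * V ^ g.β ≤ 1 / 2 * (1 + κ + ‖grad (ψ t)‖ ^ 2) := by
    have := mul_le_mul_of_nonneg_left hcoer (by positivity : 0 ≤ 2 * k)
    linear_combination this + 1 / 2 * (1 + κ + ‖grad (ψ t)‖ ^ 2) * hkC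
  have hψ := mul_le_mul_of_nonneg_left (h.norm_grad_ψ_sq_le t)
    (add_nonneg (div_nonneg zero_le_two g.coeff_zero_pos.le) one_half_pos.le :
      0 ≤ 2 / g.coeff 0 + 1 / 2)
  rw [velocity, inner_sub_left, hdiff]
  linear_combination 2 * hflux + 2 * hsource + hyoung + hpoin + hψ

theorem inner_diffusion_velocity_add_le (h : IsFlow g grad Cg ρ ψ ψt f ft F Φ P Q) (t : ℝ) :
    ⟪diffusion g grad (ρ t + ψ t), velocity g grad ρ ψ f t + ψt t⟫
      ≤ -(3 / 4) * ‖velocity g grad ρ ψ f t‖ ^ 2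
        + 1 / 2 * ⟪g.fluxLp (grad (ρ t + ψ t)), grad (ρ t + ψ t)⟫
        + F t ^ 2 + 1 / g.coeff 0 * (Cg * P t) := by
  set u := velocity g grad ρ ψ f t with hu
  have hdiff : ⟪diffusion g grad (ρ t + ψ t), u + ψt t⟫
      = ⟪f t, u⟫ - ‖u‖ ^ 2 + ⟪g.fluxLp (grad (ρ t + ψ t)), grad (ψt t)⟫ := by
    rw [inner_add_right, inner_diffusion g grad _ (ψt t), ← real_inner_self_eq_norm_sq,
      ← inner_sub_left]
    simp only [hu, velocity, sub_sub_cancel]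
  have hflux := (le_abs_self _).trans (g.abs_inner_fluxLp_le (grad (ρ t + ψ t)) (grad (ψt t)))
  have hψt := mul_le_mul_of_nonneg_left (h.norm_grad_ψt_sq_le t)
    (one_div_nonneg.2 g.coeff_zero_pos.le)
  have hsource : ⟪f t, u⟫ ≤ F t * ‖u‖ :=
    (real_inner_le_norm _ _).trans (mul_le_mul_of_nonneg_right (h.norm_f_le t) (norm_nonneg _))
  have hyoung : F t * ‖u‖ ≤ F t ^ 2 + 1 / 4 * ‖u‖ ^ 2 := by nlinarith [sq_nonneg (F t - ‖u‖ / 2)]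
  rw [hdiff]
  linarith

theorem energySystem (h : IsFlow g grad Cg ρ ψ ψt f ft F Φ P Q) (hCg : 0 < Cg) {Cκ k C : ℝ}
    (hk : 0 < k) (hkC : 4 * Cκ * k = 1)
    (hcoer : ∀ t, ‖oscillation grad (ρ t)‖ ^ g.β
      ≤ Cκ * (1 + ⟪g.fluxLp (grad (ρ t + ψ t)), grad (ρ t + ψ t)⟫ + ‖grad (ψ t)‖ ^ 2))
    (hC : 2 ≤ C) (hCF : 2 * ((k / 2) ^ (1 / g.β))⁻¹ ^ g.lam ≤ C)
    (hCΦ : (2 / g.coeff 0 + 1 / 2) * Cg ≤ C)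
    (hCP : 2 * (2 * (1 + g.deg) ^ 2 / g.coeff 0) * Cg ≤ C) :
    EnergySystem g.β k C (fun t => ‖oscillation grad (ρ t)‖ ^ 2)
      (fun t => g.energy (grad (ρ t + ψ t))) (fun t => ‖velocity g grad ρ ψ f t‖ ^ 2)
      (fun t => ⟪g.fluxLp (grad (ρ t + ψ t)), grad (ρ t + ψ t)⟫)
      (fun t => F t ^ g.lam + Φ t) P Q := by
  have hF := h.F_nonneg
  have hΦ := h.Φ_nonneg hCg
  have hP := h.P_nonneg hCg
  have hQ := h.Q_nonneg
  have hFlam : ∀ t, 0 ≤ F t ^ g.lam := fun t => Real.rpow_nonneg (hF t) _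
  have hCP' : 1 / g.coeff 0 * Cg ≤ C := by
    have := mul_nonneg (one_div_nonneg.2 g.coeff_zero_pos.le) hCg.le
    linear_combination hCΦ + this + 1 / 2 * hCg
  exact
  { y_nonneg := fun _ _ => sq_nonneg _
    H_nonneg := fun _ _ => g.energy_nonneg _
    p_nonneg := fun _ _ => sq_nonneg _
    S_nonneg := fun t _ => add_nonneg (hFlam t) (hΦ t)
    P_nonneg := fun t _ => hP t
    Q_nonneg := fun t _ => hQ t
    H_le := fun _ _ => g.energy_le _
    continuousOn_y := ((continuous_oscillation grad).comp_continuousOn h.continuousOn_ρ).norm.pow 2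
    continuousOn_H := (continuous_energy_grad g grad).comp_continuousOn
      (h.continuousOn_ρ.add h.continuousOn_ψ)
    continuousOn_p := (h.continuousOn_velocity.mono Ioi_subset_Ici_self).norm.pow 2
    differentiableAt_y := fun t ht => (h.hasDerivAt_norm_oscillation_sq ht).differentiableAt
    differentiableAt_H := fun t ht => (h.hasDerivAt_energy ht).differentiableAt
    deriv_y_le := fun t ht => by
      have hsq : (‖oscillation grad (ρ t)‖ ^ 2) ^ (g.β / 2) = ‖oscillation grad (ρ t)‖ ^ g.β := by
        rw [← Real.rpow_natCast_mul (norm_nonneg _), Nat.cast_ofNat, mul_div_cancel₀ _ two_ne_zero]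
      rw [(h.hasDerivAt_norm_oscillation_sq ht).deriv, hsq]
      linarith [h.two_mul_inner_velocity_oscillation_le hk hkC (hcoer t),
        mul_le_mul_of_nonneg_right hCF (hFlam t), mul_le_mul_of_nonneg_right hCΦ (hΦ t)]
    deriv_H_le := fun t ht => by
      have hsq := g.sq_le_one_add_rpow (hF t) (le_add_of_nonneg_right (hΦ t))
      have hFC := mul_le_mul_of_nonneg_right hC ((sq_nonneg _).trans hsq)
      have hκC := mul_le_mul_of_nonneg_right hC
        (g.inner_fluxLp_self_nonneg (grad (ρ t + ψ t)))
      have hPC := mul_le_mul_of_nonneg_right hCP' (hP t)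
      rw [(h.hasDerivAt_energy ht).deriv]
      linarith [h.inner_diffusion_velocity_add_le t,
        g.inner_fluxLp_self_nonneg (grad (ρ t + ψ t)), (sq_nonneg _).trans hsq]
    slope_p_lt := fun t ht r hr => by
      refine h.slope_norm_velocity_sq_lt ht (lt_of_le_of_lt ?_ hr)
      linear_combination mul_le_mul_of_nonneg_right hC (hQ t)
        + mul_le_mul_of_nonneg_right hCP (hP t) }

variable (g) in
theorem exists_energySystem (μ : Measure X) [IsFiniteMeasure μ] (E : Type*) [NormedAddCommGroup E]
    [InnerProductSpace ℝ E] [CompleteSpace E] {Cp Cg : ℝ} (hCp : 0 < Cp) (hCg : 0 < Cg) :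
    ∃ c C : ℝ, 0 < c ∧ 0 < C ∧ ∀ {W : Type*} [NormedAddCommGroup W] [InnerProductSpace ℝ W]
      [CompleteSpace W] {grad : W →L[ℝ] Lp E 2 μ},
      (∀ w, ‖oscillation grad w‖ ^ g.β ≤ Cp * ∫ x, ‖grad w x‖ ^ g.β ∂μ) →
      ∀ {ρ ψ ψt f ft : ℝ → W} {F Φ P Q : ℝ → ℝ}, IsFlow g grad Cg ρ ψ ψt f ft F Φ P Q →
      EnergySystem g.β c C (fun t => ‖oscillation grad (ρ t)‖ ^ 2)
        (fun t => g.energy (grad (ρ t + ψ t))) (fun t => ‖velocity g grad ρ ψ f t‖ ^ 2)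
        (fun t => ⟪g.fluxLp (grad (ρ t + ψ t)), grad (ρ t + ψ t)⟫)
        (fun t => F t ^ g.lam + Φ t) P Q := by
  obtain ⟨Cκ, hCκ, hcoer⟩ := g.exists_integral_rpow_β_le E μ
  have := g.coeff_zero_pos
  have := g.deg_pos
  obtain ⟨k, hk, hkC⟩ : ∃ k : ℝ, 0 < k ∧ 4 * (Cp * Cκ) * k = 1 :=
    ⟨(4 * (Cp * Cκ))⁻¹, by positivity, mul_inv_cancel₀ (by positivity)⟩
  have hYF : 0 < 2 * ((k / 2) ^ (1 / g.β))⁻¹ ^ g.lam := by positivity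
  have hYΦ : 0 < (2 / g.coeff 0 + 1 / 2) * Cg := by positivity
  have hYP : 0 < 2 * (2 * (1 + g.deg) ^ 2 / g.coeff 0) * Cg := by positivity
  refine ⟨k, 2 + 2 * ((k / 2) ^ (1 / g.β))⁻¹ ^ g.lam + (2 / g.coeff 0 + 1 / 2) * Cg
    + 2 * (2 * (1 + g.deg) ^ 2 / g.coeff 0) * Cg, hk, by linarith,
    fun {_ _ _ _ grad} hPoin {ρ ψ ψt f ft F Φ P Q} h => h.energySystem hCg hk hkC (fun t => ?_)
      (by linarith) (by linarith) (by linarith) (by linarith)⟩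
  have hcoer := hcoer (grad (ρ t + ψ t)) (grad (ψ t))
  rw [← map_sub, add_sub_cancel_right] at hcoer
  exact (hPoin _).trans ((mul_le_mul_of_nonneg_left hcoer hCp.le).trans_eq (mul_assoc _ _ _).symm)

end IsFlow

end GradientFlow

section FiniteDimensional

variable {V : Type*} [AddCommGroup V] [Module ℝ V] [FiniteDimensional ℝ V]

theorem exists_norm_le_mul_of_ker_le {X Y : Type*} [NormedAddCommGroup X] [NormedSpace ℝ X]
    [NormedAddCommGroup Y] [NormedSpace ℝ Y] {A : V →ₗ[ℝ] X} {B : V →ₗ[ℝ] Y}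
    (h : LinearMap.ker A ≤ LinearMap.ker B) : ∃ C : ℝ, 0 < C ∧ ∀ v, ‖B v‖ ≤ C * ‖A v‖ := by
  let L : LinearMap.range A →ₗ[ℝ] Y :=
    (LinearMap.ker A).liftQ B h ∘ₗ (A.quotKerEquivRange.symm : LinearMap.range A →ₗ[ℝ] _)
  have hL : ∀ v, L ⟨A v, LinearMap.mem_range_self A v⟩ = B v := fun v => by
    have : A.quotKerEquivRange.symm ⟨A v, LinearMap.mem_range_self A v⟩
        = (LinearMap.ker A).mkQ v := by
      rw [LinearEquiv.symm_apply_eq]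
      rfl
    simp [L, this]
  refine ⟨‖L.toContinuousLinearMap‖ + 1, by positivity, fun v => ?_⟩
  rw [← hL v]
  exact (L.toContinuousLinearMap.le_opNorm _).trans
    (mul_le_mul_of_nonneg_right (le_add_of_nonneg_right zero_le_one) (norm_nonneg _))

theorem exists_forall_norm_le_mul_setIntegral {X E F : Type*} [TopologicalSpace X]
    [MeasurableSpace X] [OpensMeasurableSpace X] {μ : Measure X} [μ.IsOpenPosMeasure]
    [NormedAddCommGroup E] [NormedSpace ℝ E] [NormedAddCommGroup F] [NormedSpace ℝ F]
    {A : V →ₗ[ℝ] X → E} {B : V →ₗ[ℝ] X → F} {s K : Set X} (hs : IsOpen s) (hK : IsCompact K)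
    (hA : ∀ v, ContinuousOn (A v) s) (hAi : ∀ v, IntegrableOn (A v) s μ)
    (hB : ∀ v, ContinuousOn (B v) K) (h : ∀ v, EqOn (A v) 0 s → EqOn (B v) 0 K) :
    ∃ C : ℝ, 0 < C ∧ ∀ v, ∀ x ∈ K, ‖B v x‖ ≤ C * ∫ y in s, ‖A v y‖ ∂μ := by
  have : CompactSpace K := isCompact_iff_compactSpace.1 hK
  let A' : V →ₗ[ℝ] Lp E 1 (μ.restrict s) :=
    { toFun := fun v => (hAi v).toL1 (A v)
      map_add' := fun v w => by
        simp only [map_add]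
        exact Integrable.toL1_add (A v) (A w) (hAi v) (hAi w)
      map_smul' := fun a v => by
        simp only [map_smul]
        exact Integrable.toL1_smul' (A v) (hAi v) a }
  let B' : V →ₗ[ℝ] C(K, F) :=
    { toFun := fun v => ⟨K.domRestrict (B v), (hB v).domRestrict⟩
      map_add' := fun v w => ContinuousMap.ext fun x => congrFun (map_add B v w) x
      map_smul' := fun a v => ContinuousMap.ext fun x => congrFun (map_smul B a v) x }
  have hker : LinearMap.ker A' ≤ LinearMap.ker B' := fun v hv => by
    have hzero : (hAi v).toL1 (A v) = 0 := hv
    have hae : A v =ᵐ[μ.restrict s] 0 := by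
      refine (hAi v).coeFn_toL1.symm.trans ?_
      rw [hzero]
      exact Lp.coeFn_zero _ _ _
    ext x
    exact h v (Measure.eqOn_open_of_ae_eq hae hs (hA v) continuousOn_const) x.2
  obtain ⟨C, hC, hle⟩ := exists_norm_le_mul_of_ker_le hker
  refine ⟨C, hC, fun v x hx => ((B' v).norm_coe_le_norm ⟨x, hx⟩).trans ?_⟩
  rw [← L1.norm_of_fun_eq_integral_norm (hAi v)]
  exact hle v

end FiniteDimensional

section Polynomials

variable {d : ℕ}

/-- A polynomial as a function on `ℝ^d`. -/
def polyEval : MvPolynomial (Fin d) ℝ →ₗ[ℝ] Space d → ℝ where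
  toFun p x := MvPolynomial.eval x.ofLp p
  map_add' p q := by ext; simp
  map_smul' a p := by ext; simp [MvPolynomial.smul_eval]

/-- The gradient of a polynomial as a function on `ℝ^d`. -/
def polyGradient : MvPolynomial (Fin d) ℝ →ₗ[ℝ] Space d → Space d where
  toFun p x := WithLp.toLp 2 fun i => MvPolynomial.eval x.ofLp (MvPolynomial.pderiv i p)
  map_add' p q := by ext; simp
  map_smul' a p := by ext; simp [MvPolynomial.smul_eval]

theorem polyEval_apply (p : MvPolynomial (Fin d) ℝ) (x : Space d) :
    polyEval p x = MvPolynomial.eval x.ofLp p := rfl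

theorem polyGradient_apply (p : MvPolynomial (Fin d) ℝ) (x : Space d) (i : Fin d) :
    polyGradient p x i = MvPolynomial.eval x.ofLp (MvPolynomial.pderiv i p) := rfl

theorem continuous_polyEval (p : MvPolynomial (Fin d) ℝ) : Continuous (polyEval p) :=
  Triangulation.continuous_eval p

theorem continuous_polyGradient (p : MvPolynomial (Fin d) ℝ) : Continuous (polyGradient p) :=
  (PiLp.continuous_toLp 2 _).comp (continuous_pi fun _ => Triangulation.continuous_eval _)

theorem hasGradientAt_polyEval (p : MvPolynomial (Fin d) ℝ) (x : Space d) :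
    HasGradientAt (polyEval p) (polyGradient p x) x := by
  rw [hasGradientAt_iff_hasFDerivAt]
  induction p using MvPolynomial.induction_on with
  | C a =>
    have hgrad : polyGradient (MvPolynomial.C a) x = 0 := by ext; simp [polyGradient_apply]
    have heval : polyEval (d := d) (MvPolynomial.C a) = fun _ => a := by
      ext; simp [polyEval_apply]
    rw [hgrad, map_zero, heval]
    exact hasFDerivAt_const a x
  | add p q hp hq =>
    rw [map_add, map_add, Pi.add_apply, map_add]
    exact hp.add hq
  | mul_X p i hp =>
    have hgrad : polyGradient (p * MvPolynomial.X i) x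
        = polyEval p x • EuclideanSpace.single i (1 : ℝ) + x i • polyGradient p x := by
      ext j
      rcases eq_or_ne i j with rfl | hij
      · simp [polyGradient_apply, polyEval_apply]
      · simp [polyGradient_apply, polyEval_apply, hij.symm]
    have heval : polyEval (p * MvPolynomial.X i) = fun y => polyEval p y * y i := by
      ext; simp [polyEval_apply]
    have hcoord : HasFDerivAt (fun y : Space d => y i)
        (InnerProductSpace.toDual ℝ (Space d) (EuclideanSpace.single i (1 : ℝ))) x := by
      refine (InnerProductSpace.toDual ℝ (Space d) (EuclideanSpace.single i 1)).hasFDerivAt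
        |>.congr_of_eventuallyEq (Eventually.of_forall fun y => ?_)
      simp [EuclideanSpace.inner_single_left]
    rw [hgrad, heval, map_add, map_smul, map_smul]
    exact hp.mul hcoord

theorem totalDegree_aeval_le {R τ ι : Type*} [CommSemiring R] {φ : ι → MvPolynomial τ R}
    (hφ : ∀ i, (φ i).totalDegree ≤ 1) (p : MvPolynomial ι R) :
    (MvPolynomial.aeval φ p).totalDegree ≤ p.totalDegree := by
  rw [MvPolynomial.aeval_def, MvPolynomial.eval₂_eq]
  refine MvPolynomial.totalDegree_finsetSum_le fun m hm => ?_
  calc (algebraMap R (MvPolynomial τ R) (p.coeff m) * ∏ i ∈ m.support, φ i ^ m i).totalDegree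
      ≤ (MvPolynomial.C (p.coeff m) : MvPolynomial τ R).totalDegree
        + (∏ i ∈ m.support, φ i ^ m i).totalDegree := MvPolynomial.totalDegree_mul _ _
    _ ≤ 0 + ∑ i ∈ m.support, (φ i ^ m i).totalDegree :=
      add_le_add (MvPolynomial.totalDegree_C _).le (MvPolynomial.totalDegree_finsetProd _ _)
    _ ≤ ∑ i ∈ m.support, m i := by
      rw [zero_add]
      exact Finset.sum_le_sum fun i _ => (MvPolynomial.totalDegree_pow _ _).trans
        (mul_le_of_le_one_right (Nat.zero_le _) (hφ i))
    _ ≤ p.totalDegree := MvPolynomial.le_totalDegree hm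

theorem exists_polyEval_comp_affine {r : ℕ} (p : MvPolynomial.restrictTotalDegree (Fin d) ℝ r)
    (c : Space d) (h : ℝ) : ∃ q : MvPolynomial.restrictTotalDegree (Fin d) ℝ r,
      ∀ y, polyEval q.1 y = polyEval p.1 (c + h • y) := by
  have hdeg : ∀ i, (MvPolynomial.C (c i) + MvPolynomial.C h * MvPolynomial.X i :
      MvPolynomial (Fin d) ℝ).totalDegree ≤ 1 := fun i =>
    (MvPolynomial.totalDegree_add _ _).trans
      (max_le (by simp) ((MvPolynomial.totalDegree_mul _ _).trans (by simp)))
  refine ⟨⟨_, (MvPolynomial.mem_restrictTotalDegree _ _ _).2 ((totalDegree_aeval_le hdeg p.1).trans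
    ((MvPolynomial.mem_restrictTotalDegree _ _ _).1 p.2))⟩, fun y => ?_⟩
  change MvPolynomial.eval y.ofLp (MvPolynomial.aeval _ p.1) = _
  rw [polyEval_apply, MvPolynomial.aeval_def, MvPolynomial.eval₂_eq, map_sum, MvPolynomial.eval_eq]
  refine Finset.sum_congr rfl fun m _ => ?_
  simp [map_prod, MvPolynomial.algebraMap_eq]

theorem polyGradient_of_polyEval_comp_affine {p q : MvPolynomial (Fin d) ℝ} {c : Space d} {h : ℝ}
    (hq : ∀ y, polyEval q y = polyEval p (c + h • y)) (y : Space d) :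
    polyGradient q y = h • polyGradient p (c + h • y) := by
  refine (hasGradientAt_polyEval q y).unique ?_
  have haff : HasFDerivAt (fun y : Space d => c + h • y)
      (h • ContinuousLinearMap.id ℝ (Space d)) y := ((hasFDerivAt_id y).const_smul h).const_add c
  rw [funext hq, hasGradientAt_iff_hasFDerivAt]
  refine ((hasGradientAt_polyEval p (c + h • y)).hasFDerivAt.comp y haff).congr_fderiv ?_
  ext v
  simp

theorem integrableOn_of_continuous {E : Type*} [NormedAddCommGroup E] {f : Space d → E}
    (hf : Continuous f) {s : Set (Space d)} (hs : Bornology.IsBounded s) : IntegrableOn f s :=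
  (hf.continuousOn.integrableOn_compact hs.isCompact_closure).mono_set subset_closure

theorem eq_zero_of_eqOn_polyEval_zero {p : MvPolynomial (Fin d) ℝ} {s : Set (Space d)}
    (hs : IsOpen s) (hne : s.Nonempty) (h : EqOn (polyEval p) 0 s) : p = 0 := by
  obtain ⟨x, hx⟩ := hne
  have hpre : (WithLp.toLp 2 : (Fin d → ℝ) → Space d) ⁻¹' s ∈ 𝓝 x.ofLp :=
    (PiLp.continuous_toLp 2 _).continuousAt.preimage_mem_nhds (hs.mem_nhds hx)
  obtain ⟨ε, hε, hball⟩ := Metric.mem_nhds_iff.1 hpre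
  refine MvPolynomial.funext_set (fun i => Metric.ball (x i) ε) (fun i => ?_) fun y hy => ?_
  · rw [Real.ball_eq_Ioo]
    exact Ioo_infinite (by linarith)
  · rw [← ball_pi _ hε] at hy
    simpa [polyEval_apply] using h (hball hy)

variable (d) in
theorem exists_norm_polyGradient_le_setIntegral_polyEval (r : ℕ) {σ : ℝ} (hσ : 0 < σ) :
    ∃ C : ℝ, 0 < C ∧ ∀ p : MvPolynomial.restrictTotalDegree (Fin d) ℝ r,
      ∀ x ∈ Metric.closedBall (0 : Space d) 1,
        ‖polyGradient p.1 x‖ ≤ C * ∫ y in Metric.ball (0 : Space d) σ, ‖polyEval p.1 y‖ := by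
  refine exists_forall_norm_le_mul_setIntegral
    (A := polyEval ∘ₗ (MvPolynomial.restrictTotalDegree (Fin d) ℝ r).subtype)
    (B := polyGradient ∘ₗ (MvPolynomial.restrictTotalDegree (Fin d) ℝ r).subtype)
    Metric.isOpen_ball (isCompact_closedBall _ _) (fun p => (continuous_polyEval p.1).continuousOn)
    (fun p => integrableOn_of_continuous (continuous_polyEval p.1) Metric.isBounded_ball)
    (fun p => (continuous_polyGradient p.1).continuousOn) fun p hp => ?_
  have hp0 : p.1 = 0 :=
    eq_zero_of_eqOn_polyEval_zero Metric.isOpen_ball (Metric.nonempty_ball.2 hσ) hp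
  intro x _
  simp [hp0]

variable (d) in
theorem exists_norm_polyGradient_le_setIntegral_polyGradient (r : ℕ) {σ : ℝ} (hσ : 0 < σ) :
    ∃ C : ℝ, 0 < C ∧ ∀ p : MvPolynomial.restrictTotalDegree (Fin d) ℝ r,
      ∀ x ∈ Metric.closedBall (0 : Space d) 1,
        ‖polyGradient p.1 x‖ ≤ C * ∫ y in Metric.ball (0 : Space d) σ, ‖polyGradient p.1 y‖ := by
  refine exists_forall_norm_le_mul_setIntegral
    (A := polyGradient ∘ₗ (MvPolynomial.restrictTotalDegree (Fin d) ℝ r).subtype)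
    (B := polyGradient ∘ₗ (MvPolynomial.restrictTotalDegree (Fin d) ℝ r).subtype)
    Metric.isOpen_ball (isCompact_closedBall _ _)
    (fun p => (continuous_polyGradient p.1).continuousOn)
    (fun p => integrableOn_of_continuous (continuous_polyGradient p.1) Metric.isBounded_ball)
    (fun p => (continuous_polyGradient p.1).continuousOn) fun p hp x _ => ?_
  ext i
  have hpi : MvPolynomial.pderiv i p.1 = 0 :=
    eq_zero_of_eqOn_polyEval_zero Metric.isOpen_ball (Metric.nonempty_ball.2 hσ)
      fun y hy => congrArg (fun v : Space d => v i) (hp hy)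
  exact (congrArg (MvPolynomial.eval x.ofLp) hpi).trans (map_zero _)

open scoped Pointwise in
theorem setIntegral_ball_comp_affine (f : Space d → ℝ) (c : Space d) {h : ℝ} (hh : 0 < h) (σ : ℝ) :
    ∫ y in Metric.ball (0 : Space d) σ, f (c + h • y)
      = (h ^ d)⁻¹ * ∫ y in Metric.ball c (σ * h), f y := by
  have hball : h • Metric.ball (0 : Space d) σ = (fun y => c + y) ⁻¹' Metric.ball c (σ * h) := by
    rw [smul_ball hh.ne', smul_zero, Real.norm_of_nonneg hh.le, mul_comm]
    ext y
    simp
  rw [Measure.setIntegral_comp_smul_of_pos volume (fun y => f (c + y)) _ hh, hball,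
    (measurePreserving_add_left volume c).setIntegral_preimage_emb
      (MeasurableEquiv.addLeft c).measurableEmbedding, finrank_euclideanSpace_fin, smul_eq_mul]

theorem exists_affine_eq {c x : Space d} {h : ℝ} (hh : 0 ≤ h) (hx : x ∈ Metric.closedBall c h) :
    ∃ y ∈ Metric.closedBall (0 : Space d) 1, c + h • y = x := by
  rw [← affinity_unitClosedBall hh] at hx
  obtain ⟨_, ⟨y, hy, rfl⟩, rfl⟩ := hx
  exact ⟨y, hy, rfl⟩

variable (d) in
theorem exists_mul_norm_polyGradient_le (r : ℕ) {σ : ℝ} (hσ : 0 < σ) : ∃ C : ℝ, 0 < C ∧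
    ∀ (p : MvPolynomial.restrictTotalDegree (Fin d) ℝ r) (c : Space d) (h : ℝ), 0 < h →
      ∀ x ∈ Metric.closedBall c h, h * ‖polyGradient p.1 x‖
        ≤ C * ((h ^ d)⁻¹ * ∫ y in Metric.ball c (σ * h), ‖polyEval p.1 y‖) := by
  obtain ⟨C, hC, hunit⟩ := exists_norm_polyGradient_le_setIntegral_polyEval d r hσ
  refine ⟨C, hC, fun p c h hh x hx => ?_⟩
  obtain ⟨q, hq⟩ := exists_polyEval_comp_affine p c h
  obtain ⟨y, hy, rfl⟩ := exists_affine_eq hh.le hx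
  simpa only [polyGradient_of_polyEval_comp_affine hq, hq, norm_smul, Real.norm_of_nonneg hh.le,
    setIntegral_ball_comp_affine (fun y => ‖polyEval p.1 y‖) c hh σ] using hunit q y hy

variable (d) in
theorem exists_norm_polyGradient_le (r : ℕ) {σ : ℝ} (hσ : 0 < σ) : ∃ C : ℝ, 0 < C ∧
    ∀ (p : MvPolynomial.restrictTotalDegree (Fin d) ℝ r) (c : Space d) (h : ℝ), 0 < h →
      ∀ x ∈ Metric.closedBall c h, ‖polyGradient p.1 x‖
        ≤ C * ((h ^ d)⁻¹ * ∫ y in Metric.ball c (σ * h), ‖polyGradient p.1 y‖) := by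
  obtain ⟨C, hC, hunit⟩ := exists_norm_polyGradient_le_setIntegral_polyGradient d r hσ
  refine ⟨C, hC, fun p c h hh x hx => ?_⟩
  obtain ⟨q, hq⟩ := exists_polyEval_comp_affine p c h
  obtain ⟨y, hy, rfl⟩ := exists_affine_eq hh.le hx
  have hqy := hunit q y hy
  simp only [polyGradient_of_polyEval_comp_affine hq, norm_smul, Real.norm_of_nonneg hh.le,
    integral_const_mul, setIntegral_ball_comp_affine (fun y => ‖polyGradient p.1 y‖) c hh σ] at hqy
  exact le_of_mul_le_mul_left (hqy.trans_eq (mul_left_comm _ _ _)) hh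

end Polynomials

section Elements

theorem sq_integral_le_rpow_mul {X : Type*} [MeasurableSpace X] {μ : Measure X} [IsFiniteMeasure μ]
    {f : X → ℝ} (hf0 : 0 ≤ f) {b : ℝ} (hb : 1 < b) (hf : MemLp f (ENNReal.ofReal b) μ) :
    (∫ x, f x ∂μ) ^ 2 ≤ μ.real univ ^ (2 - 2 / b) * (∫ x, f x ^ b ∂μ) ^ (2 / b) := by
  have hholder := integral_mul_le_Lp_mul_Lq_of_nonneg (Real.HolderConjugate.conjExponent hb)
    (ae_of_all _ hf0) (ae_of_all _ fun _ => zero_le_one) hf (memLp_const (1 : ℝ))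
  simp only [mul_one, Real.one_rpow, integral_const, smul_eq_mul] at hholder
  have hI : 0 ≤ ∫ x, f x ^ b ∂μ := integral_nonneg fun x => Real.rpow_nonneg (hf0 x) _
  refine (pow_le_pow_left₀ (integral_nonneg hf0) hholder 2).trans_eq ?_
  have hexp : 1 / b.conjExponent * (2 : ℕ) = 2 - 2 / b := by
    have : b - 1 ≠ 0 := by linarith
    rw [Real.conjExponent]
    field_simp
    norm_num
  rw [mul_pow, ← Real.rpow_mul_natCast hI, ← Real.rpow_mul_natCast measureReal_nonneg, hexp,
    mul_comm, Nat.cast_ofNat, one_div_mul_eq_div]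

variable {d : ℕ}

variable (d) in
/-- The volume of the unit ball of `ℝ^d`. -/
def unitVolume : ℝ := volume.real (Metric.ball (0 : Space d) 1)

variable (d) in
theorem unitVolume_pos : 0 < unitVolume d :=
  ENNReal.toReal_pos (Metric.measure_ball_pos _ _ one_pos).ne'
    Metric.isBounded_ball.measure_lt_top.ne

theorem volume_real_ball (c : Space d) {s : ℝ} (hs : 0 < s) :
    volume.real (Metric.ball c s) = s ^ d * unitVolume d := by
  rw [measureReal_def, Measure.addHaar_ball_of_pos _ _ hs, ENNReal.toReal_mul,
    ENNReal.toReal_ofReal (by positivity), finrank_euclideanSpace_fin]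
  rfl

theorem volume_real_closedBall (c : Space d) {s : ℝ} (hs : 0 ≤ s) :
    volume.real (Metric.closedBall c s) = s ^ d * unitVolume d := by
  rw [Measure.addHaar_real_closedBall _ _ hs, finrank_euclideanSpace_fin]
  rfl

theorem sq_setIntegral_ball_le {f : Space d → ℝ} (hf : Continuous f) (hf0 : 0 ≤ f) {b : ℝ}
    (hb : 1 < b) {c : Space d} {s : ℝ} (hs : 0 < s) {T : Set (Space d)}
    (hT : Bornology.IsBounded T) (hball : Metric.ball c s ⊆ T) :
    (∫ x in Metric.ball c s, f x) ^ 2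
      ≤ (s ^ d * unitVolume d) ^ (2 - 2 / b) * (∫ x in T, f x ^ b) ^ (2 / b) := by
  have : IsFiniteMeasure (volume.restrict (Metric.ball c s)) :=
    ⟨by simpa using Metric.isBounded_ball.measure_lt_top⟩
  have hpow : Continuous fun x => f x ^ b := hf.rpow_const fun _ => Or.inr (by linarith)
  have hmem : MemLp f (ENNReal.ofReal b) (volume.restrict (Metric.ball c s)) := by
    rw [← integrable_norm_rpow_iff hf.aestronglyMeasurable (by simpa using by linarith) (by simp),
      ENNReal.toReal_ofReal (by linarith)]
    simp only [Real.norm_of_nonneg (hf0 _)]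
    exact integrableOn_of_continuous hpow Metric.isBounded_ball
  have hmono : ∫ x in Metric.ball c s, f x ^ b ≤ ∫ x in T, f x ^ b :=
    setIntegral_mono_set (integrableOn_of_continuous hpow hT)
      (ae_of_all _ fun x => Real.rpow_nonneg (hf0 x) b) hball.eventuallyLE
  have hI : 0 ≤ ∫ x in Metric.ball c s, f x ^ b :=
    integral_nonneg fun x => Real.rpow_nonneg (hf0 x) b
  have h := sq_integral_le_rpow_mul hf0 hb hmem
  rw [measureReal_restrict_apply_univ, volume_real_ball c hs] at h
  have := unitVolume_pos d
  exact h.trans (by gcongr)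

theorem setIntegral_norm_sq_le {E : Type*} [NormedAddCommGroup E] {f : Space d → E}
    {c : Space d} {h M : ℝ} (hh : 0 ≤ h) {T : Set (Space d)}
    (hT : T ⊆ Metric.closedBall c h) (hM : ∀ x ∈ T, ‖f x‖ ≤ M) :
    ∫ x in T, ‖f x‖ ^ 2 ≤ h ^ d * unitVolume d * M ^ 2 := by
  have hTb : Bornology.IsBounded T := Metric.isBounded_closedBall.subset hT
  have hle : ‖∫ x in T, ‖f x‖ ^ 2‖ ≤ M ^ 2 * volume.real T :=
    norm_setIntegral_le_of_norm_le_const hTb.measure_lt_top fun x hx => by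
      rw [norm_pow, norm_norm]
      exact pow_le_pow_left₀ (norm_nonneg _) (hM x hx) 2
  rw [← volume_real_closedBall c hh, mul_comm]
  exact (le_abs_self _).trans (hle.trans (mul_le_mul_of_nonneg_left
    (measureReal_mono hT Metric.isBounded_closedBall.measure_lt_top.ne) (sq_nonneg M)))

theorem norm_polyEval_sub_le {p : MvPolynomial (Fin d) ℝ} {c : Space d} {h M : ℝ}
    (hM : ∀ x ∈ Metric.closedBall c h, ‖polyGradient p x‖ ≤ M) {x : Space d}
    (hx : x ∈ Metric.closedBall c h) : ‖polyEval p x - polyEval p c‖ ≤ M * h := by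
  have hc : c ∈ Metric.closedBall c h :=
    Metric.mem_closedBall_self (dist_nonneg.trans (Metric.mem_closedBall.1 hx))
  have hlip := (convex_closedBall c h).norm_image_sub_le_of_norm_hasFDerivWithin_le
    (fun y _ => (hasGradientAt_polyEval p y).hasFDerivAt.hasFDerivWithinAt)
    (fun y hy => (LinearIsometryEquiv.norm_map _ _).trans_le (hM y hy)) hc hx
  rw [← dist_eq_norm x c] at hlip
  exact hlip.trans (mul_le_mul_of_nonneg_left hx ((norm_nonneg _).trans (hM c hc)))

variable (d) in
theorem exists_sq_mul_setIntegral_polyGradient_le (r : ℕ) {σ : ℝ} (hσ : 0 < σ) :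
    ∃ C : ℝ, 0 < C ∧ ∀ (p : MvPolynomial.restrictTotalDegree (Fin d) ℝ r) (c : Space d) (h : ℝ)
      (T : Set (Space d)), 0 < h → Metric.ball c (σ * h) ⊆ T → T ⊆ Metric.closedBall c h →
      h ^ 2 * ∫ x in T, ‖polyGradient p.1 x‖ ^ 2 ≤ C * ∫ x in T, ‖polyEval p.1 x‖ ^ 2 := by
  obtain ⟨C, hC, hgrad⟩ := exists_mul_norm_polyGradient_le d r hσ
  have hV := unitVolume_pos d
  refine ⟨C ^ 2 * unitVolume d ^ 2 * σ ^ d, by positivity, fun p c h T hh hBT hTB => ?_⟩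
  set I := ∫ y in Metric.ball c (σ * h), ‖polyEval p.1 y‖
  set J := ∫ x in T, ‖polyEval p.1 x‖ ^ 2
  have hIJ : I ^ 2 ≤ (σ * h) ^ d * unitVolume d * J := by
    have hsq := sq_setIntegral_ball_le (continuous_polyEval p.1).norm (fun _ => norm_nonneg _)
      one_lt_two (mul_pos hσ hh) (Metric.isBounded_closedBall.subset hTB) hBT
    norm_num at hsq
    simpa [I, J] using hsq
  have hsup : ∀ x ∈ T, ‖h • polyGradient p.1 x‖ ≤ C * ((h ^ d)⁻¹ * I) := fun x hx => by
    rw [norm_smul, Real.norm_of_nonneg hh.le]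
    exact hgrad p c h hh x (hTB hx)
  calc h ^ 2 * ∫ x in T, ‖polyGradient p.1 x‖ ^ 2
      = ∫ x in T, ‖h • polyGradient p.1 x‖ ^ 2 := by
        simp only [norm_smul, mul_pow, Real.norm_of_nonneg hh.le, integral_const_mul]
    _ ≤ h ^ d * unitVolume d * (C * ((h ^ d)⁻¹ * I)) ^ 2 :=
        setIntegral_norm_sq_le hh.le hTB hsup
    _ = C ^ 2 * unitVolume d * (h ^ d)⁻¹ * I ^ 2 := by field_simp
    _ ≤ C ^ 2 * unitVolume d * (h ^ d)⁻¹ * ((σ * h) ^ d * unitVolume d * J) := by gcongr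
    _ = C ^ 2 * unitVolume d ^ 2 * σ ^ d * J := by
        rw [mul_pow]
        field_simp

variable (d) in
theorem exists_setIntegral_polyEval_sub_sq_le (r : ℕ) {σ b D : ℝ} (hσ : 0 < σ) (hb : 1 < b)
    (hbd : 0 ≤ 2 + (d : ℝ) - 2 * d / b) : ∃ C : ℝ, 0 < C ∧
    ∀ (p : MvPolynomial.restrictTotalDegree (Fin d) ℝ r) (c : Space d) (h : ℝ) (T : Set (Space d)),
      0 < h → h ≤ D → Metric.ball c (σ * h) ⊆ T → T ⊆ Metric.closedBall c h →
      ∫ x in T, ‖polyEval p.1 x - polyEval p.1 c‖ ^ 2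
        ≤ C * (∫ x in T, ‖polyGradient p.1 x‖ ^ b) ^ (2 / b) := by
  obtain ⟨C, hC, hgrad⟩ := exists_norm_polyGradient_le d r hσ
  have hV := unitVolume_pos d
  set V := unitVolume d
  set A := C ^ 2 * V * (σ ^ d * V) ^ (2 - 2 / b)
  have : 0 < A := by positivity
  refine ⟨A * (|D| ^ (2 + (d : ℝ) - 2 * d / b) + 1), by positivity,
    fun p c h T hh hhD hBT hTB => ?_⟩
  set I := ∫ y in Metric.ball c (σ * h), ‖polyGradient p.1 y‖
  set J := (∫ x in T, ‖polyGradient p.1 x‖ ^ b) ^ (2 / b)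
  have : 0 ≤ J := Real.rpow_nonneg
    (integral_nonneg fun _ => Real.rpow_nonneg (norm_nonneg _) _) _
  have hIJ : I ^ 2 ≤ ((σ * h) ^ d * V) ^ (2 - 2 / b) * J :=
    sq_setIntegral_ball_le (continuous_polyGradient p.1).norm (fun _ => norm_nonneg _) hb
      (mul_pos hσ hh) (Metric.isBounded_closedBall.subset hTB) hBT
  have hscale : h ^ 2 * (h ^ d)⁻¹ * (h ^ d) ^ (2 - 2 / b) = h ^ (2 + (d : ℝ) - 2 * d / b) := by
    rw [← Real.rpow_natCast h d, ← Real.rpow_mul hh.le, ← Real.rpow_neg hh.le,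
      ← Real.rpow_natCast h 2, ← Real.rpow_add hh, ← Real.rpow_add hh]
    congr 1
    push_cast
    ring
  have hpowD : h ^ (2 + (d : ℝ) - 2 * d / b) ≤ |D| ^ (2 + (d : ℝ) - 2 * d / b) + 1 :=
    (Real.rpow_le_rpow hh.le (hhD.trans (le_abs_self D)) hbd).trans (lt_add_one _).le
  calc ∫ x in T, ‖polyEval p.1 x - polyEval p.1 c‖ ^ 2
      ≤ h ^ d * V * (C * ((h ^ d)⁻¹ * I) * h) ^ 2 :=
        setIntegral_norm_sq_le hh.le hTB
          fun x hx => norm_polyEval_sub_le (hgrad p c h hh) (hTB hx)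
    _ = C ^ 2 * V * (h ^ 2 * (h ^ d)⁻¹) * I ^ 2 := by field_simp
    _ ≤ C ^ 2 * V * (h ^ 2 * (h ^ d)⁻¹) * (((σ * h) ^ d * V) ^ (2 - 2 / b) * J) := by gcongr
    _ = A * (h ^ 2 * (h ^ d)⁻¹ * (h ^ d) ^ (2 - 2 / b)) * J := by
        rw [show (σ * h) ^ d * V = σ ^ d * V * h ^ d by ring,
          Real.mul_rpow (by positivity) (by positivity)]
        simp only [A]
        ring
    _ ≤ A * (|D| ^ (2 + (d : ℝ) - 2 * d / b) + 1) * J := by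
        rw [hscale]
        gcongr

end Elements

theorem sum_rpow_le_rpow_sum {ι : Type*} (s : Finset ι) {X : ι → ℝ} (hX : ∀ i, 0 ≤ X i) {e : ℝ}
    (he : 1 ≤ e) : ∑ i ∈ s, X i ^ e ≤ (∑ i ∈ s, X i) ^ e := by
  induction s using Finset.cons_induction with
  | empty => simp [Real.zero_rpow (by linarith : e ≠ 0)]
  | cons i s hi ih =>
    rw [Finset.sum_cons, Finset.sum_cons]
    exact (add_le_add_right ih _).trans
      (Real.add_rpow_le_rpow_add (hX i) (Finset.sum_nonneg fun j _ => hX j) he)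

namespace Triangulation

variable {d : ℕ} {Ω : Set (Space d)} {𝒯 : Triangulation Ω} {r : ℕ}

theorem diam_le_meshSize {T : Set (Space d)} (hT : T ∈ 𝒯.elements) :
    Metric.diam T ≤ 𝒯.meshSize :=
  le_csSup (𝒯.elements.finite_toSet.image _).bddAbove (mem_image_of_mem _ hT)

theorem meshSize_pos (hd : 0 < d) {T : Set (Space d)} (hT : T ∈ 𝒯.elements) : 0 < 𝒯.meshSize := by
  have : Nonempty (Fin d) := ⟨⟨0, hd⟩⟩
  obtain ⟨x, hx⟩ := 𝒯.nonempty T hT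
  exact (Metric.diam_pos (infinite_of_mem_nhds x ((𝒯.isOpen T hT).mem_nhds hx)).nontrivial
    (𝒯.isBounded T hT)).trans_le (diam_le_meshSize hT)

theorem meshSize_le_diam (hΩb : Bornology.IsBounded Ω) : 𝒯.meshSize ≤ Metric.diam Ω := by
  refine Real.sSup_le ?_ Metric.diam_nonneg
  rintro _ ⟨T, hT, rfl⟩
  exact Metric.diam_mono (𝒯.subset T hT) hΩb

theorem IsQuasiUniform.exists_center (hd : 0 < d) {σ : ℝ} (hσ : 0 < σ) (hq : 𝒯.IsQuasiUniform σ)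
    {T : Set (Space d)} (hT : T ∈ 𝒯.elements) :
    ∃ c : Space d, Metric.ball c (σ * 𝒯.meshSize) ⊆ T ∧ T ⊆ Metric.closedBall c 𝒯.meshSize ∧
      ∀ y ∈ Metric.ball c (σ * 𝒯.meshSize), StarConvex ℝ y T := by
  obtain ⟨c, hc, hstar⟩ := hq T hT
  have hcT : c ∈ T := hc (Metric.mem_ball_self (mul_pos hσ (meshSize_pos hd hT)))
  exact ⟨c, hc, fun x hx => (Metric.dist_le_diam_of_mem (𝒯.isBounded T hT) hx hcT).trans
    (diam_le_meshSize hT), hstar⟩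

theorem setIntegral_eq_sum_of_integrableOn {f : Space d → ℝ}
    (hf : ∀ T : 𝒯.elements, IntegrableOn f T) :
    ∫ x in Ω, f x = ∑ T : 𝒯.elements, ∫ x in (T : Set (Space d)), f x := by
  have hae : (⋃ T : 𝒯.elements, (T : Set (Space d))) =ᵐ[volume] Ω := by
    refine LE.le.eventuallyLE (iUnion_subset fun T => 𝒯.subset _ T.2) |>.antisymm ?_
    rw [ae_le_set]
    simpa only [iUnion_subtype] using 𝒯.covers
  rw [← setIntegral_congr_set hae,
    integral_iUnion_fintype (fun T => (𝒯.isOpen _ T.2).measurableSet) _ hf]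
  exact fun T T' hne => 𝒯.disjoint T.2 T'.2 (Subtype.coe_injective.ne hne)

theorem setIntegral_eq_sum {f : Space d → ℝ} {F : 𝒯.elements → Space d → ℝ}
    (hF : ∀ T, Continuous (F T)) (hf : ∀ T : 𝒯.elements, EqOn f (F T) (T : Set (Space d))) :
    ∫ x in Ω, f x = ∑ T : 𝒯.elements, ∫ x in (T : Set (Space d)), F T x := by
  have hmeas : ∀ T : 𝒯.elements, MeasurableSet (T : Set (Space d)) :=
    fun T => (𝒯.isOpen _ T.2).measurableSet
  rw [setIntegral_eq_sum_of_integrableOn fun T => (integrableOn_of_continuous (hF T)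
    (𝒯.isBounded _ T.2)).congr_fun (hf T).symm (hmeas T)]
  exact Finset.sum_congr rfl fun T _ => setIntegral_congr_fun (hmeas T) (hf T)

theorem polyGrad_eq_sum_indicator (p : 𝒯.PolyFamily r) :
    polyGrad p = ∑ T : 𝒯.elements, (T : Set (Space d)).indicator (polyGradient (p T).1) := by
  funext x
  rw [Finset.sum_apply]
  rfl

theorem polyGrad_of_mem (p : 𝒯.PolyFamily r) (T : 𝒯.elements) {x : Space d}
    (hx : x ∈ (T : Set (Space d))) : polyGrad p x = polyGradient (p T).1 x := by
  rw [polyGrad_eq_sum_indicator, Finset.sum_apply, Finset.sum_eq_single T, indicator_of_mem hx]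
  · exact fun T' _ hne => indicator_of_notMem (Set.disjoint_right.1
      (𝒯.disjoint T'.2 T.2 (Subtype.coe_injective.ne hne)) hx) _
  · simp

theorem memLp_polyGrad (p : 𝒯.PolyFamily r) : MemLp (polyGrad p) 2 (volume.restrict Ω) := by
  rw [polyGrad_eq_sum_indicator]
  refine (memLp_finsetSum' _ fun T _ => ?_).restrict _
  rw [memLp_indicator_iff_restrict (𝒯.isOpen _ T.2).measurableSet]
  exact (memLp_two_iff_integrable_sq_norm (continuous_polyGradient _).aestronglyMeasurable).2
    (integrableOn_of_continuous ((continuous_polyGradient _).norm.pow 2) (𝒯.isBounded _ T.2))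

theorem polyGrad_add (p q : 𝒯.PolyFamily r) : polyGrad (p + q) = polyGrad p + polyGrad q := by
  simp only [polyGrad_eq_sum_indicator, Pi.add_apply, Submodule.coe_add, map_add, indicator_add',
    Finset.sum_add_distrib]

theorem polyGrad_smul (a : ℝ) (p : 𝒯.PolyFamily r) : polyGrad (a • p) = a • polyGrad p := by
  simp only [polyGrad_eq_sum_indicator, Pi.smul_apply, Submodule.coe_smul, map_smul,
    Finset.smul_sum]
  exact Finset.sum_congr rfl fun T _ =>
    Set.indicator_const_smul (T : Set (Space d)) a (polyGradient (p T).1)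

/-- The family of polynomials defining an element of `W_h`. -/
def family : 𝒯.femSpace r ≃ₗ[ℝ] 𝒯.PolyFamily r :=
  (LinearEquiv.ofInjective (𝒯.toL2 r) (𝒯.toL2_injective r)).symm

variable (𝒯 r) in
/-- The elementwise gradient as a linear map into `(L²(Ω))^d`. -/
def gradL2ₗ : 𝒯.femSpace r →ₗ[ℝ] L2Vec Ω where
  toFun w := (memLp_polyGrad (family w)).toLp (polyGrad (family w))
  map_add' v w := by
    rw [← MemLp.toLp_add]
    congr 1
    rw [map_add, polyGrad_add]
  map_smul' a w := by
    rw [RingHom.id_apply, ← MemLp.toLp_const_smul]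
    congr 1
    rw [map_smul, polyGrad_smul]

variable (𝒯 r) in
/-- The elementwise gradient as a continuous linear map. -/
def gradL2 : 𝒯.femSpace r →L[ℝ] L2Vec Ω := (𝒯.gradL2ₗ r).toContinuousLinearMap

theorem coeFn_gradL2 (w : 𝒯.femSpace r) :
    𝒯.gradL2 r w =ᵐ[volume.restrict Ω] polyGrad (family w) :=
  (memLp_polyGrad (family w)).coeFn_toLp

theorem coeFn_femSpace (w : 𝒯.femSpace r) :
    (w : L2 Ω) =ᵐ[volume.restrict Ω] polyFun (family w) := by
  have h : (w : L2 Ω) = 𝒯.toL2 r (family w) :=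
    congrArg Subtype.val
      ((LinearEquiv.ofInjective (𝒯.toL2 r) (𝒯.toL2_injective r)).apply_symm_apply w).symm
  rw [h]
  exact (memLp_polyFun (family w)).coeFn_toLp

theorem norm_sq_femSpace (w : 𝒯.femSpace r) :
    ‖w‖ ^ 2 = ∑ T : 𝒯.elements, ∫ x in (T : Set (Space d)), ‖polyEval (family w T).1 x‖ ^ 2 := by
  rw [Submodule.coe_norm, L2_norm_sq_eq_integral]
  refine (integral_congr_ae ((coeFn_femSpace w).fun_comp (‖·‖ ^ 2))).trans ?_
  refine setIntegral_eq_sum (fun T => (continuous_polyEval _).norm.pow 2) fun T x hx => ?_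
  simp only [Function.comp_apply, polyFun_of_mem _ T hx, polyEval_apply]

theorem setIntegral_comp_gradL2 (w : 𝒯.femSpace r) {F : Space d → ℝ} (hF : Continuous F) :
    ∫ x in Ω, F (𝒯.gradL2 r w x)
      = ∑ T : 𝒯.elements, ∫ x in (T : Set (Space d)), F (polyGradient (family w T).1 x) := by
  refine (integral_congr_ae ((coeFn_gradL2 w).fun_comp F)).trans ?_
  refine setIntegral_eq_sum (fun T => hF.comp (continuous_polyGradient _)) fun T x hx => ?_
  simp only [Function.comp_apply, polyGrad_of_mem _ T hx]

theorem norm_sq_gradL2 (w : 𝒯.femSpace r) :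
    ‖𝒯.gradL2 r w‖ ^ 2
      = ∑ T : 𝒯.elements, ∫ x in (T : Set (Space d)), ‖polyGradient (family w T).1 x‖ ^ 2 := by
  rw [L2_norm_sq_eq_integral]
  exact setIntegral_comp_gradL2 w (continuous_norm.pow 2)

/-- The piecewise constant function with given values. -/
def piecewiseConst (a : 𝒯.elements → ℝ) : 𝒯.femSpace r :=
  family.symm fun T => ⟨MvPolynomial.C (a T), by simp [MvPolynomial.mem_restrictTotalDegree]⟩

theorem family_piecewiseConst (a : 𝒯.elements → ℝ) (T : 𝒯.elements) :
    (family (piecewiseConst (r := r) a) T : MvPolynomial (Fin d) ℝ) = MvPolynomial.C (a T) := by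
  rw [piecewiseConst, LinearEquiv.apply_symm_apply]

theorem gradL2_piecewiseConst (a : 𝒯.elements → ℝ) : 𝒯.gradL2 r (piecewiseConst a) = 0 := by
  rw [← norm_eq_zero, ← sq_eq_zero_iff, norm_sq_gradL2]
  refine Finset.sum_eq_zero fun T _ => ?_
  have hconst : polyGradient (MvPolynomial.C (a T)) = (0 : Space d → Space d) := by
    ext
    simp [polyGradient_apply]
  simp [family_piecewiseConst, hconst]

theorem exists_inverse_le_femSpace (hd : 0 < d) (r : ℕ) {σ : ℝ} (hσ : 0 < σ) :
    ∃ C : ℝ, 0 < C ∧ ∀ {Ω : Set (Space d)} (𝒯 : Triangulation Ω), 𝒯.IsQuasiUniform σ →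
      ∀ w : 𝒯.femSpace r, 𝒯.meshSize ^ 2 * ‖𝒯.gradL2 r w‖ ^ 2 ≤ C * ‖w‖ ^ 2 := by
  obtain ⟨C, hC, h⟩ := exists_sq_mul_setIntegral_polyGradient_le d r hσ
  refine ⟨C, hC, fun 𝒯 hq w => ?_⟩
  rw [norm_sq_gradL2, norm_sq_femSpace, Finset.mul_sum, Finset.mul_sum]
  refine Finset.sum_le_sum fun T _ => ?_
  obtain ⟨c, hcT, hTc, -⟩ := hq.exists_center hd hσ T.2
  exact h _ c _ T (meshSize_pos hd T.2) hcT hTc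

theorem exists_norm_sub_piecewiseConst_sq_le (hd : 0 < d) (hΩb : Bornology.IsBounded Ω) (r : ℕ)
    {σ b : ℝ} (hσ : 0 < σ) (hb1 : 1 < b) (hb2 : b ≤ 2) (hbd : 0 ≤ 2 + (d : ℝ) - 2 * d / b) :
    ∃ C : ℝ, 0 < C ∧ ∀ 𝒯 : Triangulation Ω, 𝒯.IsQuasiUniform σ → ∀ w : 𝒯.femSpace r,
      ∃ a : 𝒯.elements → ℝ,
        ‖w - piecewiseConst a‖ ^ 2 ≤ C * (∫ x in Ω, ‖𝒯.gradL2 r w x‖ ^ b) ^ (2 / b) := by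
  obtain ⟨C, hC, h⟩ := exists_setIntegral_polyEval_sub_sq_le d r (D := Metric.diam Ω) hσ hb1 hbd
  have hb0 : 0 < b := by linarith
  have hexp : 1 ≤ 2 / b := (one_le_div hb0).2 hb2
  refine ⟨C, hC, fun 𝒯 hq w => ?_⟩
  choose c hcT hTc _ using fun T : 𝒯.elements => hq.exists_center hd hσ T.2
  refine ⟨fun T => polyEval (family w T).1 (c T), ?_⟩
  rw [norm_sq_femSpace, setIntegral_comp_gradL2 w
    (continuous_norm.rpow_const fun _ => Or.inr hb0.le : Continuous fun y : Space d => ‖y‖ ^ b)]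
  refine le_trans ?_ (mul_le_mul_of_nonneg_left (sum_rpow_le_rpow_sum Finset.univ
    (fun T => integral_nonneg fun _ => Real.rpow_nonneg (norm_nonneg _) _) hexp) hC.le)
  rw [Finset.mul_sum]
  refine Finset.sum_le_sum fun T _ => le_of_eq_of_le ?_ (h (family w T) (c T) _ T
    (meshSize_pos hd T.2) (meshSize_le_diam hΩb) (hcT T) (hTc T))
  simp only [map_sub, Pi.sub_apply, Submodule.coe_sub, family_piecewiseConst, polyEval_apply,
    MvPolynomial.eval_C]

theorem exists_norm_oscillation_gradL2_le (hd : 0 < d) (hΩb : Bornology.IsBounded Ω) (r : ℕ)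
    {σ b : ℝ} (hσ : 0 < σ) (hb1 : 1 < b) (hb2 : b ≤ 2) (hbd : 0 ≤ 2 + (d : ℝ) - 2 * d / b) :
    ∃ C : ℝ, 0 < C ∧ ∀ 𝒯 : Triangulation Ω, 𝒯.IsQuasiUniform σ → ∀ w : 𝒯.femSpace r,
      ‖oscillation (𝒯.gradL2 r) w‖ ^ b ≤ C * ∫ x in Ω, ‖𝒯.gradL2 r w x‖ ^ b := by
  obtain ⟨C, hC, h⟩ := exists_norm_sub_piecewiseConst_sq_le hd hΩb r hσ hb1 hb2 hbd
  have hb0 : 0 < b := by linarith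
  refine ⟨C ^ (b / 2), by positivity, fun 𝒯 hq w => ?_⟩
  obtain ⟨a, ha⟩ := h 𝒯 hq w
  have hI : 0 ≤ ∫ x in Ω, ‖𝒯.gradL2 r w x‖ ^ b :=
    integral_nonneg fun _ => Real.rpow_nonneg (norm_nonneg _) _
  calc ‖oscillation (𝒯.gradL2 r) w‖ ^ b
      ≤ ‖w - piecewiseConst a‖ ^ b := Real.rpow_le_rpow (norm_nonneg _)
        (norm_oscillation_le w (gradL2_piecewiseConst a)) hb0.le
    _ = (‖w - piecewiseConst a‖ ^ 2) ^ (b / 2) := by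
        rw [← Real.rpow_natCast_mul (norm_nonneg _), Nat.cast_ofNat, mul_div_cancel₀ b two_ne_zero]
    _ ≤ (C * (∫ x in Ω, ‖𝒯.gradL2 r w x‖ ^ b) ^ (2 / b)) ^ (b / 2) := by gcongr
    _ = C ^ (b / 2) * ∫ x in Ω, ‖𝒯.gradL2 r w x‖ ^ b := by
        rw [Real.mul_rpow hC.le (by positivity), ← Real.rpow_mul hI,
          show 2 / b * (b / 2) = 1 by field_simp, Real.rpow_one]

end Triangulation

section Segments

theorem sq_lintegral_le {X : Type*} [MeasurableSpace X] (ν : Measure X) [IsProbabilityMeasure ν]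
    {f : X → ℝ≥0∞} (hf : AEMeasurable f ν) : (∫⁻ x, f x ∂ν) ^ 2 ≤ ∫⁻ x, f x ^ 2 ∂ν := by
  have holder := ENNReal.lintegral_mul_le_Lp_mul_Lq ν Real.HolderConjugate.two_two hf
    (aemeasurable_const (b := (1 : ℝ≥0∞)))
  simp only [Pi.mul_apply, mul_one, lintegral_const, measure_univ, ENNReal.rpow_two, one_pow,
    ENNReal.one_rpow] at holder
  calc (∫⁻ x, f x ∂ν) ^ 2 ≤ ((∫⁻ x, f x ^ 2 ∂ν) ^ (1 / 2 : ℝ)) ^ 2 := by gcongr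
    _ = ∫⁻ x, f x ^ 2 ∂ν := by
        rw [← ENNReal.rpow_mul_natCast, Nat.cast_ofNat, one_div_mul_cancel two_ne_zero,
          ENNReal.rpow_one]

variable {d : ℕ}

theorem lintegral_comp_add_smul_le {F : Space d → ℝ≥0∞} (hF : Measurable F) (a : Space d) {s : ℝ}
    (hs : 1 / 2 ≤ s) : ∫⁻ x, F (a + s • x) ≤ 2 ^ d * ∫⁻ x, F x := by
  have hs0 : 0 < s := one_half_pos.trans_le hs
  have hinv : |(s ^ d)⁻¹| ≤ 2 ^ d := by
    rw [abs_of_pos (by positivity), ← inv_pow]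
    gcongr
    exact (inv_le_comm₀ hs0 two_pos).2 (by linarith)
  calc ∫⁻ x, F (a + s • x) = ∫⁻ y, F (a + y) ∂(Measure.map (s • ·) volume) :=
        (lintegral_map (hF.comp (measurable_const_add a)) (measurable_const_smul s)).symm
    _ = ENNReal.ofReal |(s ^ d)⁻¹| * ∫⁻ x, F x := by
        rw [Measure.map_addHaar_smul _ hs0.ne', lintegral_smul_measure,
          lintegral_add_left_eq_self F a, finrank_euclideanSpace_fin, smul_eq_mul]
    _ ≤ ENNReal.ofReal (2 ^ d) * ∫⁻ x, F x := by gcongr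
    _ = 2 ^ d * ∫⁻ x, F x := by rw [ENNReal.ofReal_pow zero_le_two, ENNReal.ofReal_ofNat]

/-- The mean of a function over the segment joining two points. -/
def segmentMean (F : Space d → ℝ≥0∞) (x y : Space d) : ℝ≥0∞ :=
  ∫⁻ s in Ioc (0 : ℝ) 1, F (y + s • (x - y))

theorem measurable_segmentMean {F : Space d → ℝ≥0∞} (hF : Measurable F) :
    Measurable fun z : Space d × Space d => segmentMean F z.1 z.2 :=
  Measurable.lintegral_prod_right'
    (f := fun q : (Space d × Space d) × ℝ => F (q.1.2 + q.2 • (q.1.1 - q.1.2)))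
    (hF.comp (by fun_prop))

theorem setLIntegral_setLIntegral_comp_add_smul_le {F : Space d → ℝ≥0∞} (hF : Measurable F)
    (A B : Set (Space d)) (a : Space d → Space d) {s : ℝ} (hs : 1 / 2 ≤ s) :
    ∫⁻ y in B, ∫⁻ x in A, F (a y + s • x) ≤ volume B * (2 ^ d * ∫⁻ x, F x) :=
  calc ∫⁻ y in B, ∫⁻ x in A, F (a y + s • x) ≤ ∫⁻ _ in B, 2 ^ d * ∫⁻ x, F x :=
        lintegral_mono fun _ =>
          (setLIntegral_le_lintegral _ _).trans (lintegral_comp_add_smul_le hF _ hs)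
    _ = volume B * (2 ^ d * ∫⁻ x, F x) := by rw [setLIntegral_const, mul_comm]

/-- On the half of the segment near `x` the change of variables in `x` is nondegenerate, on the
other half the one in `y` is. -/
theorem lintegral_comp_segment_le {F : Space d → ℝ≥0∞} (hF : Measurable F) {A B : Set (Space d)}
    {m : ℝ≥0∞} (hA : volume A ≤ m) (hB : volume B ≤ m) (s : ℝ) :
    ∫⁻ z : Space d × Space d, F (z.2 + s • (z.1 - z.2))
        ∂((volume.restrict A).prod (volume.restrict B)) ≤ m * (2 ^ d * ∫⁻ x, F x) := by
  have hmeas : Measurable fun z : Space d × Space d => F (z.2 + s • (z.1 - z.2)) :=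
    hF.comp (by fun_prop)
  rcases le_total (1 / 2) s with h | h
  · have hsplit (x y : Space d) : y + s • (x - y) = (1 - s) • y + s • x := by module
    rw [lintegral_prod_symm _ hmeas.aemeasurable]
    simp only [hsplit]
    exact (setLIntegral_setLIntegral_comp_add_smul_le hF A B _ h).trans (by gcongr)
  · have hsplit (x y : Space d) : y + s • (x - y) = s • x + (1 - s) • y := by module
    rw [lintegral_prod _ hmeas.aemeasurable]
    simp only [hsplit]
    exact (setLIntegral_setLIntegral_comp_add_smul_le hF B A _ (by linarith)).trans (by gcongr)

theorem lintegral_segmentMean_le {F : Space d → ℝ≥0∞} (hF : Measurable F) {A B : Set (Space d)}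
    {m : ℝ≥0∞} (hA : volume A ≤ m) (hB : volume B ≤ m) :
    ∫⁻ z : Space d × Space d, segmentMean F z.1 z.2
        ∂((volume.restrict A).prod (volume.restrict B)) ≤ m * (2 ^ d * ∫⁻ x, F x) := by
  have hmeas : Measurable fun q : (Space d × Space d) × ℝ => F (q.1.2 + q.2 • (q.1.1 - q.1.2)) :=
    hF.comp (by fun_prop)
  unfold segmentMean
  rw [lintegral_lintegral_swap hmeas.aemeasurable]
  calc _ ≤ ∫⁻ _ in Ioc (0 : ℝ) 1, m * (2 ^ d * ∫⁻ x, F x) :=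
        lintegral_mono fun s => lintegral_comp_segment_le hF hA hB s
    _ = m * (2 ^ d * ∫⁻ x, F x) := by simp

theorem enorm_sub_sq_le_segmentMean {u : Space d → ℝ} {u' : Space d → Space d →L[ℝ] ℝ}
    (hu : ∀ x, HasFDerivAt u (u' x) x) (hu' : Continuous u') (x y : Space d) :
    ‖u x - u y‖ₑ ^ 2 ≤ ‖x - y‖ₑ ^ 2 * segmentMean (fun z => ‖u' z‖ₑ ^ 2) x y := by
  have hderiv (s : ℝ) : HasDerivAt (fun s : ℝ => u (y + s • (x - y)))
      (u' (y + s • (x - y)) (x - y)) s :=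
    (hu _).comp_hasDerivAt s (by
      simpa using ((hasDerivAt_id s).smul_const (x - y)).const_add y)
  have hcont : Continuous fun s : ℝ => u' (y + s • (x - y)) := hu'.comp (by fun_prop)
  have ftc : ∫ s in Ioc (0 : ℝ) 1, u' (y + s • (x - y)) (x - y) = u x - u y := by
    rw [← intervalIntegral.integral_of_le zero_le_one,
      intervalIntegral.integral_eq_sub_of_hasDerivAt (fun s _ => hderiv s)
        ((hcont.clm_apply continuous_const).intervalIntegrable _ _)]
    simp only [one_smul, zero_smul, add_zero, add_sub_cancel]
  have : IsProbabilityMeasure (volume.restrict (Ioc (0 : ℝ) 1)) := ⟨by simp⟩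
  calc ‖u x - u y‖ₑ ^ 2
      ≤ (∫⁻ s in Ioc (0 : ℝ) 1, ‖x - y‖ₑ * ‖u' (y + s • (x - y))‖ₑ) ^ 2 := by
        rw [← ftc]
        gcongr
        refine (enorm_integral_le_lintegral_enorm _).trans (lintegral_mono fun s => ?_)
        rw [mul_comm]
        exact ContinuousLinearMap.le_opENorm _ _
    _ ≤ ∫⁻ s in Ioc (0 : ℝ) 1, (‖x - y‖ₑ * ‖u' (y + s • (x - y))‖ₑ) ^ 2 :=
        sq_lintegral_le _ (hcont.enorm.measurable.const_mul _).aemeasurable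
    _ = ‖x - y‖ₑ ^ 2 * segmentMean (fun z => ‖u' z‖ₑ ^ 2) x y := by
        simp only [mul_pow]
        exact lintegral_const_mul _ (hcont.enorm.measurable.pow_const 2)

end Segments

section WeakGradient

open scoped Convolution

variable {d : ℕ} {T : Set (Space d)} {f : Space d → ℝ} {G : Space d → Space d}

/-- The function `G` is a weak gradient of `f` in `T`. Both are defined on the whole space, so that
they can be convolved with bumps. -/
structure IsWeakGradientOn (T : Set (Space d)) (f : Space d → ℝ) (G : Space d → Space d) :
    Prop where
  measurable_fun : Measurable f
  measurable_grad : Measurable G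
  integrable_fun : Integrable f
  integral_eq : ∀ ψ : Space d → ℝ, IsTestFunction T ψ →
    ∫ x, f x • gradient ψ x = - ∫ x, ψ x • G x

/-- The convolution of a function with a smooth bump. -/
def mollify (η : ContDiffBump (0 : Space d)) (f : Space d → ℝ) : Space d → ℝ :=
  η.normed volume ⋆[ContinuousLinearMap.lsmul ℝ ℝ, volume] f

/-- The average of a nonnegative function, weighted by a smooth bump. -/
def smear (η : ContDiffBump (0 : Space d)) (F : Space d → ℝ≥0∞) (x : Space d) : ℝ≥0∞ :=
  ∫⁻ t, ENNReal.ofReal (η.normed volume (x - t)) * F t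

variable (η : ContDiffBump (0 : Space d))

theorem measurable_smear_kernel {F : Space d → ℝ≥0∞} (hF : Measurable F) :
    Measurable fun q : Space d × Space d => ENNReal.ofReal (η.normed volume (q.1 - q.2)) * F q.2 :=
  (η.continuous_normed.comp (by fun_prop)).measurable.ennreal_ofReal.mul (hF.comp measurable_snd)

theorem measurable_smear {F : Space d → ℝ≥0∞} (hF : Measurable F) : Measurable (smear η F) :=
  (measurable_smear_kernel η hF).lintegral_prod_right'

theorem lintegral_normed : ∫⁻ t : Space d, ENNReal.ofReal (η.normed volume t) = 1 := by
  rw [← ofReal_integral_eq_lintegral_ofReal η.integrable_normed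
    (Eventually.of_forall η.nonneg_normed), η.integral_normed, ENNReal.ofReal_one]

theorem lintegral_smear {F : Space d → ℝ≥0∞} (hF : Measurable F) :
    ∫⁻ x, smear η F x = ∫⁻ x, F x := by
  unfold smear
  rw [lintegral_lintegral_swap (measurable_smear_kernel η hF).aemeasurable]
  refine lintegral_congr fun t => ?_
  have hc : Continuous fun x : Space d => η.normed volume (x - t) :=
    η.continuous_normed.comp (by fun_prop)
  rw [lintegral_mul_const _ hc.measurable.ennreal_ofReal,
    lintegral_sub_right_eq_self (fun x => ENNReal.ofReal (η.normed volume x)) t,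
    lintegral_normed, one_mul]

theorem contDiff_mollify (hf : Integrable f) : ContDiff ℝ 1 (mollify η f) :=
  η.hasCompactSupport_normed.contDiff_convolution_left (n := 1) _ η.contDiff_normed
    hf.locallyIntegrable

theorem isTestFunction_normed_sub {x : Space d} (hx : Metric.closedBall x η.rOut ⊆ T) :
    IsTestFunction T fun t => η.normed volume (x - t) := by
  have hsupp : Function.support (fun t => η.normed volume (x - t)) ⊆
      Metric.closedBall x η.rOut := by
    intro t ht
    have hmem : x - t ∈ Function.support (η.normed volume) := ht
    rw [η.support_normed_eq, mem_ball_zero_iff] at hmem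
    rw [Metric.mem_closedBall', dist_eq_norm]
    exact hmem.le
  refine ⟨η.contDiff_normed.comp (contDiff_const.sub contDiff_id), ?_,
    (closure_minimal hsupp Metric.isClosed_closedBall).trans hx⟩
  exact HasCompactSupport.of_support_subset_isCompact (isCompact_closedBall _ _) hsupp

theorem fderiv_comp_const_sub {k : Space d → ℝ} (hk : ContDiff ℝ 1 k) (x t : Space d) :
    fderiv ℝ (fun t => k (x - t)) t = - fderiv ℝ k (x - t) := by
  have h := ((hk.differentiable one_ne_zero (x - t)).hasFDerivAt).comp t
    ((hasFDerivAt_id t).const_sub x)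
  simpa using! h.fderiv

theorem gradient_comp_const_sub {k : Space d → ℝ} (hk : ContDiff ℝ 1 k) (x t : Space d) :
    gradient (fun t => k (x - t)) t = - gradient k (x - t) := by
  unfold gradient
  rw [fderiv_comp_const_sub hk, map_neg]

theorem continuous_gradient {k : Space d → ℝ} (hk : ContDiff ℝ 1 k) : Continuous (gradient k) :=
  (InnerProductSpace.toDual ℝ (Space d)).symm.continuous.comp (hk.continuous_fderiv one_ne_zero)

theorem integrable_smul_gradient_normed_sub (hf : Integrable f) (x : Space d) :
    Integrable fun t => f t • gradient (η.normed (volume : Measure (Space d))) (x - t) := by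
  have hk : ContDiff ℝ 1 (η.normed (volume : Measure (Space d))) := η.contDiff_normed
  obtain ⟨M, hM⟩ := (η.hasCompactSupport_normed.fderiv ℝ).exists_bound_of_continuous
    (hk.continuous_fderiv one_ne_zero)
  refine hf.smul_bdd M ((continuous_gradient hk).comp (by fun_prop)).aestronglyMeasurable
    (Eventually.of_forall fun t => ?_)
  rw [gradient, LinearIsometryEquiv.norm_map]
  exact hM _

theorem fderiv_mollify_apply (hf : Integrable f) (x v : Space d) :
    fderiv ℝ (mollify η f) x v
      = ∫ t, f t * ⟪gradient (η.normed (volume : Measure (Space d))) (x - t), v⟫ := by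
  have hk : ContDiff ℝ 1 (η.normed (volume : Measure (Space d))) := η.contDiff_normed
  have hderiv := η.hasCompactSupport_normed.hasFDerivAt_convolution_left
    (ContinuousLinearMap.lsmul ℝ ℝ) hk hf.locallyIntegrable x
  have hconv : ConvolutionExistsAt (fderiv ℝ (η.normed (volume : Measure (Space d)))) f x
      ((ContinuousLinearMap.lsmul ℝ ℝ).precompL (Space d)) volume :=
    (η.hasCompactSupport_normed.fderiv ℝ).convolutionExists_left _
      (hk.continuous_fderiv one_ne_zero) hf.locallyIntegrable x
  unfold mollify
  rw [hderiv.fderiv, convolution_eq_swap]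
  refine (ContinuousLinearMap.integral_apply hconv.integrable_swap v).trans ?_
  refine integral_congr_ae (Eventually.of_forall fun t => ?_)
  simp only [ContinuousLinearMap.precompL_apply, ContinuousLinearMap.lsmul_apply, smul_eq_mul,
    gradient, InnerProductSpace.toDual_symm_apply]
  exact mul_comm _ _

theorem IsWeakGradientOn.fderiv_mollify (h : IsWeakGradientOn T f G) {x : Space d}
    (hx : Metric.closedBall x η.rOut ⊆ T) (v : Space d) :
    fderiv ℝ (mollify η f) x v = ⟪∫ t, η.normed volume (x - t) • G t, v⟫ := by
  have hparts := h.integral_eq _ (isTestFunction_normed_sub η hx)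
  simp only [gradient_comp_const_sub η.contDiff_normed, smul_neg, integral_neg, neg_inj]
    at hparts
  rw [fderiv_mollify_apply η h.integrable_fun, ← hparts, real_inner_comm,
    ← integral_inner (integrable_smul_gradient_normed_sub η h.integrable_fun x)]
  exact integral_congr_ae (Eventually.of_forall fun t => by
    simp only [inner_smul_right, real_inner_comm])

theorem IsWeakGradientOn.enorm_fderiv_mollify_sq_le (h : IsWeakGradientOn T f G) {x : Space d}
    (hx : Metric.closedBall x η.rOut ⊆ T) :
    ‖fderiv ℝ (mollify η f) x‖ₑ ^ 2 ≤ smear η (fun t => ‖G t‖ₑ ^ 2) x := by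
  set w : Space d → ℝ≥0∞ := fun t => ENNReal.ofReal (η.normed volume (x - t))
  have hw : Measurable w := (η.continuous_normed.comp (by fun_prop)).measurable.ennreal_ofReal
  have hnorm : ‖fderiv ℝ (mollify η f) x‖ ≤ ‖∫ t, η.normed volume (x - t) • G t‖ := by
    refine ContinuousLinearMap.opNorm_le_bound _ (norm_nonneg _) fun v => ?_
    rw [h.fderiv_mollify η hx]
    exact norm_inner_le_norm _ _
  have : IsProbabilityMeasure (volume.withDensity w) := ⟨by
    rw [withDensity_apply _ MeasurableSet.univ, Measure.restrict_univ,
      lintegral_sub_left_eq_self (fun t => ENNReal.ofReal (η.normed volume t)) x,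
      lintegral_normed]⟩
  calc ‖fderiv ℝ (mollify η f) x‖ₑ ^ 2
      ≤ (∫⁻ t, ‖G t‖ₑ ∂(volume.withDensity w)) ^ 2 := by
        gcongr
        refine (enorm_le_iff_norm_le.2 hnorm).trans ?_
        refine (enorm_integral_le_lintegral_enorm _).trans ?_
        rw [lintegral_withDensity_eq_lintegral_mul _ hw h.measurable_grad.enorm]
        refine lintegral_mono fun t => ?_
        rw [enorm_smul, Pi.mul_apply, Real.enorm_of_nonneg (η.nonneg_normed _)]
    _ ≤ ∫⁻ t, ‖G t‖ₑ ^ 2 ∂(volume.withDensity w) :=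
        sq_lintegral_le _ h.measurable_grad.enorm.aemeasurable
    _ = smear η (fun t => ‖G t‖ₑ ^ 2) x := by
        rw [lintegral_withDensity_eq_lintegral_mul _ hw (h.measurable_grad.enorm.pow_const 2)]
        rfl

variable {c : Space d} {s R : ℝ}

theorem closedBall_segment_subset {ε : ℝ} (hε : ε ≤ s / 2)
    (hstar : ∀ y ∈ Metric.ball c s, StarConvex ℝ y T) {x y : Space d}
    (hx : Metric.closedBall x ε ⊆ T) (hy : y ∈ Metric.ball c (s / 2)) {θ : ℝ} (h0 : 0 ≤ θ)
    (h1 : θ ≤ 1) : Metric.closedBall (y + θ • (x - y)) ε ⊆ T := by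
  intro z hz
  obtain ⟨w, rfl⟩ : ∃ w, z = y + θ • (x - y) + w := ⟨z - (y + θ • (x - y)), by abel⟩
  have hw : ‖w‖ ≤ ε := by simpa using hz
  have hsplit : y + θ • (x - y) + w = (1 - θ) • (y + w) + θ • (x + w) := by module
  rw [hsplit]
  refine hstar (y + w) ?_ (hx ?_) (by linarith) h0 (by ring)
  · rw [Metric.mem_ball, dist_eq_norm] at hy ⊢
    calc ‖y + w - c‖ = ‖(y - c) + w‖ := by congr 1; abel
      _ ≤ ‖y - c‖ + ‖w‖ := norm_add_le _ _
      _ < s := by linarith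
  · simpa using hw

theorem IsWeakGradientOn.enorm_mollify_sub_sq_le (h : IsWeakGradientOn T f G)
    (hη : η.rOut ≤ s / 2) (hTR : T ⊆ Metric.closedBall c R) (hsT : Metric.ball c s ⊆ T)
    (hstar : ∀ y ∈ Metric.ball c s, StarConvex ℝ y T) {x y : Space d}
    (hx : Metric.closedBall x η.rOut ⊆ T) (hy : y ∈ Metric.ball c (s / 2)) :
    ‖mollify η f x - mollify η f y‖ₑ ^ 2 ≤
      ENNReal.ofReal (2 * R) ^ 2 * segmentMean (smear η fun t => ‖G t‖ₑ ^ 2) x y := by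
  have hsmooth := contDiff_mollify η h.integrable_fun
  refine (enorm_sub_sq_le_segmentMean
    (fun x => (hsmooth.differentiable one_ne_zero x).hasFDerivAt)
    (hsmooth.continuous_fderiv one_ne_zero) x y).trans (mul_le_mul' ?_ ?_)
  · have hs : s / 2 ≤ s := by linarith [η.rOut_pos]
    have hxc : dist x c ≤ R := hTR (hx (Metric.mem_closedBall_self η.rOut_pos.le))
    have hyc : dist y c ≤ R := hTR (hsT (Metric.ball_subset_ball hs hy))
    rw [← ofReal_norm, ← dist_eq_norm]
    gcongr
    linarith [dist_triangle_right x y c]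
  · exact setLIntegral_mono' measurableSet_Ioc fun θ hθ => h.enorm_fderiv_mollify_sq_le η
      (closedBall_segment_subset hη hstar hx hy hθ.1.le hθ.2)

/-- Bumps shrinking to the origin, all supported in the ball of radius `s / 2`. -/
def shrinkingBump (hs : 0 < s) (n : ℕ) : ContDiffBump (0 : Space d) where
  rIn := s / (n + 2) / 2
  rOut := s / (n + 2)
  rIn_pos := by positivity
  rIn_lt_rOut := half_lt_self (by positivity)

theorem shrinkingBump_rOut_le (hs : 0 < s) (n : ℕ) :
    (shrinkingBump (d := d) hs n).rOut ≤ s / 2 := by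
  change s / ((n : ℝ) + 2) ≤ s / 2
  gcongr
  exact le_add_of_nonneg_left n.cast_nonneg

theorem tendsto_rOut_shrinkingBump (hs : 0 < s) :
    Tendsto (fun n => (shrinkingBump (d := d) hs n).rOut) atTop (𝓝 0) := by
  change Tendsto (fun n : ℕ => s / ((n : ℝ) + 2)) atTop (𝓝 0)
  exact tendsto_const_nhds.div_atTop
    (tendsto_atTop_add_const_right _ _ tendsto_natCast_atTop_atTop)

theorem ae_tendsto_mollify (hs : 0 < s) (hf : Integrable f) :
    ∀ᵐ x, Tendsto (fun n => mollify (shrinkingBump hs n) f x) atTop (𝓝 (f x)) :=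
  ContDiffBump.ae_convolution_tendsto_right_of_locallyIntegrable (K := 2)
    (tendsto_rOut_shrinkingBump hs)
    (Eventually.of_forall fun n => by
      change s / ((n : ℝ) + 2) ≤ 2 * (s / ((n : ℝ) + 2) / 2)
      linarith) hf.locallyIntegrable

theorem IsWeakGradientOn.ae_enorm_sub_sq_le_liminf (h : IsWeakGradientOn T f G) (hT : IsOpen T)
    (hs : 0 < s) (hTR : T ⊆ Metric.closedBall c R) (hsT : Metric.ball c s ⊆ T)
    (hstar : ∀ y ∈ Metric.ball c s, StarConvex ℝ y T) :
    ∀ᵐ z : Space d × Space d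
        ∂((volume.restrict T).prod (volume.restrict (Metric.ball c (s / 2)))),
      ‖f z.1 - f z.2‖ₑ ^ 2 ≤ liminf (fun n => ENNReal.ofReal (2 * R) ^ 2 *
        segmentMean (smear (shrinkingBump hs n) fun t => ‖G t‖ₑ ^ 2) z.1 z.2) atTop := by
  have hconv := ae_tendsto_mollify hs h.integrable_fun
  filter_upwards [
    Measure.quasiMeasurePreserving_fst.ae (ae_restrict_mem hT.measurableSet),
    Measure.quasiMeasurePreserving_fst.ae (ae_restrict_of_ae hconv),
    Measure.quasiMeasurePreserving_snd.ae (ae_restrict_mem measurableSet_ball),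
    Measure.quasiMeasurePreserving_snd.ae (ae_restrict_of_ae hconv)] with z hxT hx hyB hy
  obtain ⟨ε, hε, hεT⟩ := Metric.isOpen_iff.1 hT _ hxT
  rw [← (ENNReal.Tendsto.pow (hx.sub hy).enorm).liminf_eq]
  refine liminf_le_liminf ?_
  filter_upwards [(tendsto_rOut_shrinkingBump (d := d) hs).eventually (gt_mem_nhds hε)] with n hn
  exact h.enorm_mollify_sub_sq_le _ (shrinkingBump_rOut_le hs n) hTR hsT hstar
    ((Metric.closedBall_subset_ball hn).trans hεT) hyB

theorem IsWeakGradientOn.lintegral_enorm_sub_sq_le (h : IsWeakGradientOn T f G) (hT : IsOpen T)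
    (hs : 0 < s) (hTR : T ⊆ Metric.closedBall c R) (hsT : Metric.ball c s ⊆ T)
    (hstar : ∀ y ∈ Metric.ball c s, StarConvex ℝ y T) :
    ∫⁻ z : Space d × Space d, ‖f z.1 - f z.2‖ₑ ^ 2
        ∂((volume.restrict T).prod (volume.restrict (Metric.ball c (s / 2))))
      ≤ ENNReal.ofReal (2 * R) ^ 2 *
        (volume (Metric.closedBall c R) * (2 ^ d * ∫⁻ x, ‖G x‖ₑ ^ 2)) := by
  have hG2 : Measurable fun t => ‖G t‖ₑ ^ 2 := h.measurable_grad.enorm.pow_const 2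
  have hsmear (n : ℕ) := measurable_smear (shrinkingBump hs n) hG2
  have hball : Metric.ball c (s / 2) ⊆ Metric.closedBall c R :=
    ((Metric.ball_subset_ball (by linarith)).trans hsT).trans hTR
  refine (lintegral_mono_ae (h.ae_enorm_sub_sq_le_liminf hT hs hTR hsT hstar)).trans ?_
  refine (lintegral_liminf_le fun n => (measurable_segmentMean (hsmear n)).const_mul _).trans ?_
  refine liminf_le_of_le (by isBoundedDefault) fun b hb => ?_
  obtain ⟨n, hn⟩ := hb.exists
  refine hn.trans ?_
  rw [lintegral_const_mul _ (measurable_segmentMean (hsmear n)),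
    ← lintegral_smear (shrinkingBump hs n) hG2]
  gcongr
  exact lintegral_segmentMean_le (hsmear n) (measure_mono hTR) (measure_mono hball)

/-- Fubini turns the bound on the mean of `|f x - f y|²` into a good choice of `y`. -/
theorem IsWeakGradientOn.exists_lintegral_enorm_sub_const_le (h : IsWeakGradientOn T f G)
    (hT : IsOpen T) (hs : 0 < s) (hTR : T ⊆ Metric.closedBall c R) (hsT : Metric.ball c s ⊆ T)
    (hstar : ∀ y ∈ Metric.ball c s, StarConvex ℝ y T) :
    ∃ m : ℝ, ∫⁻ x in T, ‖f x - m‖ₑ ^ 2 ≤ (ENNReal.ofReal (2 * R) ^ 2 *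
        (volume (Metric.closedBall c R) * (2 ^ d * ∫⁻ x, ‖G x‖ₑ ^ 2)))
      / volume (Metric.ball c (s / 2)) := by
  have hmeas : Measurable fun z : Space d × Space d => ‖f z.1 - f z.2‖ₑ ^ 2 :=
    (((h.measurable_fun.comp measurable_fst).sub
      (h.measurable_fun.comp measurable_snd)).enorm).pow_const 2
  have hmean := h.lintegral_enorm_sub_sq_le hT hs hTR hsT hstar
  rw [lintegral_prod_symm _ hmeas.aemeasurable] at hmean
  obtain ⟨y, -, hy⟩ := exists_le_setLAverage (μ := (volume : Measure (Space d)))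
    (f := fun y => ∫⁻ x in T, ‖f x - f y‖ₑ ^ 2)
    (Metric.measure_ball_pos volume c (half_pos hs)).ne' measure_ball_lt_top.ne
    (Measurable.lintegral_prod_left' hmeas).aemeasurable
  rw [setLAverage_eq] at hy
  exact ⟨f y, hy.trans (ENNReal.div_le_div_right hmean _)⟩

end WeakGradient

section SobolevApproximation

variable {d : ℕ} {Ω : Set (Space d)}

/-- The weak gradient of a function in `H¹(Ω)`. -/
def weakGrad (φ : H1 Ω) : L2Vec Ω := (φ : WithLp 2 (L2 Ω × L2Vec Ω)).snd

theorem norm_incl_le (φ : H1 Ω) : ‖incl φ‖ ≤ ‖φ‖ := WithLp.norm_fst_le _ _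

theorem norm_weakGrad_le (φ : H1 Ω) : ‖weakGrad φ‖ ≤ ‖φ‖ := WithLp.norm_snd_le _ _

theorem ofReal_setIntegral_norm_sq {E : Type*} [NormedAddCommGroup E] {T : Set (Space d)}
    {f : Space d → E} (hf : IntegrableOn (fun x => ‖f x‖ ^ 2) T) :
    ENNReal.ofReal (∫ x in T, ‖f x‖ ^ 2) = ∫⁻ x in T, ‖f x‖ₑ ^ 2 := by
  rw [ofReal_integral_eq_lintegral_ofReal hf (Eventually.of_forall fun x => by positivity)]
  simp only [ENNReal.ofReal_pow (norm_nonneg _), ofReal_norm]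

theorem IsTestFunction.gradient_eq_zero {T : Set (Space d)} {ψ : Space d → ℝ}
    (hψ : IsTestFunction T ψ) {x : Space d} (hx : x ∉ T) : gradient ψ x = 0 := by
  have hfderiv : fderiv ℝ ψ x = 0 :=
    image_eq_zero_of_notMem_tsupport fun h => hx (hψ.2.2 (tsupport_fderiv_subset ℝ h))
  rw [gradient, hfderiv, map_zero]

theorem isWeakGradientOn_indicator (hΩb : Bornology.IsBounded Ω) (φ : H1 Ω) {T : Set (Space d)}
    (hT : MeasurableSet T) (hTΩ : T ⊆ Ω) :
    IsWeakGradientOn T (T.indicator (incl φ)) (T.indicator (weakGrad φ)) where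
  measurable_fun := (Lp.stronglyMeasurable _).measurable.indicator hT
  measurable_grad := (Lp.stronglyMeasurable _).measurable.indicator hT
  integrable_fun := by
    have : IsFiniteMeasure (volume.restrict Ω) :=
      isFiniteMeasure_restrict.2 hΩb.measure_lt_top.ne
    exact (integrable_indicator_iff hT).2
      (IntegrableOn.mono_set ((Lp.memLp (incl φ)).integrable one_le_two) hTΩ)
  integral_eq ψ hψ := by
    have hzero {x : Space d} (hx : x ∉ T) : ψ x = 0 :=
      image_eq_zero_of_notMem_tsupport fun h => hx (hψ.2.2 h)
    have hparts : ∫ x in Ω, incl φ x • gradient ψ x = - ∫ x in Ω, ψ x • weakGrad φ x :=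
      φ.2 ψ ⟨hψ.1, hψ.2.1, hψ.2.2.trans hTΩ⟩
    rw [setIntegral_eq_integral_of_forall_compl_eq_zero fun x hx => by
        rw [hψ.gradient_eq_zero (notMem_subset hTΩ hx), smul_zero],
      setIntegral_eq_integral_of_forall_compl_eq_zero fun x hx => by
        rw [hzero (notMem_subset hTΩ hx), zero_smul]] at hparts
    have hleft (x : Space d) :
        T.indicator (incl φ) x • gradient ψ x = incl φ x • gradient ψ x := by
      by_cases hx : x ∈ T
      · rw [indicator_of_mem hx]
      · rw [hψ.gradient_eq_zero hx, smul_zero, smul_zero]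
    have hright (x : Space d) : ψ x • T.indicator (weakGrad φ) x = ψ x • weakGrad φ x := by
      by_cases hx : x ∈ T
      · rw [indicator_of_mem hx]
      · rw [hzero hx, zero_smul, zero_smul]
    simp only [hleft, hright, hparts]

theorem exists_setLIntegral_enorm_sub_const_le (hΩb : Bornology.IsBounded Ω) (φ : H1 Ω)
    {T : Set (Space d)} (hT : IsOpen T) (hTΩ : T ⊆ Ω) {c : Space d} {s R : ℝ} (hs : 0 < s)
    (hTR : T ⊆ Metric.closedBall c R) (hsT : Metric.ball c s ⊆ T)
    (hstar : ∀ y ∈ Metric.ball c s, StarConvex ℝ y T) :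
    ∃ m : ℝ, ∫⁻ x in T, ‖incl φ x - m‖ₑ ^ 2 ≤ (ENNReal.ofReal (2 * R) ^ 2 *
        (volume (Metric.closedBall c R) * (2 ^ d * ∫⁻ x in T, ‖weakGrad φ x‖ₑ ^ 2)))
      / volume (Metric.ball c (s / 2)) := by
  obtain ⟨m, hm⟩ := (isWeakGradientOn_indicator hΩb φ hT.measurableSet hTΩ
    ).exists_lintegral_enorm_sub_const_le hT hs hTR hsT hstar
  refine ⟨m, le_of_eq_of_le ?_ (hm.trans_eq ?_)⟩
  · exact setLIntegral_congr_fun hT.measurableSet fun x hx => by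
      simp only [indicator_of_mem hx]
  · have hind (x : Space d) : ‖T.indicator (weakGrad φ) x‖ₑ ^ 2
        = T.indicator (fun x => ‖weakGrad φ x‖ₑ ^ 2) x := by
      by_cases hx : x ∈ T <;> simp [hx]
    simp only [hind, lintegral_indicator hT.measurableSet]

theorem exists_setIntegral_sub_const_le (hΩb : Bornology.IsBounded Ω) (φ : H1 Ω)
    {T : Set (Space d)} (hT : IsOpen T) (hTΩ : T ⊆ Ω) {c : Space d} {σ h : ℝ} (hσ : 0 < σ)
    (hh : 0 < h) (hcT : Metric.ball c (σ * h) ⊆ T) (hTc : T ⊆ Metric.closedBall c h)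
    (hstar : ∀ y ∈ Metric.ball c (σ * h), StarConvex ℝ y T) :
    ∃ m : ℝ, ∫ x in T, ‖incl φ x - m‖ ^ 2 ≤
      4 * 2 ^ d * (2 / σ) ^ d * h ^ 2 * ∫ x in T, ‖weakGrad φ x‖ ^ 2 := by
  have : IsFiniteMeasure (volume.restrict Ω) :=
    isFiniteMeasure_restrict.2 hΩb.measure_lt_top.ne
  obtain ⟨m, hm⟩ := exists_setLIntegral_enorm_sub_const_le hΩb φ hT hTΩ (by positivity) hTc hcT
    hstar
  refine ⟨m, ?_⟩
  have hfun : IntegrableOn (fun x => ‖incl φ x - m‖ ^ 2) T :=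
    IntegrableOn.mono_set (((Lp.memLp (incl φ)).sub (memLp_const m)).integrable_norm_pow
      two_ne_zero) hTΩ
  have hgrad : IntegrableOn (fun x => ‖weakGrad φ x‖ ^ 2) T :=
    IntegrableOn.mono_set (integrable_norm_sq _) hTΩ
  have hu := unitVolume_pos d
  have hratio : (2 / σ) ^ d * (σ * h / 2) ^ d = h ^ d := by
    rw [← mul_pow]
    congr 1
    field_simp
  rw [← ofReal_setIntegral_norm_sq hfun, ← ofReal_setIntegral_norm_sq hgrad,
    ← ofReal_measureReal measure_closedBall_lt_top.ne, ← ofReal_measureReal measure_ball_lt_top.ne,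
    volume_real_closedBall c hh.le, volume_real_ball c (by positivity),
    show (2 : ℝ≥0∞) ^ d = ENNReal.ofReal (2 ^ d) by
      rw [ENNReal.ofReal_pow zero_le_two, ENNReal.ofReal_ofNat],
    ← ENNReal.ofReal_pow (by positivity), ← ENNReal.ofReal_mul (by positivity),
    ← ENNReal.ofReal_mul (by positivity), ← ENNReal.ofReal_mul (by positivity),
    ← ENNReal.ofReal_div_of_pos (by positivity),
    ENNReal.ofReal_le_ofReal_iff (by positivity)] at hm
  refine hm.trans_eq ?_
  rw [div_eq_iff (by positivity), ← hratio]
  ring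

namespace Triangulation

variable {𝒯 : Triangulation Ω} {r : ℕ}

theorem norm_sq_eq_sum {E : Type*} [NormedAddCommGroup E] [InnerProductSpace ℝ E]
    (u : Lp E 2 (volume.restrict Ω)) (𝒯 : Triangulation Ω) :
    ‖u‖ ^ 2 = ∑ T : 𝒯.elements, ∫ x in (T : Set (Space d)), ‖u x‖ ^ 2 := by
  rw [L2_norm_sq_eq_integral, setIntegral_eq_sum_of_integrableOn
    fun T => IntegrableOn.mono_set (integrable_norm_sq _) (𝒯.subset _ T.2)]

theorem norm_sub_piecewiseConst_sq (u : L2 Ω) (a : 𝒯.elements → ℝ) :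
    ‖u - (piecewiseConst (r := r) a : L2 Ω)‖ ^ 2
      = ∑ T : 𝒯.elements, ∫ x in (T : Set (Space d)), ‖u x - a T‖ ^ 2 := by
  rw [norm_sq_eq_sum _ 𝒯]
  refine Finset.sum_congr rfl fun T _ => integral_congr_ae ?_
  have hsub := 𝒯.subset _ T.2
  filter_upwards [ae_restrict_of_ae_restrict_of_subset hsub (Lp.coeFn_sub u _),
    ae_restrict_of_ae_restrict_of_subset hsub (coeFn_femSpace (piecewiseConst (r := r) a)),
    ae_restrict_mem (𝒯.isOpen _ T.2).measurableSet] with x hx hconst hxT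
  rw [hx, Pi.sub_apply, hconst, polyFun_of_mem _ T hxT, family_piecewiseConst,
    MvPolynomial.eval_C]

theorem exists_norm_incl_sub_piecewiseConst_sq_le (hd : 0 < d) (hΩb : Bornology.IsBounded Ω)
    (r : ℕ) {σ : ℝ} (hσ : 0 < σ) (hq : 𝒯.IsQuasiUniform σ) (φ : H1 Ω) :
    ∃ a : 𝒯.elements → ℝ, ‖incl φ - (piecewiseConst (r := r) a : L2 Ω)‖ ^ 2
      ≤ 4 * 2 ^ d * (2 / σ) ^ d * 𝒯.meshSize ^ 2 * ‖φ‖ ^ 2 := by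
  have hlocal (T : 𝒯.elements) : ∃ m : ℝ, ∫ x in (T : Set (Space d)), ‖incl φ x - m‖ ^ 2 ≤
      4 * 2 ^ d * (2 / σ) ^ d * 𝒯.meshSize ^ 2 *
        ∫ x in (T : Set (Space d)), ‖weakGrad φ x‖ ^ 2 := by
    obtain ⟨c, hcT, hTc, hstar⟩ := hq.exists_center hd hσ T.2
    exact exists_setIntegral_sub_const_le hΩb φ (𝒯.isOpen _ T.2) (𝒯.subset _ T.2) hσ
      (meshSize_pos hd T.2) hcT hTc hstar
  choose a ha using hlocal
  refine ⟨a, ?_⟩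
  calc ‖incl φ - (piecewiseConst (r := r) a : L2 Ω)‖ ^ 2
      ≤ 4 * 2 ^ d * (2 / σ) ^ d * 𝒯.meshSize ^ 2 * ‖weakGrad φ‖ ^ 2 := by
        rw [norm_sub_piecewiseConst_sq, norm_sq_eq_sum _ 𝒯, Finset.mul_sum]
        exact Finset.sum_le_sum fun T _ => ha T
    _ ≤ 4 * 2 ^ d * (2 / σ) ^ d * 𝒯.meshSize ^ 2 * ‖φ‖ ^ 2 := by
        gcongr
        exact norm_weakGrad_le φ

theorem norm_proj_le (u : L2 Ω) : ‖𝒯.proj r u‖ ≤ ‖u‖ :=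
  Submodule.norm_orthogonalProjectionOnto_apply_le _ _

theorem proj_sub (u v : L2 Ω) : 𝒯.proj r (u - v) = 𝒯.proj r u - 𝒯.proj r v :=
  map_sub (𝒯.femSpace r).orthogonalProjectionOnto u v

theorem proj_coe (w : 𝒯.femSpace r) : 𝒯.proj r (w : L2 Ω) = w :=
  Submodule.orthogonalProjectionOnto_mem_subspace_eq_self w

/-- Subtracting a piecewise constant does not change the elementwise gradient, so the factor
`h⁻¹` of the inverse inequality is compensated by the first order approximation of `φ`. -/
theorem exists_norm_gradL2_proj_le (hd : 0 < d) (hΩb : Bornology.IsBounded Ω) (r : ℕ) {σ : ℝ}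
    (hσ : 0 < σ) : ∃ C : ℝ, 0 < C ∧ ∀ 𝒯 : Triangulation Ω, 𝒯.IsQuasiUniform σ →
      ∀ φ : H1 Ω, ‖𝒯.gradL2 r (𝒯.proj r (incl φ))‖ ^ 2 ≤ C * ‖φ‖ ^ 2 := by
  obtain ⟨C, hC, hinv⟩ := exists_inverse_le_femSpace hd r hσ
  refine ⟨C * (4 * 2 ^ d * (2 / σ) ^ d), by positivity, fun 𝒯 hq φ => ?_⟩
  rcases isEmpty_or_nonempty 𝒯.elements with hempty | ⟨⟨T, hT⟩⟩
  · rw [norm_sq_gradL2, Finset.univ_eq_empty, Finset.sum_empty]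
    positivity
  have hh := meshSize_pos hd hT
  obtain ⟨a, ha⟩ := exists_norm_incl_sub_piecewiseConst_sq_le hd hΩb r hσ hq φ
  set e : L2 Ω := incl φ - (piecewiseConst (r := r) a : L2 Ω)
  have hgrad : 𝒯.gradL2 r (𝒯.proj r (incl φ)) = 𝒯.gradL2 r (𝒯.proj r e) := by
    rw [proj_sub, proj_coe, map_sub, gradL2_piecewiseConst, sub_zero]
  refine le_of_mul_le_mul_left ?_ (by positivity : 0 < 𝒯.meshSize ^ 2)
  calc 𝒯.meshSize ^ 2 * ‖𝒯.gradL2 r (𝒯.proj r (incl φ))‖ ^ 2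
      ≤ C * ‖𝒯.proj r e‖ ^ 2 := by
        rw [hgrad]
        exact hinv 𝒯 hq _
    _ ≤ C * ‖e‖ ^ 2 := by
        gcongr
        exact norm_proj_le e
    _ ≤ C * (4 * 2 ^ d * (2 / σ) ^ d * 𝒯.meshSize ^ 2 * ‖φ‖ ^ 2) := by gcongr
    _ = 𝒯.meshSize ^ 2 * (C * (4 * 2 ^ d * (2 / σ) ^ d) * ‖φ‖ ^ 2) := by ring

end Triangulation

end SobolevApproximation

section LimitSuperior

variable {p S P Q : ℝ → ℝ} {e C : ℝ}

theorem eventually_le_limsup_add_one {u : ℝ → ℝ}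
    (h : limsup (fun t => ENNReal.ofReal (u t)) atTop ≠ ⊤) :
    ∀ᶠ t in atTop, u t ≤ (limsup (fun t => ENNReal.ofReal (u t)) atTop).toReal + 1 := by
  have hlt : limsup (fun t => ENNReal.ofReal (u t)) atTop <
      ENNReal.ofReal ((limsup (fun t => ENNReal.ofReal (u t)) atTop).toReal + 1) := by
    rw [ENNReal.ofReal_add ENNReal.toReal_nonneg zero_le_one, ENNReal.ofReal_toReal h,
      ENNReal.ofReal_one]
    exact ENNReal.lt_add_right h one_ne_zero
  filter_upwards [eventually_lt_of_limsup_lt hlt] with t ht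
  exact (ENNReal.ofReal_lt_ofReal_iff'.1 ht).1.le

theorem ofReal_mul_one_add_rpow_add_add {l lP lQ : ℝ≥0∞} (hC : 0 ≤ C) (he : 0 ≤ e) (hl : l ≠ ⊤)
    (hlP : lP ≠ ⊤) (hlQ : lQ ≠ ⊤) :
    ENNReal.ofReal (C * (1 + l.toReal ^ e + lP.toReal + lQ.toReal))
      = ENNReal.ofReal C * (1 + l ^ e + lP + lQ) := by
  rw [ENNReal.ofReal_mul hC, ENNReal.ofReal_add (by positivity) ENNReal.toReal_nonneg,
    ENNReal.ofReal_add (by positivity) ENNReal.toReal_nonneg,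
    ENNReal.ofReal_add zero_le_one (by positivity), ENNReal.ofReal_one,
    ← ENNReal.ofReal_rpow_of_nonneg ENNReal.toReal_nonneg he, ENNReal.ofReal_toReal hl,
    ENNReal.ofReal_toReal hlP, ENNReal.ofReal_toReal hlQ]

theorem limsup_ofReal_le_of_eventually_le (hC : 0 < C) (he : 1 ≤ e) (he2 : e ≤ 2)
    (h : ∀ {L LP LQ : ℝ}, 0 ≤ L → 0 ≤ LP → 0 ≤ LQ → (∀ᶠ t in atTop, S t ≤ L) →
      (∀ᶠ t in atTop, P t ≤ LP) → (∀ᶠ t in atTop, Q t ≤ LQ) →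
      ∀ᶠ t in atTop, p t ≤ C * (1 + L ^ e + LP + LQ)) :
    limsup (fun t => ENNReal.ofReal (p t)) atTop ≤ ENNReal.ofReal (C * 5) *
      (1 + limsup (fun t => ENNReal.ofReal (S t)) atTop ^ e
        + limsup (fun t => ENNReal.ofReal (P t)) atTop
        + limsup (fun t => ENNReal.ofReal (Q t)) atTop) := by
  have he0 : 0 < e := by linarith
  have htop : ENNReal.ofReal (C * 5) * ⊤ = ⊤ :=
    ENNReal.mul_top (ENNReal.ofReal_pos.2 (by positivity)).ne'
  by_cases hS : limsup (fun t => ENNReal.ofReal (S t)) atTop = ⊤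
  · simp only [hS, ENNReal.top_rpow_of_pos he0, add_top, top_add, htop, le_top]
  by_cases hP : limsup (fun t => ENNReal.ofReal (P t)) atTop = ⊤
  · simp only [hP, add_top, top_add, htop, le_top]
  by_cases hQ : limsup (fun t => ENNReal.ofReal (Q t)) atTop = ⊤
  · simp only [hQ, add_top, htop, le_top]
  have hev := h (by positivity) (by positivity) (by positivity) (eventually_le_limsup_add_one hS)
    (eventually_le_limsup_add_one hP) (eventually_le_limsup_add_one hQ)
  rw [← ofReal_mul_one_add_rpow_add_add (by positivity) he0.le hS hP hQ]
  set lS := (limsup (fun t => ENNReal.ofReal (S t)) atTop).toReal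
  set lP := (limsup (fun t => ENNReal.ofReal (P t)) atTop).toReal
  set lQ := (limsup (fun t => ENNReal.ofReal (Q t)) atTop).toReal
  have hlS : 0 ≤ lS := ENNReal.toReal_nonneg
  have hlP : 0 ≤ lP := ENNReal.toReal_nonneg
  have hlQ : 0 ≤ lQ := ENNReal.toReal_nonneg
  have hpow : (lS + 1) ^ e ≤ 2 * (lS ^ e + 1) := by
    simpa only [Real.one_rpow] using add_rpow_le_two_mul hlS zero_le_one he he2
  have hconst : 1 + (lS + 1) ^ e + (lP + 1) + (lQ + 1) ≤ 5 * (1 + lS ^ e + lP + lQ) := by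
    linarith [Real.rpow_nonneg hlS e]
  refine limsup_le_of_le (h := ?_)
  filter_upwards [hev] with t ht
  refine ENNReal.ofReal_le_ofReal (ht.trans ?_)
  rw [mul_assoc]
  gcongr

end LimitSuperior

section SemidiscreteProblem

variable {d : ℕ} {Ω : Set (Space d)}

namespace Data

variable (D : Data Ω)

theorem continuousOn_φ : ContinuousOn D.φ (Ici 0) :=
  fun t ht => (D.hasDeriv_φ t ht).continuousWithinAt

theorem continuousOn_ftil : ContinuousOn D.ftil (Ici 0) :=
  fun t ht => (D.hasDeriv_ftil t ht).continuousWithinAt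

theorem size_nonneg (g : Law) (t : ℝ) : 0 ≤ D.size g t :=
  add_nonneg (Real.rpow_nonneg (norm_nonneg _) _) (sq_nonneg _)

theorem norm_ρtil₀_sq_le : ‖D.ρtil₀‖ ^ 2 ≤ 2 * (‖D.ρ₀‖ ^ 2 + ‖incl (D.φ 0)‖ ^ 2) := by
  have htriangle : ‖D.ρtil₀‖ ≤ ‖D.ρ₀‖ + ‖incl (D.φ 0)‖ :=
    (norm_sub_le _ _).trans (add_le_add_left (norm_incl_le D.ρ₀) _)
  exact (pow_le_pow_left₀ (norm_nonneg _) htriangle 2).trans add_sq_le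

variable {D} {g : Law} {G : ℝ → ℝ} {t₀ t : ℝ}

theorem IsEnvelope.rpow_nonneg (hG : D.IsEnvelope g G) (e : ℝ) {s : ℝ} (hs : 0 ≤ s) :
    0 ≤ G s ^ e :=
  Real.rpow_nonneg ((D.size_nonneg g s).trans (hG.2.2 s hs)) _

theorem IsEnvelope.initial_integral_nonneg (hG : D.IsEnvelope g G) (ht₀ : 0 ≤ t₀) :
    0 ≤ ∫ s in (0 : ℝ)..t₀, (‖D.φt s‖ ^ 2 + G s ^ (2 / g.β)) :=
  intervalIntegral.integral_nonneg ht₀ fun _ hs =>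
    add_nonneg (sq_nonneg _) (hG.rpow_nonneg _ hs.1)

theorem IsEnvelope.weighted_integral_nonneg (hG : D.IsEnvelope g G) (ht : 0 ≤ t) :
    0 ≤ ∫ s in (0 : ℝ)..t, Real.exp (-(1 / 4) * (t - s)) *
      (1 + ‖D.ρtil₀‖ ^ 2 + ‖D.φt s‖ ^ 2 + ‖D.ftilt s‖ ^ 2 + G s ^ (2 / g.β)) :=
  intervalIntegral.integral_nonneg ht fun s hs => by
    have := hG.rpow_nonneg (2 / g.β) hs.1
    positivity

theorem IsEnvelope.weighted_integral_mono (hG : D.IsEnvelope g G) {y z : ℝ} (hyz : y ≤ z)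
    (ht : 0 ≤ t) :
    ∫ s in (0 : ℝ)..t, Real.exp (-(1 / 4) * (t - s)) *
        (1 + y + ‖D.φt s‖ ^ 2 + ‖D.ftilt s‖ ^ 2 + G s ^ (2 / g.β))
      ≤ ∫ s in (0 : ℝ)..t, Real.exp (-(1 / 4) * (t - s)) *
        (1 + z + ‖D.φt s‖ ^ 2 + ‖D.ftilt s‖ ^ 2 + G s ^ (2 / g.β)) := by
  have hφt : ContinuousOn (fun s => ‖D.φt s‖ ^ 2) (Ici 0) := D.continuousOn_φt.norm.pow 2
  have hft : ContinuousOn (fun s => ‖D.ftilt s‖ ^ 2) (Ici 0) := D.continuousOn_ftilt.norm.pow 2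
  have hGpow : ContinuousOn (fun s => G s ^ (2 / g.β)) (Ici 0) :=
    hG.1.rpow_const fun _ _ => Or.inr (div_nonneg zero_le_two g.β_pos.le)
  have hint (z : ℝ) : IntervalIntegrable (fun s => Real.exp (-(1 / 4) * (t - s)) *
      (1 + z + ‖D.φt s‖ ^ 2 + ‖D.ftilt s‖ ^ 2 + G s ^ (2 / g.β))) volume 0 t :=
    intervalIntegrable_of_continuousOn_Ici ((Continuous.continuousOn (by fun_prop)).mul
      (((continuousOn_const.add hφt).add hft).add hGpow)) le_rfl ht
  exact intervalIntegral.integral_mono_on ht (hint y) (hint z) fun s _ => by gcongr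

theorem IsEnvelope.bound_nonneg (hG : D.IsEnvelope g G) (ht₀ : 0 < t₀) (ht : t₀ ≤ t) :
    0 ≤ D.bound g G t₀ t := by
  have hinitial := hG.initial_integral_nonneg ht₀.le
  have hweighted := hG.weighted_integral_nonneg (ht₀.le.trans ht)
  unfold bound
  positivity

theorem IsEnvelope.le_two_add_mul_bound (hG : D.IsEnvelope g G) {y H M : ℝ} (hM : 0 ≤ M)
    (hy : y ≤ ‖D.ρtil₀‖ ^ 2) (hH : H ≤ M * ‖D.ρ₀‖ ^ 2) (ht₀ : 0 < t₀) (ht : t₀ ≤ t) :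
    t₀⁻¹ * Real.exp (-(1 / 4) * (t - t₀)) *
        (1 + y + H + ∫ s in (0 : ℝ)..t₀, (‖D.φt s‖ ^ 2 + G s ^ (2 / g.β)))
      + ∫ s in (0 : ℝ)..t, Real.exp (-(1 / 4) * (t - s)) *
        (1 + y + ‖D.φt s‖ ^ 2 + ‖D.ftilt s‖ ^ 2 + G s ^ (2 / g.β))
      ≤ (2 + M) * D.bound g G t₀ t := by
  have hinitial := hG.initial_integral_nonneg ht₀.le
  have hinit : 1 + y + H + ∫ s in (0 : ℝ)..t₀, (‖D.φt s‖ ^ 2 + G s ^ (2 / g.β))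
      ≤ (2 + M) * (1 + ‖D.ρ₀‖ ^ 2 + ‖incl (D.φ 0)‖ ^ 2
        + ∫ s in (0 : ℝ)..t₀, (‖D.φt s‖ ^ 2 + G s ^ (2 / g.β))) := by
    have hslack : 0 ≤ M * (1 + ‖incl (D.φ 0)‖ ^ 2
        + ∫ s in (0 : ℝ)..t₀, (‖D.φt s‖ ^ 2 + G s ^ (2 / g.β))) := by positivity
    linarith [D.norm_ρtil₀_sq_le]
  have hweighted := (hG.weighted_integral_mono hy (ht₀.le.trans ht)).trans
    (le_mul_of_one_le_left (hG.weighted_integral_nonneg (ht₀.le.trans ht))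
      (by linarith : 1 ≤ 2 + M))
  rw [bound, mul_add (2 + M), mul_left_comm]
  gcongr

end Data

theorem Law.embedding_exponent_nonneg (g : Law) (hdeg : g.a ≤ 4 / ((d : ℝ) + 2)) :
    0 ≤ 2 + (d : ℝ) - 2 * d / g.β := by
  have hd : 0 < (d : ℝ) + 2 := by positivity
  rw [le_div_iff₀ hd] at hdeg
  rw [sub_nonneg, div_le_iff₀ g.β_pos, Law.β]
  linarith

/-- The inclusion `H¹(Ω) → L²(Ω)` as a continuous linear map. -/
def inclL : H1 Ω →L[ℝ] L2 Ω := (WithLp.fstL 2 ℝ (L2 Ω) (L2Vec Ω)).comp (H1 Ω).subtypeL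

namespace IsSemidiscreteSolution

variable {𝒯 : Triangulation Ω} {r : ℕ} {g : Law} {D : Data Ω} {ρtil : ℝ → 𝒯.femSpace r}

theorem deriv_eq_velocity (h : IsSemidiscreteSolution g 𝒯 r D ρtil) {t : ℝ} (ht : 0 < t) :
    deriv ρtil t = velocity g (𝒯.gradL2 r) ρtil (fun t => 𝒯.proj r (incl (D.φ t)))
      (fun t => 𝒯.proj r (D.ftil t)) t := by
  refine ext_inner_right ℝ fun w => ?_
  have hflux (u : 𝒯.femSpace r) : ∫ x in Ω, ⟪g.flux (𝒯.gradL2 r u x), 𝒯.gradL2 r w x⟫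
      = ∫ x in Ω, ⟪g.K ‖Triangulation.grad u x‖ • Triangulation.grad u x,
          Triangulation.grad w x⟫ := by
    refine integral_congr_ae ?_
    filter_upwards [Triangulation.coeFn_gradL2 u, Triangulation.coeFn_gradL2 w] with x hu hw
    rw [hu, hw]
    rfl
  rw [velocity, inner_sub_left, inner_diffusion, Law.inner_fluxLp, Triangulation.proj,
    Submodule.inner_orthogonalProjectionOnto_eq_of_mem_right, ← h.equation t ht w, hflux,
    add_sub_cancel_right]

theorem isFlow (h : IsSemidiscreteSolution g 𝒯 r D ρtil) {Cg : ℝ}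
    (hCg : ∀ φ : H1 Ω, ‖𝒯.gradL2 r (𝒯.proj r (incl φ))‖ ^ 2 ≤ Cg * ‖φ‖ ^ 2) :
    IsFlow g (𝒯.gradL2 r) Cg ρtil (fun t => 𝒯.proj r (incl (D.φ t)))
      (fun t => 𝒯.proj r (incl (D.φt t))) (fun t => 𝒯.proj r (D.ftil t))
      (fun t => 𝒯.proj r (D.ftilt t)) (fun t => ‖D.ftil t‖) (fun t => ‖D.φ t‖ ^ 2)
      (fun t => ‖D.φt t‖ ^ 2) (fun t => ‖D.ftilt t‖ ^ 2) where
  continuousOn_ρ := h.continuousOn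
  continuousOn_ψ := ((𝒯.femSpace r).orthogonalProjectionOnto.comp
    (inclL (Ω := Ω))).continuous.comp_continuousOn D.continuousOn_φ
  continuousOn_f :=
    (𝒯.femSpace r).orthogonalProjectionOnto.continuous.comp_continuousOn D.continuousOn_ftil
  hasDerivAt_ρ t ht := by
    rw [← h.deriv_eq_velocity ht]
    exact (h.differentiableAt t ht).hasDerivAt
  hasDerivAt_ψ t ht := ((𝒯.femSpace r).orthogonalProjectionOnto.comp
    (inclL (Ω := Ω))).hasFDerivAt.comp_hasDerivAt t
      ((D.hasDeriv_φ t ht.le).hasDerivAt (Ici_mem_nhds ht))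
  hasDerivAt_f t ht := (𝒯.femSpace r).orthogonalProjectionOnto.hasFDerivAt.comp_hasDerivAt t
    ((D.hasDeriv_ftil t ht.le).hasDerivAt (Ici_mem_nhds ht))
  norm_f_le t := Triangulation.norm_proj_le _
  norm_ft_sq_le t := by
    gcongr
    exact Triangulation.norm_proj_le _
  norm_grad_ψ_sq_le t := hCg _
  norm_grad_ψt_sq_le t := hCg _

theorem norm_oscillation_zero_sq_le (h : IsSemidiscreteSolution g 𝒯 r D ρtil) :
    ‖oscillation (𝒯.gradL2 r) (ρtil 0)‖ ^ 2 ≤ ‖D.ρtil₀‖ ^ 2 := by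
  have hosc := norm_oscillation_le (ρtil 0) (map_zero (𝒯.gradL2 r))
  rw [sub_zero, h.initial] at hosc
  rw [h.initial]
  gcongr
  exact hosc.trans (Triangulation.norm_proj_le _)

theorem energy_zero_le (h : IsSemidiscreteSolution g 𝒯 r D ρtil) {Cg : ℝ}
    (hCg : ∀ φ : H1 Ω, ‖𝒯.gradL2 r (𝒯.proj r (incl φ))‖ ^ 2 ≤ Cg * ‖φ‖ ^ 2) :
    g.energy (𝒯.gradL2 r (ρtil 0 + 𝒯.proj r (incl (D.φ 0))))
      ≤ 1 / g.coeff 0 * Cg * ‖D.ρ₀‖ ^ 2 := by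
  have ha := g.coeff_zero_pos
  rw [h.initial, Data.ρtil₀, Triangulation.proj_sub, sub_add_cancel, mul_assoc]
  calc g.energy (𝒯.gradL2 r (𝒯.proj r (incl D.ρ₀)))
      ≤ 1 / g.coeff 0 * ‖𝒯.gradL2 r (𝒯.proj r (incl D.ρ₀))‖ ^ 2 :=
        (g.energy_le _).trans (g.inner_fluxLp_self_le _)
    _ ≤ 1 / g.coeff 0 * (Cg * ‖D.ρ₀‖ ^ 2) := by
        gcongr
        exact hCg _

end IsSemidiscreteSolution

theorem exists_energySystem_of_isQuasiUniform (hd : 0 < d) (g : Law)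
    (hdeg : g.a ≤ 4 / ((d : ℝ) + 2)) (hΩb : Bornology.IsBounded Ω) (r : ℕ) {σ : ℝ} (hσ : 0 < σ) :
    ∃ c C : ℝ, 0 < c ∧ 0 < C ∧ ∀ 𝒯 : Triangulation Ω, 𝒯.IsQuasiUniform σ →
      ∀ (D : Data Ω) (ρtil : ℝ → 𝒯.femSpace r), IsSemidiscreteSolution g 𝒯 r D ρtil →
        EnergySystem g.β c C (fun t => ‖oscillation (𝒯.gradL2 r) (ρtil t)‖ ^ 2)
          (fun t => g.energy (𝒯.gradL2 r (ρtil t + 𝒯.proj r (incl (D.φ t)))))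
          (fun t => ‖velocity g (𝒯.gradL2 r) ρtil (fun t => 𝒯.proj r (incl (D.φ t)))
            (fun t => 𝒯.proj r (D.ftil t)) t‖ ^ 2)
          (fun t => ⟪g.fluxLp (𝒯.gradL2 r (ρtil t + 𝒯.proj r (incl (D.φ t)))),
            𝒯.gradL2 r (ρtil t + 𝒯.proj r (incl (D.φ t)))⟫)
          (D.size g) (fun t => ‖D.φt t‖ ^ 2) (fun t => ‖D.ftilt t‖ ^ 2) := by
  have : IsFiniteMeasure (volume.restrict Ω) :=
    isFiniteMeasure_restrict.2 hΩb.measure_lt_top.ne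
  obtain ⟨Cp, hCp, hpoincare⟩ := Triangulation.exists_norm_oscillation_gradL2_le hd hΩb r hσ
    g.one_lt_β g.β_lt_two.le (g.embedding_exponent_nonneg hdeg)
  obtain ⟨Cg, hCg, hproj⟩ := Triangulation.exists_norm_gradL2_proj_le hd hΩb r hσ
  obtain ⟨c, C, hc, hC, hsystem⟩ :=
    IsFlow.exists_energySystem g (volume.restrict Ω) (Space d) hCp hCg
  exact ⟨c, C, hc, hC, fun 𝒯 hq _ _ h => hsystem (hpoincare 𝒯 hq) (h.isFlow (hproj 𝒯 hq))⟩

theorem exists_norm_deriv_sq_le_bound (hd : 0 < d) (g : Law) (hdeg : g.a ≤ 4 / ((d : ℝ) + 2))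
    (hΩb : Bornology.IsBounded Ω) (r : ℕ) {σ : ℝ} (hσ : 0 < σ) :
    ∃ C : ℝ, 0 < C ∧ ∀ 𝒯 : Triangulation Ω, 𝒯.IsQuasiUniform σ →
      ∀ (D : Data Ω) (ρtil : ℝ → 𝒯.femSpace r), IsSemidiscreteSolution g 𝒯 r D ρtil →
        ∀ G : ℝ → ℝ, D.IsEnvelope g G → ∀ t₀ : ℝ, 0 < t₀ → t₀ ≤ 1 → ∀ t : ℝ, t₀ ≤ t →
          ‖deriv ρtil t‖ ^ 2 ≤ C * D.bound g G t₀ t := by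
  obtain ⟨c, C, hc, hC, hsystem⟩ := exists_energySystem_of_isQuasiUniform hd g hdeg hΩb r hσ
  obtain ⟨Cg, hCg, hproj⟩ := Triangulation.exists_norm_gradL2_proj_le hd hΩb r hσ
  obtain ⟨C₁, hC₁, hbound⟩ := EnergySystem.le_bound g.one_lt_β.le g.β_lt_two.le hc hC
  have ha := g.coeff_zero_pos
  refine ⟨C₁ * (2 + 1 / g.coeff 0 * Cg), by positivity,
    fun 𝒯 hq D ρtil h G hG t₀ ht₀ ht₁ t ht => ?_⟩
  rw [h.deriv_eq_velocity (ht₀.trans_le ht), mul_assoc]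
  refine (hbound (hsystem 𝒯 hq D ρtil h) (D.continuousOn_φt.norm.pow 2)
    (D.continuousOn_ftilt.norm.pow 2) hG.1 hG.2.1 hG.2.2 t₀ ht₀ ht₁ t ht).trans ?_
  gcongr
  exact hG.le_two_add_mul_bound (by positivity) h.norm_oscillation_zero_sq_le
    (h.energy_zero_le (hproj 𝒯 hq)) ht₀ ht

theorem exists_limsup_norm_deriv_sq_le (hd : 0 < d) (g : Law) (hdeg : g.a ≤ 4 / ((d : ℝ) + 2))
    (hΩb : Bornology.IsBounded Ω) (r : ℕ) {σ : ℝ} (hσ : 0 < σ) :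
    ∃ C : ℝ, ∀ 𝒯 : Triangulation Ω, 𝒯.IsQuasiUniform σ →
      ∀ (D : Data Ω) (ρtil : ℝ → 𝒯.femSpace r), IsSemidiscreteSolution g 𝒯 r D ρtil →
        limsup (fun t => ENNReal.ofReal (‖deriv ρtil t‖ ^ 2)) atTop ≤
          ENNReal.ofReal C *
            (1 + (limsup (fun t => ENNReal.ofReal (D.size g t)) atTop) ^ (2 / g.β)
              + limsup (fun t => ENNReal.ofReal (‖D.φt t‖ ^ 2)) atTop
              + limsup (fun t => ENNReal.ofReal (‖D.ftilt t‖ ^ 2)) atTop) := by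
  obtain ⟨c, C, hc, hC, hsystem⟩ := exists_energySystem_of_isQuasiUniform hd g hdeg hΩb r hσ
  obtain ⟨C₁, hC₁, hlim⟩ := EnergySystem.eventually_le g.one_lt_β.le g.β_lt_two.le hc hC
  refine ⟨C₁ * 5, fun 𝒯 hq D ρtil h => limsup_ofReal_le_of_eventually_le hC₁
    g.one_le_two_div_β g.two_div_β_le_two fun hL hLP hLQ hS hP hQ => ?_⟩
  filter_upwards [hlim (hsystem 𝒯 hq D ρtil h) hL hLP hLQ hS hP hQ, eventually_gt_atTop 0]
    with t ht ht0
  rwa [h.deriv_eq_velocity ht0]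

end SemidiscreteProblem

theorem theorem4p4_general {d : ℕ} (hd : 0 < d) (g : Law) (hdeg : g.a ≤ 4 / ((d : ℝ) + 2))
    (Ω : Set (Space d)) (hΩb : Bornology.IsBounded Ω) (r : ℕ) (σ : ℝ) (hσ : 0 < σ) :
    ∃ C : ℝ, 0 < C ∧
      ∀ (𝒯 : Triangulation Ω), 𝒯.IsQuasiUniform σ →
      ∀ (D : Data Ω) (ρtil : ℝ → 𝒯.femSpace r), IsSemidiscreteSolution g 𝒯 r D ρtil →
        (∀ G : ℝ → ℝ, D.IsEnvelope g G → ∀ t₀ : ℝ, 0 < t₀ → t₀ < 1 → ∀ t : ℝ, t₀ ≤ t →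
          ‖deriv ρtil t‖ ^ 2 ≤ C * D.bound g G t₀ t) ∧
        limsup (fun t => ENNReal.ofReal (‖deriv ρtil t‖ ^ 2)) atTop ≤
          ENNReal.ofReal C *
            (1 + (limsup (fun t => ENNReal.ofReal (D.size g t)) atTop) ^ (2 / g.β)
              + limsup (fun t => ENNReal.ofReal (‖D.φt t‖ ^ 2)) atTop
              + limsup (fun t => ENNReal.ofReal (‖D.ftilt t‖ ^ 2)) atTop) := by
  obtain ⟨C₁, hC₁, hbound⟩ := exists_norm_deriv_sq_le_bound hd g hdeg hΩb r hσ
  obtain ⟨C₂, hlimsup⟩ := exists_limsup_norm_deriv_sq_le hd g hdeg hΩb r hσ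
  refine ⟨max C₁ C₂, lt_max_of_lt_left hC₁, fun 𝒯 hq D ρtil h => ⟨?_, ?_⟩⟩
  · intro G hG t₀ ht₀ ht₁ t ht
    exact (hbound 𝒯 hq D ρtil h G hG t₀ ht₀ ht₁.le t ht).trans
      (mul_le_mul_of_nonneg_right (le_max_left _ _) (hG.bound_nonneg ht₀ ht))
  · refine (hlimsup 𝒯 hq D ρtil h).trans ?_
    gcongr
    exact le_max_right _ _

end ForchheimerFlow

end

open ForchheimerFlow in
theorem theorem4p4 {d : ℕ} (hd : 2 ≤ d) (g : Law) (hdeg : g.a ≤ 4 / ((d : ℝ) + 2))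
    (Ω : Set (Space d)) (hΩo : IsOpen Ω) (hΩb : Bornology.IsBounded Ω)
    (r : ℕ) (σ : ℝ) (hσ : 0 < σ) :
    ∃ C : ℝ, 0 < C ∧
      ∀ (𝒯 : Triangulation Ω), 𝒯.IsQuasiUniform σ →
      ∀ (D : Data Ω) (ρtil : ℝ → 𝒯.femSpace r), IsSemidiscreteSolution g 𝒯 r D ρtil →
        (∀ G : ℝ → ℝ, D.IsEnvelope g G → ∀ t₀ : ℝ, 0 < t₀ → t₀ < 1 → ∀ t : ℝ, t₀ ≤ t →
          ‖deriv ρtil t‖ ^ 2 ≤ C * D.bound g G t₀ t) ∧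
        limsup (fun t => ENNReal.ofReal (‖deriv ρtil t‖ ^ 2)) atTop ≤
          ENNReal.ofReal C *
            (1 + (limsup (fun t => ENNReal.ofReal (D.size g t)) atTop) ^ (2 / g.β)
              + limsup (fun t => ENNReal.ofReal (‖D.φt t‖ ^ 2)) atTop
              + limsup (fun t => ENNReal.ofReal (‖D.ftilt t‖ ^ 2)) atTop) :=
  theorem4p4_general (by omega) g hdeg Ω hΩb r σ hσ
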